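/- Let $n\ge 1$, and let $C\le SL_n(\mathbb R)$ be the group of diagonal matrices with positive diagonal entries. Give the set of closed subgroups of $SL_n(\mathbb R)$ the Chabauty topology, in which basic open sets are given by finitely many conditions of the form "$H\cap K=\emptyset$" ($K$ compact) and "$H\cap U\neq\emptyset$" ($U$ open). A closed subgroup $L$ is a conjugacy limit of $C$ if there is a sequence $P_k\in SL_n(\mathbb R)$ such that $P_kCP_k^{-1}\to L$ in this topology. Let $Ab(n)$ be the set of $SL_n(\mathbb R)$-conjugacy classes of closed subgroups of $SL_n(\mathbb R)$ that are isomorphic, as topological groups, to $(\mathbb R^{n-1},+)$, and let $Red(n)$ be the set of $SL_n(\mathbb R)$-conjugacy classes of conjugacy limits of $C$. If $n\le 4$, then $Ab(n)=Red(n)$. If $n\ge 5$, then $Red(n)\subsetneq Ab(n)$. -/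

import Mathlib

open Filter Topology
open scoped MatrixGroups

namespace ConjLimit

/-- The Chabauty topology on the set of closed subgroups of a topological group: the topology
generated by the sets of closed subgroups that miss a given compact set and the sets of closed
subgroups that meet a given open set. -/
instance chabautyTopology (G : Type*) [Group G] [TopologicalSpace G] :
    TopologicalSpace (ClosedSubgroup G) :=
  TopologicalSpace.generateFrom
    ({S | ∃ K : Set G, IsCompact K ∧ S = {H : ClosedSubgroup G | (H : Set G) ∩ K = ∅}} ∪
      {S | ∃ U : Set G, IsOpen U ∧ S = {H : ClosedSubgroup G | ((H : Set G) ∩ U).Nonempty}})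

/-- The conjugate `g H g⁻¹` of a closed subgroup `H`. -/
def conj {G : Type*} [Group G] [TopologicalSpace G] [IsTopologicalGroup G]
    (g : G) (H : ClosedSubgroup G) : ClosedSubgroup G where
  toSubgroup := H.toSubgroup.map (MulAut.conj g).toMonoidHom
  isClosed' := by
    have h := ((Homeomorph.mulLeft g).trans (Homeomorph.mulRight g⁻¹)).isClosedMap _ H.isClosed'
    exact h

/-- Two closed subgroups are equivalent when one is conjugate to the other. -/
def conjSetoid (G : Type*) [Group G] [TopologicalSpace G] [IsTopologicalGroup G] :
    Setoid (ClosedSubgroup G) where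
  r H L := ∃ g : G, conj g H = L
  iseqv := by
    have key : ∀ (g h : G) (H : ClosedSubgroup G), conj g (conj h H) = conj (g * h) H := by
      intro g h H
      apply ClosedSubgroup.toSubgroup_injective
      change (H.toSubgroup.map _).map _ = H.toSubgroup.map _
      rw [Subgroup.map_map]
      congr 1
      ext x
      simp [mul_assoc]
    have one : ∀ H : ClosedSubgroup G, conj 1 H = H := by
      intro H
      apply ClosedSubgroup.toSubgroup_injective
      change H.toSubgroup.map _ = H.toSubgroup
      ext x
      simp
    refine ⟨fun H => ⟨1, one H⟩, ?_, ?_⟩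
    · rintro H L ⟨g, rfl⟩
      exact ⟨g⁻¹, by rw [key, inv_mul_cancel, one]⟩
    · rintro H L M ⟨g, rfl⟩ ⟨h, rfl⟩
      exact ⟨h * g, (key h g H).symm⟩

/-- The space of conjugacy classes of closed subgroups, with the quotient of the Chabauty
topology. -/
abbrev ClassSpace (G : Type*) [Group G] [TopologicalSpace G] [IsTopologicalGroup G] : Type _ :=
  Quotient (conjSetoid G)

/-- The group `C` of diagonal matrices in `SL_n(ℝ)` with positive diagonal entries. -/
def cartan (n : ℕ) : ClosedSubgroup SL(n, ℝ) where
  carrier := {g | ∃ d : Fin n → ℝ, (∀ i, 0 < d i) ∧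
    (g : Matrix (Fin n) (Fin n) ℝ) = Matrix.diagonal d}
  one_mem' := ⟨fun _ => 1, fun _ => one_pos, by simp⟩
  mul_mem' := by
    rintro a b ⟨d, hd, ha⟩ ⟨e, he, hb⟩
    exact ⟨fun i => d i * e i, fun i => mul_pos (hd i) (he i), by
      rw [Matrix.SpecialLinearGroup.coe_mul, ha, hb, Matrix.diagonal_mul_diagonal]⟩
  inv_mem' := by
    rintro a ⟨d, hd, ha⟩
    refine ⟨fun i => (d i)⁻¹, fun i => inv_pos.2 (hd i), ?_⟩
    have h1 : (a : Matrix (Fin n) (Fin n) ℝ) * ((a⁻¹ : SL(n, ℝ)) : Matrix (Fin n) (Fin n) ℝ)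
        = 1 := by
      rw [← Matrix.SpecialLinearGroup.coe_mul, mul_inv_cancel, Matrix.SpecialLinearGroup.coe_one]
    have h2 : Matrix.diagonal (fun i => (d i)⁻¹) * (a : Matrix (Fin n) (Fin n) ℝ) = 1 := by
      rw [ha, Matrix.diagonal_mul_diagonal, ← Matrix.diagonal_one]
      congr 1
      funext i
      exact inv_mul_cancel₀ (hd i).ne'
    exact (left_inv_eq_right_inv h2 h1).symm
  isClosed' := by
    have hset : {g : SL(n, ℝ) | ∃ d : Fin n → ℝ, (∀ i, 0 < d i) ∧
        (g : Matrix (Fin n) (Fin n) ℝ) = Matrix.diagonal d} =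
        (⋂ i, {g : SL(n, ℝ) | 0 ≤ (g : Matrix (Fin n) (Fin n) ℝ) i i}) ∩
        {g : SL(n, ℝ) | (g : Matrix (Fin n) (Fin n) ℝ) =
          Matrix.diagonal (fun i => (g : Matrix (Fin n) (Fin n) ℝ) i i)} := by
      ext g
      simp only [Set.mem_ofPred_eq, Set.mem_inter_iff, Set.mem_iInter]
      constructor
      · rintro ⟨d, hd, hg⟩
        refine ⟨fun i => ?_, ?_⟩
        · rw [hg, Matrix.diagonal_apply_eq]
          exact (hd i).le
        · rw [hg]
          simp
      · rintro ⟨h0, hg⟩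
        refine ⟨_, fun i => lt_of_le_of_ne (h0 i) fun hi => ?_, hg⟩
        have hdet := g.det_coe
        rw [hg, Matrix.det_diagonal] at hdet
        exact (Finset.prod_ne_zero_iff.1 (hdet.trans_ne one_ne_zero)) i (Finset.mem_univ i) hi.symm
    have hval : Continuous fun g : SL(n, ℝ) => (g : Matrix (Fin n) (Fin n) ℝ) :=
      continuous_subtype_val
    have hentry : ∀ i j, Continuous fun g : SL(n, ℝ) => (g : Matrix (Fin n) (Fin n) ℝ) i j :=
      fun i j => hval.matrix_elem i j
    change IsClosed {g : SL(n, ℝ) | ∃ d : Fin n → ℝ, (∀ i, 0 < d i) ∧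
        (g : Matrix (Fin n) (Fin n) ℝ) = Matrix.diagonal d}
    rw [hset]
    refine IsClosed.inter (isClosed_iInter fun i => isClosed_le continuous_const (hentry i i)) ?_
    exact isClosed_eq hval (Continuous.matrix_diagonal (continuous_pi fun i => hentry i i))

/-- `L` is a conjugacy limit of `C`: some sequence of conjugates of `C` in `SL_n(ℝ)` converges
to `L` in the Chabauty topology. -/
def IsConjLimit (n : ℕ) (L : ClosedSubgroup SL(n, ℝ)) : Prop :=
  ∃ P : ℕ → SL(n, ℝ), Tendsto (fun k => conj (P k) (cartan n)) atTop (𝓝 L)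

/-- The closed subgroups of `SL_n(ℝ)` that are isomorphic to `(ℝⁿ⁻¹, +)` as topological groups. -/
def AbHat (n : ℕ) : Set (ClosedSubgroup SL(n, ℝ)) :=
  {G | Nonempty (G.toSubgroup ≃ₜ* Multiplicative (Fin (n - 1) → ℝ))}

/-- The closed subgroups of `SL_n(ℝ)` that are conjugacy limits of `C`. -/
def RedHat (n : ℕ) : Set (ClosedSubgroup SL(n, ℝ)) :=
  {G | IsConjLimit n G}

/-- The set of conjugacy classes of elements of `AbHat n`. -/
def Ab (n : ℕ) : Set (ClassSpace SL(n, ℝ)) :=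
  Quotient.mk (conjSetoid SL(n, ℝ)) '' AbHat n

/-- The set of conjugacy classes of elements of `RedHat n`. -/
def Red (n : ℕ) : Set (ClassSpace SL(n, ℝ)) :=
  Quotient.mk (conjSetoid SL(n, ℝ)) '' RedHat n

end ConjLimit

/-! The conjugate `P C P⁻¹` consists of the determinant-one exponentials of elements of the algebra
`P D P⁻¹`, where `D` is the `n`-dimensional algebra of diagonal matrices. By compactness the
algebras `P k D (P k)⁻¹` subconverge to an `n`-dimensional commutative algebra, spanned by `1` and
traceless matrices `b j` (`IsLimitFrame`, `frameSpan`). A limit of the groups is exactly `exp (span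
b)`: a limit point lies in the limit algebra and is joined to `1` by a segment of units, hence is an
exponential there (`IsLimitFrame.exists_exp_eq`). Injectivity of `exp` on `span b` follows because a
limit group has no involution, so a period could be halved indefinitely. This gives
`mem_AbHat_of_isConjLimit` for every `n ≥ 1`.

Conversely, a closed subgroup `G` isomorphic to `ℝⁿ⁻¹` is `exp` of the span of `n - 1` commuting
matrices `a j`. If `a` is a limit of simultaneously diagonalizable real families, then `G` is a
conjugacy limit. For `n ≤ 4`, any `n - 1` commuting `n × n` matrices with eigenvalues in the base
field are such a limit (`mem_closure_diagonalizableFamilies`): generalized eigenspaces reduce to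
nilpotent families, and in each nilpotent type one member can be perturbed, without destroying
commutation, so that it gains a second eigenvalue and splits the space.

Real eigenvalues are not given in advance. The density result over `ℂ` shows first that `1` and the
`a j` span an algebra; on it `exp` has no periods, and a commutative real algebra with this property
has no complex characters (`isUnit_sq_add_one_of_exp_injective`). Hence all characteristic
polynomials split over `ℝ`, and the real density result applies.

For `n ≥ 5` the obstruction is linear: every conjugacy limit spans at most `n` dimensions of
matrices (`exists_submodule_of_mem_RedHat`), while an explicit unipotent group isomorphic to `ℝⁿ⁻¹`
spans `n + 1`, because one generator has a square independent of `1` and the generators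
(`exists_mem_AbHat_not_forall_mem`). -/

namespace ConjLimit
open NormedSpace

/-! ### Exponentials and one-parameter groups in Banach algebras. -/

section BanachAlgebra

variable {𝔸 : Type*} [NormedRing 𝔸] [NormedAlgebra ℝ 𝔸] [CompleteSpace 𝔸]

theorem exp_add_of_commute_real {x y : 𝔸} (h : Commute x y) : exp (x + y) = exp x * exp y := by
  let _ : NormedAlgebra ℚ 𝔸 := NormedAlgebra.restrictScalars ℚ ℝ 𝔸
  exact exp_add_of_commute h

theorem continuous_exp_real : Continuous (exp : 𝔸 → 𝔸) := by
  let _ : NormedAlgebra ℚ 𝔸 := NormedAlgebra.restrictScalars ℚ ℝ 𝔸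
  exact exp_continuous

theorem exp_neg_mul_exp (x : 𝔸) : exp (-x) * exp x = 1 := by
  rw [← exp_add_of_commute_real (Commute.refl x).neg_left, neg_add_cancel, exp_zero]

/-- The exponential is a local bijection between neighbourhoods of `0` and `1`. -/
theorem exp_local_inverse : (∀ᶠ y in 𝓝 (1 : 𝔸), y ∈ Set.range (exp : 𝔸 → 𝔸)) ∧
    ∀ᶠ x in 𝓝 (0 : 𝔸), exp x = 1 → x = 0 := by
  have h : HasStrictFDerivAt (exp : 𝔸 → 𝔸) ((ContinuousLinearEquiv.refl ℝ 𝔸 : 𝔸 ≃L[ℝ] 𝔸) :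
      𝔸 →L[ℝ] 𝔸) 0 := hasStrictFDerivAt_exp_zero (𝕂 := ℝ)
  constructor
  · have h1 := h.map_nhds_eq_of_equiv
    rw [exp_zero] at h1
    rw [← h1]
    exact eventually_map.2 (Eventually.of_forall fun x => ⟨x, rfl⟩)
  · have h2 := h.eventually_left_inverse
    filter_upwards [h2] with x hx hx1
    have h3 := h2.self_of_nhds
    rw [exp_zero] at h3
    rw [← hx, hx1, h3]

/-- In a commutative real Banach algebra, the endpoint of a path of units starting at `1` is an
exponential. -/
theorem mem_range_exp_of_path (hc : ∀ x y : 𝔸, Commute x y) (γ : ℝ → 𝔸) (hγ : Continuous γ)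
    (hu : ∀ t ∈ Set.Icc (0 : ℝ) 1, IsUnit (γ t)) (h0 : γ 0 = 1) :
    γ 1 ∈ Set.range (exp : 𝔸 → 𝔸) := by
  -- Near `t` the quotient of `γ s` by `γ t` is close to `1`, hence an exponential; since
  -- exponentials form a group here, membership in the range is locally constant along the path.
  have key : ∀ t ∈ Set.Icc (0 : ℝ) 1, ∀ᶠ s in 𝓝 t,
      (γ s ∈ Set.range (exp : 𝔸 → 𝔸) ↔ γ t ∈ Set.range (exp : 𝔸 → 𝔸)) := by
    intro t ht
    obtain ⟨u, hu⟩ := hu t ht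
    have hcont : Tendsto (fun s => γ s * ↑u⁻¹) (𝓝 t) (𝓝 (1 : 𝔸)) := by
      have := (hγ.tendsto t).mul_const (↑u⁻¹ : 𝔸)
      rwa [← hu, Units.mul_inv] at this
    filter_upwards [hcont.eventually exp_local_inverse.1] with s hs
    obtain ⟨z, hz⟩ := hs
    have hs' : γ s = exp z * γ t := by rw [hz, ← hu, mul_assoc, Units.inv_mul, mul_one]
    constructor
    · rintro ⟨w, hw⟩
      refine ⟨-z + w, ?_⟩
      rw [exp_add_of_commute_real (hc _ _), hw, hs', ← mul_assoc, exp_neg_mul_exp, one_mul]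
    · rintro ⟨w, hw⟩
      exact ⟨z + w, by rw [exp_add_of_commute_real (hc _ _), hw, hs']⟩
  have hl : IsLocallyConstant fun t : unitInterval => (γ t ∈ Set.range (exp : 𝔸 → 𝔸)) := by
    rw [IsLocallyConstant.iff_eventually_eq]
    intro t
    have := (continuous_subtype_val.tendsto t).eventually (key t t.2)
    filter_upwards [this] with s hs
    exact propext hs
  have := hl.apply_eq_of_preconnectedSpace 1 0
  rw [show γ 1 = γ (1 : unitInterval) from rfl, this]
  exact ⟨0, by simp [h0]⟩

/-- A commutative finite-dimensional real algebra on which the exponential is injective has no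
complex characters: `x ^ 2 + 1` is always invertible. -/
theorem isUnit_sq_add_one_of_exp_injective [FiniteDimensional ℝ 𝔸]
    (hc : ∀ x y : 𝔸, Commute x y) (hinj : ∀ x : 𝔸, exp x = 1 → x = 0) (x : 𝔸) :
    IsUnit (x ^ 2 + 1) := by
  let _ : CommRing 𝔸 := { (inferInstance : Ring 𝔸) with mul_comm := fun a b => hc a b }
  let _ : Algebra ℝ 𝔸 := NormedAlgebra.toAlgebra
  have : IsArtinianRing 𝔸 := IsArtinianRing.of_finite ℝ 𝔸
  set N : 𝔸 := x ^ 2 + 1 with hN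
  -- The decreasing chain of ideals generated by the powers of `N` stabilizes in an Artinian ring.
  obtain ⟨k, c, hk⟩ : ∃ (k : ℕ) (c : 𝔸), N ^ k = N ^ (2 * k) * c ∧ 0 < k := by
    obtain ⟨n, y, hy⟩ := IsArtinian.exists_pow_succ_smul_dvd N (1 : 𝔸)
    have hy' : ∀ m, ∃ c, N ^ n = N ^ (n + m) * c := by
      intro m
      induction m with
      | zero => exact ⟨1, by simp⟩
      | succ m ih =>
        obtain ⟨c, hc'⟩ := ih
        simp only [smul_eq_mul, mul_one] at hy
        refine ⟨y * c, ?_⟩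
        calc N ^ n = N ^ (n + m) * c := hc'
          _ = N ^ m * N ^ n * c := by ring
          _ = N ^ m * (N ^ n.succ * y) * c := by rw [hy]
          _ = _ := by rw [Nat.succ_eq_add_one]; ring
    obtain ⟨c, hc'⟩ := hy' (n + 1)
    refine ⟨n + 1, c, ?_, by omega⟩
    calc N ^ (n + 1) = N * N ^ n := by ring
      _ = N * (N ^ (n + (n + 1)) * c) := by rw [← hc']
      _ = N ^ (2 * (n + 1)) * c := by rw [← mul_assoc, ← pow_succ']; congr 2; omega
  obtain ⟨hk, hk0⟩ := hk
  -- The Fitting idempotent: on its summand `N` is nilpotent, so `x` is a square root of `-1` up to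
  -- nilpotents. The goal is `e = 0`.
  set e : 𝔸 := 1 - N ^ k * c with he
  have hee : e * e = e := by
    have : N ^ k * c * (N ^ k * c) = N ^ k * c := by
      calc N ^ k * c * (N ^ k * c) = N ^ (2 * k) * c * c := by ring
        _ = _ := by rw [← hk]
    rw [he]
    linear_combination this
  have hNe : N ^ k * e = 0 := by
    rw [he]
    linear_combination hk
  have hnil : ∀ s : 𝔸, IsUnit (1 - e * N * s) := fun s => by
    refine IsNilpotent.isUnit_one_sub ⟨k, ?_⟩
    calc (e * N * s) ^ k = e ^ (k - 1) * s ^ k * (N ^ k * e) := by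
          obtain ⟨j, rfl⟩ : ∃ j, k = j + 1 := ⟨k - 1, by omega⟩
          rw [mul_pow, mul_pow, Nat.add_sub_cancel, pow_succ e]
          generalize N ^ (j + 1) = M
          generalize s ^ (j + 1) = r
          generalize e ^ j = f
          ring
      _ = 0 := by rw [hNe, mul_zero]
  -- A half turn on the `e` summand leads from `1` to `1 - 2e`. The path stays in the units because
  -- multiplying by its conjugate gives `1` minus a nilpotent. Its endpoint is an involution `exp
  -- y`, so `exp (y + y) = 1` forces `y = 0`, and then `e = 0`.
  have hpath := mem_range_exp_of_path hc
    (fun t => (1 - e) + e * (algebraMap ℝ 𝔸 (Real.cos (Real.pi * t)) +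
      algebraMap ℝ 𝔸 (Real.sin (Real.pi * t)) * x))
    (by
      have := continuous_algebraMap ℝ 𝔸
      fun_prop)
    (fun t _ => by
      have hcs := congrArg (algebraMap ℝ 𝔸) (Real.cos_sq_add_sin_sq (Real.pi * t))
      simp only [map_add, map_pow, map_one] at hcs
      set a := algebraMap ℝ 𝔸 (Real.cos (Real.pi * t))
      set b := algebraMap ℝ 𝔸 (Real.sin (Real.pi * t))
      refine isUnit_of_mul_isUnit_left (y := (1 - e) + e * (a - b * x)) ?_
      have : ((1 - e) + e * (a + b * x)) * ((1 - e) + e * (a - b * x)) = 1 - e * N * b ^ 2 := by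
        rw [hN]
        linear_combination (1 - 2 * a + a ^ 2 - b ^ 2 * x ^ 2) * hee + e * hcs
      rw [this]
      exact hnil _)
    (by simp)
  obtain ⟨y, hy⟩ := hpath
  simp only [mul_one, Real.cos_pi, Real.sin_pi, map_neg, map_one, map_zero, zero_mul, add_zero,
    mul_neg] at hy
  have h2 : exp (y + y) = 1 := by
    rw [exp_add_of_commute_real (hc y y), hy]
    linear_combination 4 * hee
  have h3 : y = 0 := by
    have h4 := hinj _ h2
    rw [← two_smul ℝ] at h4
    exact (smul_eq_zero.1 h4).resolve_left two_ne_zero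
  rw [h3, exp_zero] at hy
  have h5 : (2 : ℝ) • e = 0 := by
    rw [two_smul]
    linear_combination hy
  have h6 : e = 0 := (smul_eq_zero.1 h5).resolve_left two_ne_zero
  rw [he, sub_eq_zero] at h6
  have h7 : IsUnit (N ^ k) := IsUnit.of_mul_eq_one c h6.symm
  exact (isUnit_pow_iff hk0.ne').1 h7

/-- A continuous one-parameter group in a Banach algebra is `t ↦ exp (t • a)`. -/
theorem exists_eq_exp_smul_of_continuous (φ : ℝ → 𝔸) (hφ : Continuous φ) (h0 : φ 0 = 1)
    (hadd : ∀ s t, φ (s + t) = φ s * φ t) : ∃ a : 𝔸, ∀ t, φ t = exp (t • a) := by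
  -- Smoothing by integration: `φ t * Φ δ` is a difference of values of the differentiable `Φ`, and
  -- `Φ δ` is a unit for some small `δ` because `Φ δ / δ` tends to `1`. Hence `φ` is differentiable
  -- and solves `φ' = φ * a`.
  set Φ : ℝ → 𝔸 := fun t => ∫ s in (0 : ℝ)..t, φ s with hΦ
  have hint : ∀ a b, IntervalIntegrable φ MeasureTheory.volume a b :=
    fun a b => hφ.intervalIntegrable a b
  have hderiv : ∀ t, HasDerivAt Φ (φ t) t := fun t =>
    intervalIntegral.integral_hasDerivAt_right (hint 0 t)
      hφ.aestronglyMeasurable.stronglyMeasurableAtFilter hφ.continuousAt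
  have hshift : ∀ t δ, φ t * Φ δ = Φ (t + δ) - Φ t := by
    intro t δ
    rw [hΦ]
    simp only
    rw [intervalIntegral.integral_interval_sub_left (hint _ _) (hint _ _),
      ← ContinuousLinearMap.mul_apply' ℝ 𝔸 (φ t) (∫ s in (0 : ℝ)..δ, φ s),
      ← ContinuousLinearMap.intervalIntegral_comp_comm _ (hint _ _)]
    simp only [ContinuousLinearMap.mul_apply', ← hadd]
    rw [intervalIntegral.integral_comp_add_left (fun s => φ s) t, add_zero]
  obtain ⟨δ, hδ⟩ : ∃ δ, IsUnit (Φ δ) := by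
    have h1 : Tendsto (fun δ : ℝ => δ⁻¹ • (Φ (0 + δ) - Φ 0)) (𝓝[≠] 0) (𝓝 (φ 0)) :=
      hasDerivAt_iff_tendsto_slope_zero.1 (hderiv 0)
    rw [h0] at h1
    have h2 : ∀ᶠ δ in 𝓝[≠] (0 : ℝ), IsUnit (δ⁻¹ • (Φ (0 + δ) - Φ 0)) :=
      h1.eventually (Units.isOpen.mem_nhds isUnit_one)
    obtain ⟨δ, hδ, hne⟩ := (h2.and self_mem_nhdsWithin).exists
    refine ⟨δ, ?_⟩
    have h3 : Φ 0 = 0 := by simp [hΦ]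
    rw [zero_add, h3, sub_zero] at hδ
    have h4 : Φ δ = algebraMap ℝ 𝔸 δ * (δ⁻¹ • Φ δ) := by
      rw [← Algebra.smul_def, smul_smul, mul_inv_cancel₀ hne, one_smul]
    rw [h4]
    exact ((IsUnit.mk0 δ hne).map (algebraMap ℝ 𝔸)).mul hδ
  obtain ⟨u, hu⟩ := hδ
  have hφ' : ∀ t, φ t = (Φ (t + δ) - Φ t) * ↑u⁻¹ := by
    intro t
    rw [← hshift, ← hu, mul_assoc, Units.mul_inv, mul_one]
  have hd0 : HasDerivAt φ ((φ (0 + δ) - φ 0) * ↑u⁻¹) 0 := by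
    have h1 : HasDerivAt (fun t => (Φ (t + δ) - Φ t) * (↑u⁻¹ : 𝔸)) ((φ (0 + δ) - φ 0) * ↑u⁻¹) 0 :=
      (((hderiv (0 + δ)).comp_add_const 0 δ).sub (hderiv 0)).mul_const _
    exact h1.congr_of_eventuallyEq (Eventually.of_forall hφ')
  set a := (φ (0 + δ) - φ 0) * (↑u⁻¹ : 𝔸)
  have hd : ∀ t, HasDerivAt φ (φ t * a) t := by
    intro t
    have h1 : HasDerivAt (fun s => φ t * φ (s - t)) (φ t * a) t := by
      have h2 : HasDerivAt (fun s => φ (s - t)) a t := by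
        have h3 := hd0
        rw [← sub_self t] at h3
        exact h3.comp_sub_const t t
      exact h2.const_mul _
    refine h1.congr_of_eventuallyEq (Eventually.of_forall fun s => ?_)
    simp only
    rw [← hadd, add_sub_cancel]
  have hconst : ∀ t, φ t * exp ((-t) • a) = 1 := by
    have h1 : ∀ t, HasDerivAt (fun t => φ t * exp ((-t) • a)) 0 t := by
      intro t
      have h2 : HasDerivAt (fun u : ℝ => exp ((-u) • a)) (-(a * exp ((-t) • a))) t := by
        have h3 := (hasDerivAt_exp_smul_const' (𝕂 := ℝ) a (-t)).scomp t (hasDerivAt_neg t)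
        rw [neg_one_smul] at h3
        exact h3
      have h4 : HasDerivAt (fun t => φ t * exp ((-t) • a))
        (φ t * a * exp ((-t) • a) + φ t * -(a * exp ((-t) • a))) t := (hd t).mul h2
      rwa [mul_neg, mul_assoc, add_neg_cancel] at h4
    intro t
    have h5 := is_const_of_deriv_eq_zero (fun t => (h1 t).differentiableAt)
      (fun t => (h1 t).deriv) t 0
    simpa [h0] using h5
  refine ⟨a, fun t => ?_⟩
  have h1 := hconst t
  calc φ t = φ t * (exp ((-t) • a) * exp (t • a)) := by
        rw [neg_smul, exp_neg_mul_exp, mul_one]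
    _ = _ := by rw [← mul_assoc, h1, one_mul]

theorem hasDerivAt_exp_smul_zero (a : 𝔸) : HasDerivAt (fun t : ℝ => exp (t • a)) a 0 := by
  have h2 := hasDerivAt_exp_smul_const (𝕂 := ℝ) a (0 : ℝ)
  simpa only [zero_smul, exp_zero, one_mul] using h2

/-- Elements whose one-parameter groups commute, commute. -/
theorem commute_of_commute_exp {a b : 𝔸} (h : ∀ t : ℝ, Commute (exp (t • a)) b) : Commute a b := by
  have h1 : HasDerivAt (fun t : ℝ => exp (t • a) * b - b * exp (t • a)) (a * b - b * a) 0 := by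
    have h2 := hasDerivAt_exp_smul_zero a
    exact (h2.mul_const b).sub (h2.const_mul b)
  have h3 : (fun t : ℝ => exp (t • a) * b - b * exp (t • a)) = fun _ => 0 := by
    funext t
    exact sub_eq_zero.2 (h t)
  rw [h3] at h1
  exact sub_eq_zero.1 (h1.unique (hasDerivAt_const _ _))

end BanachAlgebra

/-! ### Matrix exponentials and determinants. -/

section Matrix

variable {n : Type*} [Fintype n] [DecidableEq n]

/-- Real matrices as operators on Euclidean space. -/
noncomputable def matrixEquivCLM (n : Type*) [Fintype n] [DecidableEq n] :
    Matrix n n ℝ ≃ₐ[ℝ] (EuclideanSpace ℝ n →L[ℝ] EuclideanSpace ℝ n) :=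
  (Matrix.toEuclideanCLM (n := n) (𝕜 := ℝ)).toAlgEquiv

theorem continuous_matrixEquivCLM : Continuous (matrixEquivCLM n) :=
  (matrixEquivCLM n).toLinearMap.continuous_of_finiteDimensional

theorem continuous_matrixEquivCLM_symm : Continuous (matrixEquivCLM n).symm :=
  (matrixEquivCLM n).symm.toLinearMap.continuous_of_finiteDimensional

theorem matrixEquivCLM_exp (A : Matrix n n ℝ) :
    matrixEquivCLM n (exp A) = exp (matrixEquivCLM n A) := by
  have h := (exp_series_hasSum_exp' (𝕂 := ℝ) (matrixEquivCLM n A)).map (matrixEquivCLM n).symm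
    continuous_matrixEquivCLM_symm
  have h2 := h.tsum_eq
  rw [← AlgEquiv.eq_symm_apply, ← h2, exp_eq_tsum ℝ]
  funext k
  simp

theorem continuous_matrix_exp : Continuous (exp : Matrix n n ℝ → Matrix n n ℝ) := by
  have : (exp : Matrix n n ℝ → Matrix n n ℝ) =
      fun A => (matrixEquivCLM n).symm (exp (matrixEquivCLM n A)) := by
    funext A
    rw [← matrixEquivCLM_exp, AlgEquiv.symm_apply_apply]
  rw [this]
  exact continuous_matrixEquivCLM_symm.comp (continuous_exp_real.comp continuous_matrixEquivCLM)

theorem hasDerivAt_det_one (γ : ℝ → Matrix n n ℝ) (A : Matrix n n ℝ) (h0 : γ 0 = 1)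
    (hγ : ∀ i j, HasDerivAt (fun t => γ t i j) (A i j) 0) :
    HasDerivAt (fun t => (γ t).det) A.trace 0 := by
  have hdet : Differentiable ℝ (fun M : n → n → ℝ => (Matrix.of M).det) := by
    simp only [Matrix.det_apply, Matrix.of_apply]
    fun_prop
  set o : n → n → ℝ := fun i j => (1 : Matrix n n ℝ) i j with ho
  have hfd : HasFDerivAt (fun M : n → n → ℝ => (Matrix.of M).det)
    (fderiv ℝ (fun M : n → n → ℝ => (Matrix.of M).det) o) o := (hdet o).hasFDerivAt
  set L := fderiv ℝ (fun M : n → n → ℝ => (Matrix.of M).det) o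
  have key : ∀ γ : ℝ → n → n → ℝ, γ 0 = o → (∀ i j, HasDerivAt (fun t => γ t i j) (A i j) 0) →
      HasDerivAt (fun t => (Matrix.of (γ t)).det) (L fun i j => A i j) 0 := by
    intro γ h0 hγ
    have h1 : HasDerivAt γ (fun i j => A i j) 0 :=
      hasDerivAt_pi.2 fun i => hasDerivAt_pi.2 fun j => hγ i j
    rw [← h0] at hfd
    exact hfd.comp_hasDerivAt 0 h1
  -- The differential of `det` at the identity applied to `A` depends only on the velocity, so the
  -- affine path `1 + t A` suffices to identify it as the trace.
  have h4 : HasDerivAt (fun t : ℝ => (Matrix.of fun i j => o i j + t * A i j).det) A.trace 0 := by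
    have h5 := (Matrix.det (1 + (Polynomial.X : Polynomial ℝ) • A.map Polynomial.C)).hasDerivAt 0
    rw [Matrix.derivative_det_one_add_X_smul] at h5
    refine h5.congr_of_eventuallyEq (Eventually.of_forall fun t => ?_)
    simp only
    rw [← Polynomial.coe_evalRingHom, RingHom.map_det]
    congr 1
    ext i j
    simp [Matrix.one_apply, apply_ite, ho, mul_comm t]
  have h6 := key (fun t i j => o i j + t * A i j) (by simp) (fun i j => by
    simpa using ((hasDerivAt_id (0 : ℝ)).mul_const (A i j)).const_add (o i j))
  rw [← h6.unique h4]
  exact key (fun t i j => γ t i j) (by rw [h0]) hγ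

/-- Both sides, taken at `t • A`, are one-parameter groups in `ℝ` with derivative `trace A` at `0`;
the quotient has zero derivative. -/
theorem det_exp_eq (A : Matrix n n ℝ) : (exp A).det = Real.exp A.trace := by
  set g : ℝ → ℝ := fun t => (exp (t • A)).det with hg
  have hadd : ∀ s t, g (s + t) = g s * g t := by
    intro s t
    change (exp ((s + t) • A)).det = (exp (s • A)).det * (exp (t • A)).det
    rw [add_smul, Matrix.exp_add_of_commute _ _ (((Commute.refl A).smul_left s).smul_right t),
      Matrix.det_mul]
  have h0 : HasDerivAt g A.trace 0 := by
    refine hasDerivAt_det_one (fun t => exp (t • A)) A (by simp) fun i j => ?_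
    have h2 := hasDerivAt_exp_smul_zero (matrixEquivCLM n A)
    let l : (EuclideanSpace ℝ n →L[ℝ] EuclideanSpace ℝ n) →L[ℝ] ℝ :=
      LinearMap.toContinuousLinearMap
        ((Matrix.entryLinearMap ℝ ℝ i j).comp (matrixEquivCLM n).symm.toLinearMap)
    have hl : ∀ M, l M = (matrixEquivCLM n).symm M i j := fun M => rfl
    have h3 := l.hasFDerivAt.comp_hasDerivAt (0 : ℝ) h2
    rw [hl, AlgEquiv.symm_apply_apply] at h3
    refine h3.congr_of_eventuallyEq (Eventually.of_forall fun t => ?_)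
    change exp (t • A) i j = l (exp (t • matrixEquivCLM n A))
    rw [hl, ← map_smul, ← matrixEquivCLM_exp, AlgEquiv.symm_apply_apply]
  have hd : ∀ t, HasDerivAt g (g t * A.trace) t := by
    intro t
    have h2 : HasDerivAt (fun s => g (s - t)) A.trace t := by
      have h3 := h0
      rw [← sub_self t] at h3
      exact h3.comp_sub_const t t
    refine (h2.const_mul (g t)).congr_of_eventuallyEq (Eventually.of_forall fun s => ?_)
    change g s = g t * g (s - t)
    rw [← hadd, add_sub_cancel]
  have h1 : ∀ t, HasDerivAt (fun t => g t * Real.exp (-(t * A.trace))) 0 t := by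
    intro t
    have h2 : HasDerivAt (fun t => Real.exp (-(t * A.trace)))
        (Real.exp (-(t * A.trace)) * -A.trace) t := by
      have := (((hasDerivAt_id t).mul_const A.trace).neg).exp
      simpa using this
    have h3 := (hd t).mul h2
    rw [show g t * A.trace * Real.exp (-(t * A.trace)) +
      g t * (Real.exp (-(t * A.trace)) * -A.trace) = 0 by ring] at h3
    exact h3
  have h5 := is_const_of_deriv_eq_zero (fun t => (h1 t).differentiableAt)
    (fun t => (h1 t).deriv) 1 0
  simp only [hg, one_smul, one_mul, zero_smul, exp_zero, Matrix.det_one, zero_mul, neg_zero,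
    Real.exp_zero] at h5
  rw [Real.exp_neg] at h5
  field_simp at h5
  exact h5

end Matrix
end ConjLimit

namespace ConjLimit
open NormedSpace

/-! ### Exponentials inside commutative matrix algebras. -/

section Subalgebra

variable {𝔸 : Type*} [NormedRing 𝔸] [NormedAlgebra ℝ 𝔸] [FiniteDimensional ℝ 𝔸]

theorem coe_exp_subalgebra (B : Subalgebra ℝ 𝔸) (y : B) : ((exp y : B) : 𝔸) = exp (y : 𝔸) := by
  have : CompleteSpace 𝔸 := FiniteDimensional.complete ℝ 𝔸
  have : CompleteSpace B := FiniteDimensional.complete ℝ B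
  let _ : NormedAlgebra ℚ 𝔸 := NormedAlgebra.restrictScalars ℚ ℝ 𝔸
  let _ : NormedAlgebra ℚ B := NormedAlgebra.restrictScalars ℚ ℝ B
  exact map_exp B.val continuous_subtype_val y

/-- Multiplication by `y` is injective on the finite-dimensional space `B`, hence surjective, so the
inverse already lies in `B`. -/
theorem isUnit_subalgebra (B : Subalgebra ℝ 𝔸) (hc : ∀ x y : B, Commute x y) (y : B)
    (hy : IsUnit (y : 𝔸)) : IsUnit y := by
  have h1 : Function.Injective (LinearMap.mulLeft ℝ y) := by
    intro a b hab
    have h2 : (y : 𝔸) * a = y * b := congrArg Subtype.val hab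
    exact Subtype.ext (hy.mul_left_cancel h2)
  obtain ⟨z, hz⟩ := LinearMap.injective_iff_surjective.1 h1 1
  exact ⟨⟨y, z, hz, (hc z y).eq.trans hz⟩, rfl⟩

theorem exists_exp_eq_of_segment (B : Subalgebra ℝ 𝔸) (hc : ∀ x y : B, Commute x y) (x : B)
    (hx : ∀ t ∈ Set.Icc (0 : ℝ) 1, IsUnit ((1 - t) • (1 : 𝔸) + t • (x : 𝔸))) :
    ∃ y : B, exp (y : 𝔸) = x := by
  have : CompleteSpace B := FiniteDimensional.complete ℝ B
  obtain ⟨y, hy⟩ := mem_range_exp_of_path hc (fun t : ℝ => (1 - t) • (1 : B) + t • x)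
    (by fun_prop) (fun t ht => isUnit_subalgebra B hc _ (hx t ht)) (by simp)
  refine ⟨y, ?_⟩
  rw [← coe_exp_subalgebra, hy]
  simp

theorem isUnit_sq_add_one_subalgebra (B : Subalgebra ℝ 𝔸) (hc : ∀ x y : B, Commute x y)
    (hinj : ∀ y : B, exp (y : 𝔸) = 1 → y = 0) (x : B) : IsUnit ((x : 𝔸) ^ 2 + 1) := by
  have : CompleteSpace B := FiniteDimensional.complete ℝ B
  have h := isUnit_sq_add_one_of_exp_injective hc (fun y hy => hinj y (by
    rw [← coe_exp_subalgebra, hy]; rfl)) x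
  exact h.map B.val

end Subalgebra

section Matrix

variable {n : Type*} [Fintype n] [DecidableEq n]

theorem commute_map_matrixEquivCLM (B : Subalgebra ℝ (Matrix n n ℝ))
    (hc : ∀ x ∈ B, ∀ y ∈ B, x * y = y * x) (x y : B.map (matrixEquivCLM n).toAlgHom) :
    Commute x y := by
  obtain ⟨x, x', hx, rfl⟩ := x
  obtain ⟨y, y', hy, rfl⟩ := y
  refine Subtype.ext ?_
  change matrixEquivCLM n x' * matrixEquivCLM n y' = matrixEquivCLM n y' * matrixEquivCLM n x'
  rw [← map_mul, ← map_mul, hc x' hx y' hy]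

theorem exists_exp_eq_of_segment_matrix (B : Subalgebra ℝ (Matrix n n ℝ))
    (hc : ∀ x ∈ B, ∀ y ∈ B, x * y = y * x) (x : Matrix n n ℝ) (hxB : x ∈ B)
    (hx : ∀ t ∈ Set.Icc (0 : ℝ) 1, IsUnit ((1 - t) • (1 : Matrix n n ℝ) + t • x)) :
    ∃ y ∈ B, exp y = x := by
  obtain ⟨⟨z, y, hy, rfl⟩, h⟩ := exists_exp_eq_of_segment (B.map (matrixEquivCLM n).toAlgHom)
    (commute_map_matrixEquivCLM B hc) ⟨matrixEquivCLM n x, x, hxB, rfl⟩ (fun t ht => by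
      have := (hx t ht).map (matrixEquivCLM n)
      rw [map_add, map_smul, map_smul, map_one] at this
      exact this)
  refine ⟨y, hy, ?_⟩
  apply (matrixEquivCLM n).injective
  rw [matrixEquivCLM_exp]
  exact h

theorem isUnit_sq_add_one_matrix (B : Subalgebra ℝ (Matrix n n ℝ))
    (hc : ∀ x ∈ B, ∀ y ∈ B, x * y = y * x) (hinj : ∀ y ∈ B, exp y = 1 → y = 0)
    (x : Matrix n n ℝ) (hxB : x ∈ B) : IsUnit (x ^ 2 + 1) := by
  have h := isUnit_sq_add_one_subalgebra (B.map (matrixEquivCLM n).toAlgHom)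
    (commute_map_matrixEquivCLM B hc) (by
      rintro ⟨z, y, hy, rfl⟩ h1
      refine Subtype.ext ?_
      change exp (matrixEquivCLM n y) = 1 at h1
      rw [← matrixEquivCLM_exp, ← map_one (matrixEquivCLM n)] at h1
      change matrixEquivCLM n y = 0
      rw [hinj y hy ((matrixEquivCLM n).injective h1), map_zero])
    ⟨matrixEquivCLM n x, x, hxB, rfl⟩
  have h2 : IsUnit (matrixEquivCLM n (x ^ 2 + 1)) := by
    rw [map_add, map_pow, map_one]
    exact h
  have h3 := h2.map (matrixEquivCLM n).symm
  rwa [AlgEquiv.symm_apply_apply] at h3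

theorem exists_eq_exp_smul_matrix (φ : ℝ → Matrix n n ℝ) (hφ : Continuous φ) (h0 : φ 0 = 1)
    (hadd : ∀ s t, φ (s + t) = φ s * φ t) : ∃ a : Matrix n n ℝ, ∀ t, φ t = exp (t • a) := by
  obtain ⟨a, ha⟩ := exists_eq_exp_smul_of_continuous (fun t => matrixEquivCLM n (φ t))
    (continuous_matrixEquivCLM.comp hφ) (by rw [h0, map_one]) (fun s t => by rw [hadd, map_mul])
  refine ⟨(matrixEquivCLM n).symm a, fun t => ?_⟩
  apply (matrixEquivCLM n).injective
  rw [matrixEquivCLM_exp, map_smul, AlgEquiv.apply_symm_apply]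
  exact ha t

theorem commute_of_commute_exp_matrix {a b : Matrix n n ℝ}
    (h : ∀ s t : ℝ, Commute (exp (t • a)) (exp (s • b))) : Commute a b := by
  have h1 : ∀ s t : ℝ, Commute (exp (t • matrixEquivCLM n a)) (exp (s • matrixEquivCLM n b)) := by
    intro s t
    have := (h s t).map (matrixEquivCLM n)
    rwa [matrixEquivCLM_exp, matrixEquivCLM_exp, map_smul, map_smul] at this
  have h2 : Commute (matrixEquivCLM n a) (matrixEquivCLM n b) :=
    (commute_of_commute_exp fun s => (commute_of_commute_exp fun t => h1 s t).symm).symm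
  have h3 := h2.map (matrixEquivCLM n).symm
  rwa [AlgEquiv.symm_apply_apply, AlgEquiv.symm_apply_apply] at h3

theorem eventually_eq_zero_of_exp_eq_one :
    ∀ᶠ x in 𝓝 (0 : Matrix n n ℝ), exp x = 1 → x = 0 := by
  have h1 : Tendsto (matrixEquivCLM n) (𝓝 0) (𝓝 0) := by
    have := continuous_matrixEquivCLM.tendsto (0 : Matrix n n ℝ)
    rwa [map_zero] at this
  filter_upwards [h1.eventually exp_local_inverse.2] with x hx h
  have h2 : exp (matrixEquivCLM n x) = 1 := by rw [← matrixEquivCLM_exp, h, map_one]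
  exact (map_eq_zero_iff _ (matrixEquivCLM n).injective).1 (hx h2)

end Matrix
end ConjLimit

namespace ConjLimit
open Module Polynomial

/-! ### Limits of simultaneously diagonalizable families. -/

section MatrixFamilies

variable (𝕜 : Type*) [RCLike 𝕜] (ι n : Type*) [Fintype n] [DecidableEq n]

/-- Families of matrices that are diagonal in a common basis. -/
def diagonalizableFamilies : Set (ι → Matrix n n 𝕜) :=
  {f | ∃ (k : ℕ) (P : Matrix n (Fin k) 𝕜) (Q : Matrix (Fin k) n 𝕜), P * Q = 1 ∧ Q * P = 1 ∧
    ∃ d : ι → Fin k → 𝕜, ∀ i, f i = P * Matrix.diagonal (d i) * Q}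

variable {𝕜 ι n}

theorem diagonalizableFamilies_conj {m : Type*} [Fintype m] [DecidableEq m]
    {S : Matrix m n 𝕜} {T : Matrix n m 𝕜} (h1 : S * T = 1) (h2 : T * S = 1)
    {f : ι → Matrix n n 𝕜} (hf : f ∈ closure (diagonalizableFamilies 𝕜 ι n)) :
    (fun i => S * f i * T) ∈ closure (diagonalizableFamilies 𝕜 ι m) := by
  refine map_mem_closure (f := fun (f : ι → Matrix n n 𝕜) i => S * f i * T) (by fun_prop) hf ?_
  rintro f ⟨k, P, Q, hPQ, hQP, d, hd⟩
  refine ⟨k, S * P, Q * T, ?_, ?_, d, fun i => ?_⟩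
  · rw [Matrix.mul_assoc, ← Matrix.mul_assoc P, hPQ, Matrix.one_mul, h1]
  · rw [Matrix.mul_assoc, ← Matrix.mul_assoc T, h2, Matrix.one_mul, hQP]
  · simp only [hd, Matrix.mul_assoc]

/-- Noncommutative polynomial expressions depend continuously on the family and remain diagonal in
any basis that diagonalizes it. So only generators need to be approximated. -/
theorem diagonalizableFamilies_adjoin {κ : Type*} {f : ι → Matrix n n 𝕜} {g : κ → Matrix n n 𝕜}
    (hg : ∀ j, g j ∈ Algebra.adjoin 𝕜 (Set.range f))
    (hf : f ∈ closure (diagonalizableFamilies 𝕜 ι n)) :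
    g ∈ closure (diagonalizableFamilies 𝕜 κ n) := by
  rw [Algebra.adjoin_range_eq_range_freeAlgebra_lift] at hg
  choose a ha using hg
  have hg' : g = (fun (f : ι → Matrix n n 𝕜) j => FreeAlgebra.lift 𝕜 f (a j)) f := by
    funext j
    exact (ha j).symm
  rw [hg']
  refine map_mem_closure (f := fun (f : ι → Matrix n n 𝕜) j => FreeAlgebra.lift 𝕜 f (a j)) ?_ hf ?_
  · refine continuous_pi fun j => ?_
    induction a j using FreeAlgebra.induction with
    | grade0 r => simp only [AlgHom.commutes]; exact continuous_const
    | grade1 i => simp only [FreeAlgebra.lift_ι_apply]; exact continuous_apply i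
    | mul x y hx hy => simp only [map_mul]; exact hx.mul hy
    | add x y hx hy => simp only [map_add]; exact hx.add hy
  · rintro f ⟨k, P, Q, hPQ, hQP, d, hd⟩
    have key : ∀ x : FreeAlgebra 𝕜 ι, ∃ e : Fin k → 𝕜,
        FreeAlgebra.lift 𝕜 f x = P * Matrix.diagonal e * Q := by
      intro x
      induction x using FreeAlgebra.induction with
      | grade0 r =>
        refine ⟨fun _ => r, ?_⟩
        rw [AlgHom.commutes, ← Matrix.smul_one_eq_diagonal, Matrix.mul_smul, Matrix.mul_one,
          Matrix.smul_mul, hPQ, Algebra.algebraMap_eq_smul_one]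
      | grade1 i => exact ⟨d i, by rw [FreeAlgebra.lift_ι_apply, hd]⟩
      | mul x y hx hy =>
        obtain ⟨e, he⟩ := hx
        obtain ⟨e', he'⟩ := hy
        refine ⟨fun i => e i * e' i, ?_⟩
        rw [map_mul, he, he', ← Matrix.diagonal_mul_diagonal]
        simp only [Matrix.mul_assoc]
        rw [← Matrix.mul_assoc Q, hQP, Matrix.one_mul]
      | add x y hx hy =>
        obtain ⟨e, he⟩ := hx
        obtain ⟨e', he'⟩ := hy
        refine ⟨fun i => e i + e' i, ?_⟩
        rw [map_add, he, he', ← Matrix.diagonal_add, Matrix.mul_add, Matrix.add_mul]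
    choose e he using key
    exact ⟨k, P, Q, hPQ, hQP, fun j => e (a j), fun j => he (a j)⟩

theorem diagonalizableFamilies_fromBlocks {m : Type*} [Fintype m] [DecidableEq m]
    {f : ι → Matrix n n 𝕜} {g : ι → Matrix m m 𝕜}
    (hf : f ∈ closure (diagonalizableFamilies 𝕜 ι n))
    (hg : g ∈ closure (diagonalizableFamilies 𝕜 ι m)) :
    (fun i => Matrix.fromBlocks (f i) 0 0 (g i)) ∈
      closure (diagonalizableFamilies 𝕜 ι (n ⊕ m)) := by
  have h : (f, g) ∈ closure (diagonalizableFamilies 𝕜 ι n ×ˢ diagonalizableFamilies 𝕜 ι m) := by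
    rw [closure_prod_eq]
    exact ⟨hf, hg⟩
  refine map_mem_closure (f := fun (p : (ι → Matrix n n 𝕜) × (ι → Matrix m m 𝕜)) i =>
    Matrix.fromBlocks (p.1 i) 0 0 (p.2 i)) ?_ h ?_
  · refine continuous_pi fun i => ?_
    exact Continuous.matrix_fromBlocks (by fun_prop) continuous_const continuous_const (by fun_prop)
  · rintro ⟨f, g⟩ ⟨⟨k, P, Q, hPQ, hQP, d, hd⟩, ⟨k', P', Q', hPQ', hQP', d', hd'⟩⟩
    let σ : Fin k ⊕ Fin k' ≃ Fin (k + k') := finSumFinEquiv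
    refine ⟨k + k', (Matrix.fromBlocks P 0 0 P').submatrix id σ.symm,
      (Matrix.fromBlocks Q 0 0 Q').submatrix σ.symm id, ?_, ?_,
      fun i => Sum.elim (d i) (d' i) ∘ σ.symm, fun i => ?_⟩
    · rw [Matrix.submatrix_mul_equiv, Matrix.fromBlocks_multiply]
      simp [hPQ, hPQ']
    · rw [← Matrix.submatrix_mul _ _ _ _ _ Function.bijective_id, Matrix.fromBlocks_multiply]
      simp [hQP, hQP']
    · simp only at hd hd' ⊢
      rw [← Matrix.submatrix_diagonal_equiv, Matrix.submatrix_mul_equiv,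
        Matrix.submatrix_mul_equiv, ← Matrix.fromBlocks_diagonal, Matrix.fromBlocks_multiply,
        Matrix.fromBlocks_multiply, hd, hd']
      simp

end MatrixFamilies

section Endomorphisms

variable {𝕜 : Type*} [RCLike 𝕜] {ι : Type*} {V : Type*} [AddCommGroup V] [Module 𝕜 V]

theorem diagonalizableFamilies_change_basis {n m : Type*} [Fintype n] [DecidableEq n] [Fintype m]
    [DecidableEq m] (b : Basis n 𝕜 V) (c : Basis m 𝕜 V) {f : ι → End 𝕜 V}
    (h : (fun i => LinearMap.toMatrix b b (f i)) ∈ closure (diagonalizableFamilies 𝕜 ι n)) :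
    (fun i => LinearMap.toMatrix c c (f i)) ∈ closure (diagonalizableFamilies 𝕜 ι m) := by
  have h1 := diagonalizableFamilies_conj (Basis.toMatrix_mul_toMatrix_flip c b)
    (Basis.toMatrix_mul_toMatrix_flip b c) h
  simpa only [basis_toMatrix_mul_linearMap_toMatrix_mul_basis_toMatrix] using h1

/-- An endomorphism killed by a nonzero polynomial with all roots in the base field. -/
def HasSplitAnnihilator (T : End 𝕜 V) : Prop :=
  ∃ p : 𝕜[X], p ≠ 0 ∧ p.Splits ∧ aeval T p = 0

theorem HasSplitAnnihilator.restrict {T : End 𝕜 V} (hT : HasSplitAnnihilator T)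
    {W : Submodule 𝕜 V} (h : ∀ v ∈ W, T v ∈ W) : HasSplitAnnihilator (T.restrict h) := by
  obtain ⟨p, hp, hs, hT⟩ := hT
  refine ⟨p, hp, hs, ?_⟩
  ext v
  have key : ∀ q : 𝕜[X], ((aeval (T.restrict h) q) v : V) = aeval T q v := by
    intro q
    induction q using Polynomial.induction_on' with
    | add p q hp hq => simp [hp, hq]
    | monomial n a =>
      rw [aeval_monomial, aeval_monomial]
      simp only [Algebra.algebraMap_eq_smul_one, smul_mul_assoc, one_mul, LinearMap.smul_apply,
        Submodule.coe_smul]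
      congr 1
      rw [Module.End.pow_restrict]
      rfl
  rw [key, hT]
  simp

theorem HasSplitAnnihilator.of_isNilpotent {T : End 𝕜 V} (hT : IsNilpotent T) :
    HasSplitAnnihilator T := by
  obtain ⟨k, hk⟩ := hT
  exact ⟨X ^ k, pow_ne_zero _ X_ne_zero, Splits.X.pow k, by simp [hk]⟩

theorem HasSplitAnnihilator.of_pow_mul {T : End 𝕜 V} (k : ℕ) (t : 𝕜)
    (h : T ^ k * (T - algebraMap 𝕜 _ t) = 0) : HasSplitAnnihilator T :=
  ⟨X ^ k * (X - C t), mul_ne_zero (pow_ne_zero _ X_ne_zero) (X_sub_C_ne_zero t),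
    (Splits.X.pow k).mul (Splits.X_sub_C t), by simpa using h⟩

variable [FiniteDimensional 𝕜 V]

/-- A family of endomorphisms is a limit of simultaneously diagonalizable families. -/
def IsDiagLimit (f : ι → End 𝕜 V) : Prop :=
  (fun i => LinearMap.toMatrix (finBasis 𝕜 V) (finBasis 𝕜 V) (f i)) ∈
    closure (diagonalizableFamilies 𝕜 ι (Fin (finrank 𝕜 V)))

theorem isDiagLimit_iff {n : Type*} [Fintype n] [DecidableEq n] (b : Basis n 𝕜 V)
    {f : ι → End 𝕜 V} : IsDiagLimit f ↔
      (fun i => LinearMap.toMatrix b b (f i)) ∈ closure (diagonalizableFamilies 𝕜 ι n) :=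
  ⟨diagonalizableFamilies_change_basis _ _, diagonalizableFamilies_change_basis _ _⟩

theorem IsDiagLimit.of_adjoin {κ : Type*} {f : ι → End 𝕜 V} {g : κ → End 𝕜 V}
    (hf : IsDiagLimit f) (hg : ∀ j, g j ∈ Algebra.adjoin 𝕜 (Set.range f)) : IsDiagLimit g := by
  refine diagonalizableFamilies_adjoin (fun j => ?_) hf
  have h := (Subalgebra.mem_map (f := (LinearMap.toMatrixAlgEquiv (finBasis 𝕜 V)).toAlgHom)).2
    ⟨_, hg j, rfl⟩
  rw [AlgHom.map_adjoin, ← Set.range_comp] at h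
  exact h

theorem IsDiagLimit.conj {V' : Type*} [AddCommGroup V'] [Module 𝕜 V'] [FiniteDimensional 𝕜 V']
    (e : V ≃ₗ[𝕜] V') {f : ι → End 𝕜 V} {f' : ι → End 𝕜 V'} (h : ∀ i v, f' i (e v) = e (f i v))
    (hf : IsDiagLimit f) : IsDiagLimit f' := by
  rw [isDiagLimit_iff ((finBasis 𝕜 V).map e)]
  refine (congrArg (· ∈ closure _) (_root_.funext fun i => ?_)).mp hf
  ext a b
  simp [LinearMap.toMatrix_apply, h]

theorem IsDiagLimit.prodMap {V' : Type*} [AddCommGroup V'] [Module 𝕜 V'] [FiniteDimensional 𝕜 V']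
    {f : ι → End 𝕜 V} {f' : ι → End 𝕜 V'} (hf : IsDiagLimit f) (hf' : IsDiagLimit f') :
    IsDiagLimit fun i => (f i).prodMap (f' i) := by
  rw [isDiagLimit_iff ((finBasis 𝕜 V).prod (finBasis 𝕜 V'))]
  simp only [LinearMap.toMatrix_prodMap]
  exact diagonalizableFamilies_fromBlocks hf hf'

theorem IsDiagLimit.of_isCompl {W W' : Submodule 𝕜 V} (hW : IsCompl W W') {f : ι → End 𝕜 V}
    (h : ∀ i, ∀ v ∈ W, f i v ∈ W) (h' : ∀ i, ∀ v ∈ W', f i v ∈ W')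
    (hf : IsDiagLimit fun i => (f i).restrict (h i))
    (hf' : IsDiagLimit fun i => (f i).restrict (h' i)) : IsDiagLimit f := by
  refine (hf.prodMap hf').conj (Submodule.prodEquivOfIsCompl W W' hW) ?_
  rintro i ⟨v, w⟩
  simp

/-- The closure is closed, and `f + t g` tends to `f` as `t → 0` through nonzero values. This turns
the problem into finding a perturbation direction. -/
theorem IsDiagLimit.of_perturb {f g : ι → End 𝕜 V}
    (h : ∀ t : 𝕜, t ≠ 0 → IsDiagLimit fun i => f i + t • g i) : IsDiagLimit f := by
  set b := finBasis 𝕜 V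
  have h1 : Tendsto (fun (t : 𝕜) i => LinearMap.toMatrix b b (f i) + t • LinearMap.toMatrix b b (g i))
      (𝓝[≠] 0) (𝓝 fun i => LinearMap.toMatrix b b (f i)) := by
    have h2 : Continuous fun (t : 𝕜) (i : ι) =>
      LinearMap.toMatrix b b (f i) + t • LinearMap.toMatrix b b (g i) := by fun_prop
    have h3 := h2.tendsto 0
    simp only [zero_smul, add_zero] at h3
    exact h3.mono_left nhdsWithin_le_nhds
  refine isClosed_closure.mem_of_tendsto h1 ?_
  filter_upwards [self_mem_nhdsWithin] with t ht
  have h4 := h t ht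
  rw [IsDiagLimit] at h4
  simpa only [map_add, map_smul] using h4

/-- Take a root `μ` of the minimal polynomial and separate the full power of `X - μ` from the rest:
either that power alone annihilates `T`, or the two coprime factors are both proper. -/
theorem HasSplitAnnihilator.coprime_or_isNilpotent [Nontrivial V] {T : End 𝕜 V}
    (hT : HasSplitAnnihilator T) :
    (∃ p q : 𝕜[X], IsCoprime p q ∧ aeval T (p * q) = 0 ∧ aeval T p ≠ 0 ∧ aeval T q ≠ 0) ∨
      ∃ μ : 𝕜, IsNilpotent (T - algebraMap 𝕜 _ μ) := by
  obtain ⟨p, hp, hs, hTp⟩ := hT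
  have hint : IsIntegral 𝕜 T := Algebra.IsIntegral.isIntegral T
  have hm : (minpoly 𝕜 T).Splits := hs.of_dvd hp (minpoly.dvd _ _ hTp)
  obtain ⟨μ, hμ⟩ := hm.exists_eval_eq_zero (minpoly.degree_pos hint).ne'
  obtain ⟨q, hq, hndvd⟩ := exists_eq_pow_rootMultiplicity_mul_and_not_dvd (minpoly 𝕜 T)
    (minpoly.ne_zero hint) μ
  set k := rootMultiplicity μ (minpoly 𝕜 T)
  by_cases h1 : aeval T ((X - C μ) ^ k) = 0
  · exact Or.inr ⟨μ, k, by simpa using h1⟩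
  · refine Or.inl ⟨(X - C μ) ^ k, q, ?_, ?_, h1, fun h2 => ?_⟩
    · exact ((irreducible_X_sub_C μ).coprime_iff_not_dvd.2 hndvd).pow_left
    · rw [← hq, minpoly.aeval]
    · exact hndvd ((dvd_iff_isRoot.2 hμ).trans (minpoly.dvd _ _ h2))

end Endomorphisms

section Induction

variable (𝕜 : Type) [RCLike 𝕜]

/-- In dimension `d`, commuting families with eigenvalues in the base field are limits of
simultaneously diagonalizable families. -/
def DiagLimitDim (d : ℕ) : Prop :=
  ∀ (V : Type) [AddCommGroup V] [Module 𝕜 V] [FiniteDimensional 𝕜 V], finrank 𝕜 V = d →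
    ∀ (ι : Type) (f : ι → End 𝕜 V), (∀ i j, Commute (f i) (f j)) →
      (∀ i, HasSplitAnnihilator (f i)) → IsDiagLimit f

variable {𝕜} {V : Type} [AddCommGroup V] [Module 𝕜 V] [FiniteDimensional 𝕜 V] {ι : Type}

/-- The kernels of `p(T)` and `q(T)` are complementary, invariant under everything commuting with
`T`, and both proper, so induction on the dimension applies to each summand. -/
theorem isDiagLimit_of_coprime (hd : ∀ d < finrank 𝕜 V, DiagLimitDim 𝕜 d) {f : ι → End 𝕜 V}
    (hc : ∀ i j, Commute (f i) (f j)) (hs : ∀ i, HasSplitAnnihilator (f i)) (T : End 𝕜 V)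
    (hT : ∀ i, Commute T (f i)) {p q : 𝕜[X]} (hpq : IsCoprime p q) (h0 : aeval T (p * q) = 0)
    (hp : aeval T p ≠ 0) (hq : aeval T q ≠ 0) : IsDiagLimit f := by
  have hinv : ∀ (r : 𝕜[X]) i, ∀ v ∈ LinearMap.ker (aeval T r), f i v ∈ LinearMap.ker (aeval T r) := by
    intro r i v hv
    have h1 : Commute (aeval T r) (f i) :=
      (Algebra.commute_of_mem_adjoin_singleton_of_commute
        (aeval_mem_adjoin_singleton 𝕜 (p := r) T) (hT i).symm).symm
    rw [LinearMap.mem_ker] at hv ⊢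
    rw [← Module.End.mul_apply, h1.eq, Module.End.mul_apply, hv, map_zero]
  have hcompl : IsCompl (LinearMap.ker (aeval T p)) (LinearMap.ker (aeval T q)) := by
    refine ⟨Polynomial.disjoint_ker_aeval_of_isCoprime T hpq, codisjoint_iff.2 ?_⟩
    rw [Polynomial.sup_ker_aeval_eq_ker_aeval_mul_of_coprime T hpq, h0, LinearMap.ker_zero]
  have hlt : ∀ r : 𝕜[X], aeval T r ≠ 0 → finrank 𝕜 (LinearMap.ker (aeval T r)) < finrank 𝕜 V := by
    intro r hr
    refine Submodule.finrank_lt (lt_of_le_of_ne le_top fun h => hr (LinearMap.ker_eq_top.1 h)).ne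
  have key : ∀ r : 𝕜[X], aeval T r ≠ 0 → IsDiagLimit fun i => (f i).restrict (hinv r i) := by
    intro r hr
    refine hd _ (hlt r hr) _ rfl _ _ (fun i j => ?_) fun i => (hs i).restrict _
    refine LinearMap.ext fun v => Subtype.ext ?_
    exact LinearMap.congr_fun (hc i j).eq v.1
  exact IsDiagLimit.of_isCompl hcompl (hinv p) (hinv q) (key p hp) (key q hq)

end Induction

end ConjLimit

namespace ConjLimit
open Module Polynomial

/-! ### Perturbing nilpotent families: rank one members. -/

section LocalFamilies

theorem smulRight_mul_smulRight {𝕜 V : Type*} [Field 𝕜] [AddCommGroup V] [Module 𝕜 V]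
    (φ ψ : Module.Dual 𝕜 V) (x y : V) :
    (φ.smulRight x * ψ.smulRight y : End 𝕜 V) = φ y • ψ.smulRight x := by
  ext v
  simp [smul_smul, mul_comm]

variable {𝕜 : Type} [RCLike 𝕜] {V : Type} [AddCommGroup V] [Module 𝕜 V] [FiniteDimensional 𝕜 V]
  {ι : Type}

theorem isDiagLimit_of_forall_eq_zero {f : ι → End 𝕜 V} (hf : ∀ i, f i = 0) : IsDiagLimit f := by
  refine subset_closure ⟨finrank 𝕜 V, 1, 1, by simp, by simp, fun _ => 0, fun i => ?_⟩
  simp [hf]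

/-- Either some member has two eigenvalues and splits the space, or every member is a scalar plus a
nilpotent; scalars lie in every generated algebra and can be subtracted. -/
theorem isDiagLimit_of_isNilpotent_case (hd : ∀ d < finrank 𝕜 V, DiagLimitDim 𝕜 d)
    {f : ι → End 𝕜 V} (hc : ∀ i j, Commute (f i) (f j)) (hs : ∀ i, HasSplitAnnihilator (f i))
    (hnil : ∀ g : ι → End 𝕜 V, (∀ i j, Commute (g i) (g j)) → (∀ i, IsNilpotent (g i)) →
      IsDiagLimit g) : IsDiagLimit f := by
  rcases subsingleton_or_nontrivial V with hV | hV
  · exact isDiagLimit_of_forall_eq_zero fun i => Subsingleton.elim _ _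
  by_cases h : ∃ i, ∃ p q : 𝕜[X], IsCoprime p q ∧ aeval (f i) (p * q) = 0 ∧ aeval (f i) p ≠ 0 ∧
      aeval (f i) q ≠ 0
  · obtain ⟨i, p, q, hpq, h0, hp, hq⟩ := h
    exact isDiagLimit_of_coprime hd hc hs (f i) (hc i) hpq h0 hp hq
  · push Not at h
    have h1 : ∀ i, ∃ μ : 𝕜, IsNilpotent (f i - algebraMap 𝕜 _ μ) := fun i => by
      rcases (hs i).coprime_or_isNilpotent with ⟨p, q, hpq, h0, hp, hq⟩ | h1
      · exact absurd (h i p q hpq h0 hp) hq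
      · exact h1
    choose μ hμ using h1
    refine (hnil (fun i => f i - algebraMap 𝕜 _ (μ i)) (fun i j => ?_) hμ).of_adjoin fun i => ?_
    · exact ((hc i j).sub_right (Algebra.commutes _ _).symm).sub_left
        (Commute.sub_right (Algebra.commutes _ _) (Algebra.commutes _ _))
    · have h2 := Subalgebra.add_mem _ (Algebra.subset_adjoin (R := 𝕜)
        (s := Set.range fun i => f i - algebraMap 𝕜 (End 𝕜 V) (μ i)) ⟨i, rfl⟩)
        (Subalgebra.algebraMap_mem _ (μ i))
      simpa using h2

/-- Perturbing one member of a commuting family of nilpotent endomorphisms so that it acquires a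
second eigenvalue. -/
theorem isDiagLimit_of_perturb_one (hd : ∀ d < finrank 𝕜 V, DiagLimitDim 𝕜 d) {κ : Type}
    (X E : End 𝕜 V) (f : κ → End 𝕜 V) (hc : ∀ i j, Commute (f i) (f j))
    (hn : ∀ i, IsNilpotent (f i)) (hX : ∀ i, Commute X (f i)) (hE : ∀ i, Commute E (f i)) (k : ℕ)
    (h0 : ∀ t : 𝕜, (X + t • E) ^ k * (X + t • E - algebraMap 𝕜 _ t) = 0)
    (h1 : ∀ t : 𝕜, t ≠ 0 → (X + t • E) ^ k ≠ 0)
    (h2 : ∀ t : 𝕜, t ≠ 0 → X + t • E ≠ algebraMap 𝕜 _ t)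
    {g : ι → End 𝕜 V} (hg : ∀ i, g i ∈ Algebra.adjoin 𝕜 (insert X (Set.range f))) :
    IsDiagLimit g := by
  have key : IsDiagLimit fun o : Option κ => o.elim X f := by
    -- Only the member `X` moves. The perturbed `X + t E` still commutes with the others and is
    -- killed by `X ^ k (X - t)`, whose factors are coprime and individually do not kill it.
    refine IsDiagLimit.of_perturb (g := fun o : Option κ => o.elim E fun _ => 0) fun t ht => ?_
    have hT : ∀ i, Commute (X + t • E) (f i) := fun i => (hX i).add_left ((hE i).smul_left t)
    have hfam : (fun o : Option κ => o.elim X f + t • o.elim E fun _ => 0) =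
        fun o : Option κ => o.elim (X + t • E) f := by
      funext o
      cases o <;> simp
    rw [hfam]
    refine isDiagLimit_of_coprime hd ?_ ?_ (X + t • E) ?_ (p := Polynomial.X ^ k)
      (q := Polynomial.X - C t) ?_ ?_ ?_ ?_
    · rintro (_ | i) (_ | j)
      exacts [Commute.refl _, hT j, (hT i).symm, hc i j]
    · rintro (_ | i)
      exacts [HasSplitAnnihilator.of_pow_mul k t (h0 t), HasSplitAnnihilator.of_isNilpotent (hn i)]
    · rintro (_ | i)
      exacts [Commute.refl _, hT i]
    · refine IsCoprime.pow_left ?_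
      have := isCoprime_X_sub_C_of_isUnit_sub (a := (0 : 𝕜)) (b := t)
        (by simpa using ht)
      simpa using this
    · simpa using h0 t
    · simpa using h1 t ht
    · simpa [sub_eq_zero] using h2 t ht
  refine key.of_adjoin fun i => ?_
  have : insert X (Set.range f) ⊆ Set.range fun o : Option κ => o.elim X f := by
    rintro x (rfl | ⟨i, rfl⟩)
    exacts [⟨none, rfl⟩, ⟨some i, rfl⟩]
  exact Algebra.adjoin_mono this (hg i)

theorem pow_finrank_eq_zero_of_isNilpotent {T : End 𝕜 V} (hT : IsNilpotent T) :
    T ^ finrank 𝕜 V = 0 := by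
  simpa [hT.charpoly_eq_X_pow_finrank] using T.aeval_self_charpoly

/-- Families whose members all factor through one functional. -/
theorem isDiagLimit_of_common_functional (hd : ∀ d < finrank 𝕜 V, DiagLimitDim 𝕜 d)
    (φ : Module.Dual 𝕜 V) (u : ι → V) (hu : ∀ i, φ (u i) = 0) :
    IsDiagLimit fun i => (φ.smulRight (u i) : End 𝕜 V) := by
  by_cases hall : ∀ i, (φ.smulRight (u i) : End 𝕜 V) = 0
  · exact isDiagLimit_of_forall_eq_zero hall
  push Not at hall
  obtain ⟨i₀, hi₀⟩ := hall
  have hφ : φ ≠ 0 := by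
    rintro rfl
    exact hi₀ (by ext; simp)
  have hne : u i₀ ≠ 0 := by
    intro h
    exact hi₀ (by ext; simp [h])
  obtain ⟨e₀, he₀⟩ : ∃ e₀, φ e₀ = 1 := LinearMap.surjective hφ 1
  set e₁ := u i₀
  have he₁ : φ e₁ = 0 := hu i₀
  obtain ⟨ψ', hψ'⟩ := Module.Projective.exists_dual_ne_zero 𝕜 hne
  set ψ : Module.Dual 𝕜 V := (ψ' e₁)⁻¹ • (ψ' - ψ' e₀ • φ) with hψ
  have hψ₁ : ψ e₁ = 1 := by simp [hψ, he₁, hψ']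
  have hψ₀ : ψ e₀ = 0 := by simp [hψ, he₀]
  -- The perturbed operator `(φ + tψ) ⊗ e₁` has rank one and eigenvalue `t` on `e₁`. Subtracting `ψ
  -- (u i) • e₁` puts the other vectors in the kernel of `ψ`, so their operators commute with it.
  refine isDiagLimit_of_perturb_one hd (φ.smulRight e₁) (ψ.smulRight e₁)
    (fun i => φ.smulRight (u i - ψ (u i) • e₁)) (fun i j => ?_) (fun i => ⟨2, ?_⟩) (fun i => ?_)
    (fun i => ?_) 1 (fun t => ?_) (fun t ht h => ?_) (fun t ht h => ?_) (fun i => ?_)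
  · simp [commute_iff_eq, smulRight_mul_smulRight, hu, he₁]
  · simp [pow_two, smulRight_mul_smulRight, hu, he₁]
  · simp [commute_iff_eq, smulRight_mul_smulRight, hu, he₁]
  · simp [commute_iff_eq, smulRight_mul_smulRight, he₁, hψ₁]
  · simp only [Algebra.algebraMap_eq_smul_one, pow_one, mul_sub, add_mul, mul_add, smul_mul_assoc,
      mul_smul_comm, smulRight_mul_smulRight, he₁, hψ₁, mul_one]
    module
  · have := congrArg ψ (LinearMap.congr_fun h e₁)
    simp [he₁, hψ₁, ht] at this
  · have := congrArg φ (LinearMap.congr_fun h e₀)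
    simp [he₀, he₁, hψ₀, Algebra.algebraMap_eq_smul_one] at this
    exact ht this.symm
  · have h1 : (φ.smulRight (u i) : End 𝕜 V) =
        ψ (u i) • φ.smulRight e₁ + φ.smulRight (u i - ψ (u i) • e₁) := by
      ext v
      simp only [LinearMap.smulRight_apply, LinearMap.add_apply, LinearMap.smul_apply]
      module
    rw [h1]
    exact Subalgebra.add_mem _ (Subalgebra.smul_mem _ (Algebra.subset_adjoin (Set.mem_insert _ _)) _)
      (Algebra.subset_adjoin (Set.mem_insert_of_mem _ ⟨i, rfl⟩))

/-- Families whose members all have range in a common line. -/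
theorem isDiagLimit_of_common_range (hd : ∀ d < finrank 𝕜 V, DiagLimitDim 𝕜 d)
    (o : V) (h : ι → Module.Dual 𝕜 V) (ho : ∀ i, h i o = 0) :
    IsDiagLimit fun i => ((h i).smulRight o : End 𝕜 V) := by
  by_cases hall : ∀ i, ((h i).smulRight o : End 𝕜 V) = 0
  · exact isDiagLimit_of_forall_eq_zero hall
  push Not at hall
  obtain ⟨i₀, hi₀⟩ := hall
  set φ := h i₀
  have hφ : φ ≠ 0 := by
    intro h
    exact hi₀ (by ext; simp [h])
  have hne : o ≠ 0 := by
    rintro rfl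
    exact hi₀ (by ext; simp)
  obtain ⟨e₁, he₁⟩ : ∃ e₁, φ e₁ = 1 := LinearMap.surjective hφ 1
  have hφo : φ o = 0 := ho i₀
  -- Dually, `φ ⊗ (o + t e₁)` has eigenvalue `φ (o + t e₁) = t`, and the other functionals are
  -- corrected by multiples of `φ` so as to vanish on `e₁`.
  refine isDiagLimit_of_perturb_one hd (φ.smulRight o) (φ.smulRight e₁)
    (fun i => (h i - h i e₁ • φ).smulRight o) (fun i j => ?_) (fun i => ⟨2, ?_⟩) (fun i => ?_)
    (fun i => ?_) 1 (fun t => ?_) (fun t ht h => ?_) (fun t ht h => ?_) (fun i => ?_)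
  · simp [commute_iff_eq, smulRight_mul_smulRight, ho, hφo]
  · simp [pow_two, smulRight_mul_smulRight, ho, hφo]
  · simp [commute_iff_eq, smulRight_mul_smulRight, ho, hφo]
  · simp [commute_iff_eq, smulRight_mul_smulRight, he₁, hφo]
  · simp only [Algebra.algebraMap_eq_smul_one, pow_one, mul_sub, add_mul, mul_add, smul_mul_assoc,
      mul_smul_comm, smulRight_mul_smulRight, he₁, hφo, mul_one]
    module
  · have := congrArg φ (LinearMap.congr_fun h e₁)
    simp [he₁, hφo, ht] at this
  · have := LinearMap.congr_fun h o
    simp [hφo, Algebra.algebraMap_eq_smul_one, ht, hne, eq_comm] at this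
  · have h1 : ((h i).smulRight o : End 𝕜 V) =
        h i e₁ • φ.smulRight o + (h i - h i e₁ • φ).smulRight o := by
      ext v
      simp only [LinearMap.smulRight_apply, LinearMap.add_apply, LinearMap.smul_apply,
        LinearMap.sub_apply]
      module
    rw [h1]
    exact Subalgebra.add_mem _ (Subalgebra.smul_mem _ (Algebra.subset_adjoin (Set.mem_insert _ _)) _)
      (Algebra.subset_adjoin (Set.mem_insert_of_mem _ ⟨i, rfl⟩))

end LocalFamilies
end ConjLimit

namespace ConjLimit
open Module Polynomial

/-! ### Nilpotent families with a commuting operator of index at least three. -/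

section LocalFamilies

variable {𝕜 : Type} [RCLike 𝕜] {V : Type} [AddCommGroup V] [Module 𝕜 V] [FiniteDimensional 𝕜 V]
  {ι : Type}

theorem linearIndependent_pow_apply {𝕜 V : Type*} [Field 𝕜] [AddCommGroup V] [Module 𝕜 V]
    {T : End 𝕜 V} {m : ℕ} {v : V} (hv : (T ^ m) v ≠ 0) (h0 : (T ^ (m + 1)) v = 0) :
    LinearIndependent 𝕜 fun j : Fin (m + 1) => (T ^ (j : ℕ)) v := by
  have hbig : ∀ k, m < k → (T ^ k) v = 0 := by
    intro k hk
    obtain ⟨j, rfl⟩ := Nat.exists_eq_add_of_le (show m + 1 ≤ k from hk)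
    rw [add_comm, pow_add, Module.End.mul_apply, h0, map_zero]
  rw [Fintype.linearIndependent_iff]
  intro c hc
  have key : ∀ k : ℕ, ∀ hk : k < m + 1, c ⟨k, hk⟩ = 0 := by
    intro k
    induction k using Nat.strong_induction_on with
    | _ k ih =>
      intro hk
      have h1 := congrArg (T ^ (m - k)) hc
      rw [map_sum, map_zero, Finset.sum_eq_single ⟨k, hk⟩] at h1
      · rw [map_smul, ← Module.End.mul_apply, ← pow_add, Nat.sub_add_cancel (by omega)] at h1
        exact (smul_eq_zero.1 h1).resolve_right hv
      · rintro ⟨j, hj⟩ - hjk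
        have hjk' : j ≠ k := fun h => hjk (Fin.ext h)
        rcases lt_or_gt_of_ne hjk' with h | h
        · rw [ih j h hj, zero_smul, map_zero]
        · rw [map_smul, ← Module.End.mul_apply, ← pow_add, hbig _ (by simp only; omega), smul_zero]
      · simp
  exact fun i => key i i.2

/-- Families commuting with a regular nilpotent endomorphism. -/
theorem isDiagLimit_of_regular (hd : ∀ d < finrank 𝕜 V, DiagLimitDim 𝕜 d) {T : End 𝕜 V} {m : ℕ}
    (hm : 0 < m) (hfin : finrank 𝕜 V = m + 1) (hT : T ^ m ≠ 0) (hT0 : T ^ (m + 1) = 0)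
    {f : ι → End 𝕜 V} (hc : ∀ i, Commute T (f i)) : IsDiagLimit f := by
  obtain ⟨v, hv⟩ : ∃ v, (T ^ m) v ≠ 0 := by
    by_contra! h
    exact hT (LinearMap.ext h)
  have hli := linearIndependent_pow_apply hv (by rw [hT0]; rfl)
  let b : Basis (Fin (m + 1)) 𝕜 V := basisOfLinearIndependentOfCardEqFinrank hli (by simp [hfin])
  have hb : ∀ j, b j = (T ^ (j : ℕ)) v := fun j => by simp [b]
  have hb0 : b 0 = v := by simp [hb]
  set φ := b.coord 0 with hφ
  have hφv : φ v = 1 := by rw [← hb0, hφ]; simp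
  have hφT : ∀ j, 0 < j → φ ((T ^ j) v) = 0 := by
    intro j hj
    by_cases hjm : j < m + 1
    · have h1 : (T ^ j) v = b ⟨j, hjm⟩ := by rw [hb]
      rw [h1, hφ, Basis.coord_apply, Basis.repr_self, Finsupp.single_eq_of_ne]
      simp [Fin.ext_iff]
      omega
    · obtain ⟨k, rfl⟩ := Nat.exists_eq_add_of_le (not_lt.1 hjm)
      rw [pow_add, hT0]
      simp
  have hpow : ∀ (t : 𝕜) (k j : ℕ), 0 < j →
      ((T + t • φ.smulRight v) ^ k) ((T ^ j) v) = (T ^ (k + j)) v := by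
    intro t k
    induction k with
    | zero => simp
    | succ k ih =>
      intro j hj
      rw [pow_succ, Module.End.mul_apply]
      have : (T + t • φ.smulRight v) ((T ^ j) v) = (T ^ (j + 1)) v := by
        simp [hφT j hj, pow_succ']
      rw [this, ih _ (by omega)]
      congr 2
      omega
  have hvan : ∀ (t : 𝕜) (j : ℕ), 0 < j → ((T + t • φ.smulRight v) ^ m) ((T ^ j) v) = 0 := by
    intro t j hj
    obtain ⟨i, rfl⟩ := Nat.exists_eq_add_of_le (show 1 ≤ j from hj)
    rw [hpow t m _ hj, ← add_assoc, pow_add, hT0]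
    simp
  -- In the cyclic basis `v, T v, …` the perturbation adds the diagonal entry `t` at `v`, giving the
  -- eigenvalues `0` and `t`. No other generators are needed, since the commutant of a regular
  -- nilpotent consists of polynomials in it.
  refine isDiagLimit_of_perturb_one hd (κ := Empty) T (φ.smulRight v) Empty.elim (fun i => i.elim)
    (fun i => i.elim) (fun i => i.elim) (fun i => i.elim) m (fun t => ?_) (fun t ht h => ?_)
    (fun t ht h => ?_) (fun i => ?_)
  · refine b.ext fun j => ?_
    rw [hb, Module.End.mul_apply, LinearMap.zero_apply]
    rcases Nat.eq_zero_or_pos (j : ℕ) with hj | hj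
    · have : (T + t • φ.smulRight v - algebraMap 𝕜 _ t) ((T ^ (j : ℕ)) v) = (T ^ 1) v := by
        simp [hj, hφv, Algebra.algebraMap_eq_smul_one]
      rw [this, hvan t 1 one_pos]
    · have : (T + t • φ.smulRight v - algebraMap 𝕜 _ t) ((T ^ (j : ℕ)) v) =
          (T ^ ((j : ℕ) + 1)) v - t • (T ^ (j : ℕ)) v := by
        simp [hφT _ hj, Algebra.algebraMap_eq_smul_one, pow_succ']
      rw [this, map_sub, map_smul, hvan t _ hj, hvan t _ (by omega), smul_zero, sub_zero]
  · have hφφ : ∀ x, φ ((T + t • φ.smulRight v) x) = t * φ x := by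
      intro x
      have h1 : φ ∘ₗ T = 0 := b.ext fun j => by
        have := hφT ((j : ℕ) + 1) (by omega)
        rw [pow_succ'] at this
        simpa [hb] using this
      have h2 : φ (T x) = 0 := LinearMap.congr_fun h1 x
      simp [h2, hφv]
    have h3 : ∀ k, φ (((T + t • φ.smulRight v) ^ k) v) = t ^ k := by
      intro k
      induction k with
      | zero => simp [hφv]
      | succ k ih => rw [pow_succ', Module.End.mul_apply, hφφ, ih, pow_succ']
    have h4 := h3 m
    rw [h] at h4
    simp only [LinearMap.zero_apply, map_zero] at h4
    exact pow_ne_zero m ht h4.symm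
  · have h1 := LinearMap.congr_fun h v
    simp [hφv, Algebra.algebraMap_eq_smul_one] at h1
    obtain ⟨k, rfl⟩ := Nat.exists_eq_add_of_le (show 1 ≤ m from hm)
    rw [add_comm, pow_succ, Module.End.mul_apply, h1, map_zero] at hv
    exact hv rfl
  · have h1 : f i = ∑ j, b.repr (f i v) j • T ^ (j : ℕ) := by
      refine b.ext fun k => ?_
      have h2 : f i v = ∑ j, b.repr (f i v) j • (T ^ (j : ℕ)) v := by
        conv_lhs => rw [← b.sum_repr (f i v)]
        simp only [hb]
      have h3 : f i ((T ^ (k : ℕ)) v) = (T ^ (k : ℕ)) (f i v) :=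
        (LinearMap.congr_fun ((hc i).pow_left k).eq v).symm
      rw [hb, h3]
      conv_lhs => rw [h2]
      rw [map_sum, LinearMap.sum_apply]
      refine Finset.sum_congr rfl fun j _ => ?_
      rw [map_smul, LinearMap.smul_apply, ← Module.End.mul_apply, ← Module.End.mul_apply,
        ← pow_add, ← pow_add, add_comm (k : ℕ)]
    rw [h1]
    exact Subalgebra.sum_mem _ fun j _ => Subalgebra.smul_mem _ (Subalgebra.pow_mem _
      (Algebra.subset_adjoin (Set.mem_insert _ _)) _) _

/-- Families in dimension four commuting with a nilpotent endomorphism of nilpotency index three. -/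
theorem isDiagLimit_of_index_three (hd : ∀ d < finrank 𝕜 V, DiagLimitDim 𝕜 d)
    (hfin : finrank 𝕜 V = 4) {T : End 𝕜 V} (hT : T ^ 2 ≠ 0) (hT0 : T ^ 3 = 0)
    {f : ι → End 𝕜 V} (hc : ∀ i, Commute T (f i)) (hcf : ∀ i j, Commute (f i) (f j))
    (hn : ∀ i, IsNilpotent (f i)) : IsDiagLimit f := by
  obtain ⟨v, hv⟩ : ∃ v, (T ^ 2) v ≠ 0 := by
    by_contra! h
    exact hT (LinearMap.ext h)
  have hv3 : T (T (T v)) = 0 := by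
    have := LinearMap.congr_fun hT0 v
    simpa [pow_succ] using this
  have hv2 : T (T v) ≠ 0 := by simpa [pow_succ] using hv
  -- The Jordan type is `(3, 1)`. If the kernel of `T` were only the line of `T² v`, lifting back
  -- through `T` would span the four-dimensional space by `v, T v, T² v`.
  obtain ⟨w, hw, hwv⟩ : ∃ w, T w = 0 ∧ w ∉ Submodule.span 𝕜 {T (T v)} := by
    by_contra! h
    have hspan : ∀ u, u ∈ Submodule.span 𝕜 (Set.range ![v, T v, T (T v)]) := by
      intro u
      have h0 : T (T (T u)) = 0 := by
        have := LinearMap.congr_fun hT0 u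
        simpa [pow_succ] using this
      obtain ⟨a, ha⟩ := Submodule.mem_span_singleton.1 (h _ h0)
      obtain ⟨c, hc⟩ := Submodule.mem_span_singleton.1 (h (T u - a • T v) (by simp [ha]))
      obtain ⟨e, he⟩ := Submodule.mem_span_singleton.1 (h (u - a • v - c • T v) (by simp [hc]))
      have hu : u = a • v + c • T v + e • T (T v) := by
        rw [he]
        abel
      rw [hu]
      refine Submodule.add_mem _ (Submodule.add_mem _ ?_ ?_) ?_ <;>
        refine Submodule.smul_mem _ _ (Submodule.subset_span ?_)
      exacts [⟨0, rfl⟩, ⟨1, rfl⟩, ⟨2, rfl⟩]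
    have h1 := finrank_range_le_card (R := 𝕜) ![v, T v, T (T v)]
    rw [Set.finrank, (Submodule.eq_top_iff'.2 hspan : Submodule.span 𝕜 _ = ⊤), finrank_top, hfin] at h1
    simp at h1
  have hli : LinearIndependent 𝕜 ![v, T v, T (T v), w] := by
    rw [Fintype.linearIndependent_iff]
    intro c hsum
    simp only [Fin.sum_univ_four, Matrix.cons_val] at hsum
    have h0 : c 0 = 0 := by
      have := congrArg (fun u => T (T u)) hsum
      simpa [hv3, hw, hv2] using this
    have h1 : c 1 = 0 := by
      have := congrArg T hsum
      simpa [hv3, hw, hv2, h0] using this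
    have h3 : c 3 = 0 := by
      by_contra h3
      refine hwv (Submodule.mem_span_singleton.2 ⟨-((c 3)⁻¹ * c 2), ?_⟩)
      have h4 : c 2 • T (T v) = -(c 3 • w) := by
        rw [h0, h1] at hsum
        simpa [add_eq_zero_iff_eq_neg] using hsum
      rw [neg_smul, mul_smul, h4, smul_neg, neg_neg, smul_smul, inv_mul_cancel₀ h3, one_smul]
    have h2 : c 2 = 0 := by
      simpa [h0, h1, h3, hv2] using hsum
    intro i
    fin_cases i <;> assumption
  let b : Basis (Fin 4) 𝕜 V := basisOfLinearIndependentOfCardEqFinrank hli (by simp [hfin])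
  have hb : ∀ j, b j = ![v, T v, T (T v), w] j := fun j => by simp [b]
  have hexp : ∀ u, u = b.repr u 0 • v + b.repr u 1 • T v + b.repr u 2 • T (T v) +
      b.repr u 3 • w := by
    intro u
    conv_lhs => rw [← b.sum_repr u]
    simp [Fin.sum_univ_four, hb]
  have hzero : ∀ a c d e : 𝕜, a • v + c • T v + d • T (T v) + e • w = 0 →
      a = 0 ∧ c = 0 ∧ d = 0 ∧ e = 0 := by
    intro a c d e h
    have := Fintype.linearIndependent_iff.1 hli ![a, c, d, e] (by
      simpa [Fin.sum_univ_four] using h)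
    exact ⟨this 0, this 1, this 2, this 3⟩
  have heig : ∀ (S : End 𝕜 V), IsNilpotent S → ∀ (u : V) (a : 𝕜), u ≠ 0 → S u = a • u → a = 0 := by
    rintro S ⟨k, hk⟩ u a hu hSu
    have h1 : ∀ j, (S ^ j) u = a ^ j • u := by
      intro j
      induction j with
      | zero => simp
      | succ j ih => rw [pow_succ, Module.End.mul_apply, hSu, map_smul, ih, smul_smul, pow_succ']
    have h2 := h1 k
    rw [hk, LinearMap.zero_apply] at h2
    exact IsReduced.eq_zero a ⟨k, (smul_eq_zero.1 h2.symm).resolve_right hu⟩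
  -- Commuting with `T` fixes the shape up to eigenvalues: `α` occurs on `T² v`, and `δ'` occurs on
  -- `f i w` if nonzero. Nilpotency kills both.
  have hshape : ∀ i, ∃ β γ δ ε : 𝕜, f i v = β • T v + γ • T (T v) + δ • w ∧
      f i w = ε • T (T v) := by
    intro i
    have hcT : ∀ u, f i (T u) = T (f i u) := fun u => (LinearMap.congr_fun (hc i).eq u).symm
    obtain ⟨α, β, γ, δ, h1⟩ : ∃ α β γ δ : 𝕜, f i v = α • v + β • T v + γ • T (T v) + δ • w :=
      ⟨_, _, _, _, hexp _⟩
    obtain ⟨α', β', γ', δ', h2⟩ : ∃ α β γ δ : 𝕜, f i w = α • v + β • T v + γ • T (T v) + δ • w :=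
      ⟨_, _, _, _, hexp _⟩
    have hα : α = 0 := by
      refine heig (f i) (hn i) (T (T v)) α hv2 ?_
      rw [hcT, hcT, h1]
      simp [hv3, hw]
    have h3 : T (f i w) = 0 := by rw [← hcT, hw, map_zero]
    rw [h2] at h3
    simp only [map_add, map_smul, hv3, hw, smul_zero, add_zero] at h3
    obtain ⟨-, hα', hβ', -⟩ := hzero 0 α' β' 0 (by simpa using h3)
    have hδ' : δ' = 0 := by
      by_contra hδ'
      refine hδ' (heig (f i) (hn i) (f i w) δ' (fun h => ?_) ?_)
      · rw [h2] at h
        exact hδ' (hzero _ _ _ _ h).2.2.2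
      · conv_lhs => rw [h2]
        have : f i (T (T v)) = 0 := by
          rw [hcT, hcT, h1, hα]
          simp [hv3, hw]
        simp [hα', hβ', this]
    refine ⟨β, γ, δ, γ', ?_, ?_⟩
    · rw [h1, hα, zero_smul, zero_add]
    · rw [h2, hα', hβ', hδ']
      simp
  choose β γ δ ε hfv hfw using hshape
  have hfT : ∀ i, f i (T v) = β i • T (T v) := by
    intro i
    have : f i (T v) = T (f i v) := (LinearMap.congr_fun (hc i).eq v).symm
    rw [this, hfv]
    simp [hv3, hw]
  have hfTT : ∀ i, f i (T (T v)) = 0 := by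
    intro i
    have : f i (T (T v)) = T (f i (T v)) := (LinearMap.congr_fun (hc i).eq (T v)).symm
    rw [this, hfT]
    simp [hv3]
  have hprop : ∀ i j, δ j * ε i = δ i * ε j := by
    intro i j
    have h1 := LinearMap.congr_fun (hcf i j).eq v
    simp only [Module.End.mul_apply, hfv, map_add, map_smul, hfT, hfTT, hfw, smul_zero, add_zero,
      smul_smul, ← add_smul] at h1
    have h2 := smul_left_injective 𝕜 hv2 h1
    linear_combination h2
  -- Commutation makes all pairs `(δ i, ε i)` proportional to one pair `(d, e)`. Modulo polynomials
  -- in `T` the family therefore has the single generator `Y`.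
  obtain ⟨d, e, s, hds, hes⟩ : ∃ (d e : 𝕜) (s : ι → 𝕜), (∀ i, δ i = s i * d) ∧
      ∀ i, ε i = s i * e := by
    by_cases h1 : ∃ i, δ i ≠ 0
    · obtain ⟨i₀, h1⟩ := h1
      refine ⟨δ i₀, ε i₀, fun i => δ i / δ i₀, fun i => by field_simp, fun i => ?_⟩
      have := hprop i i₀
      field_simp
      linear_combination this
    · push Not at h1
      exact ⟨0, 1, ε, fun i => by simp [h1], fun i => by simp⟩
  set Y : End 𝕜 V := b.constr 𝕜 ![d • w, 0, 0, e • T (T v)] with hY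
  -- The projection onto the line of the small Jordan block commutes with `T` and gives `Y + t E`
  -- the eigenvalue `t`.
  set E : End 𝕜 V := b.constr 𝕜 ![0, 0, 0, w] with hE
  have hYv : Y v = d • w := by
    have := b.constr_basis 𝕜 ![d • w, 0, 0, e • T (T v)] 0
    rwa [hb] at this
  have hYT : Y (T v) = 0 := by
    have := b.constr_basis 𝕜 ![d • w, 0, 0, e • T (T v)] 1
    rwa [hb] at this
  have hYTT : Y (T (T v)) = 0 := by
    have := b.constr_basis 𝕜 ![d • w, 0, 0, e • T (T v)] 2
    rwa [hb] at this
  have hYw : Y w = e • T (T v) := by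
    have := b.constr_basis 𝕜 ![d • w, 0, 0, e • T (T v)] 3
    rwa [hb] at this
  have hEv : E v = 0 := by
    have := b.constr_basis 𝕜 ![0, 0, 0, w] 0
    rwa [hb] at this
  have hET : E (T v) = 0 := by
    have := b.constr_basis 𝕜 ![0, 0, 0, w] 1
    rwa [hb] at this
  have hETT : E (T (T v)) = 0 := by
    have := b.constr_basis 𝕜 ![0, 0, 0, w] 2
    rwa [hb] at this
  have hEw : E w = w := by
    have := b.constr_basis 𝕜 ![0, 0, 0, w] 3
    rwa [hb] at this
  have hwne : w ≠ 0 := fun h => hwv (h ▸ Submodule.zero_mem _)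
  have hTv : T v ≠ 0 := fun h => hv2 (by rw [h, map_zero])
  have hext : ∀ A B : End 𝕜 V, A v = B v → A (T v) = B (T v) → A (T (T v)) = B (T (T v)) →
      A w = B w → A = B := by
    intro A B h0 h1 h2 h3
    refine b.ext fun j => ?_
    rw [hb]
    fin_cases j <;> assumption
  refine isDiagLimit_of_perturb_one hd Y E (fun _ : Unit => T) (fun _ _ => Commute.refl _)
    (fun _ => ⟨3, hT0⟩) (fun _ => ?_) (fun _ => ?_) 2 (fun t => ?_) (fun t ht h => ?_)
    (fun t ht h => ?_) (fun i => ?_)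
  · apply hext <;> simp [hYv, hYT, hYTT, hYw, hw, hv3]
  · apply hext <;> simp [hEv, hET, hETT, hEw, hw, hv3]
  · apply hext <;>
      simp [pow_two, Algebra.algebraMap_eq_smul_one, hYv, hYT, hYTT, hYw, hEv, hET, hETT, hEw,
        smul_smul, mul_comm]
  · have h1 := LinearMap.congr_fun h w
    simp [pow_two, hYTT, hYw, hETT, hEw, smul_smul] at h1
    have h2 := hzero 0 0 (t * e) (t * t) (by simpa using h1)
    simpa [ht] using h2.2.2.2
  · have h1 := LinearMap.congr_fun h (T v)
    simp only [LinearMap.add_apply, LinearMap.smul_apply, hYT, hET, smul_zero, add_zero,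
      Algebra.algebraMap_eq_smul_one, Module.End.one_apply] at h1
    exact (smul_ne_zero ht hTv) h1.symm
  · have h1 : f i = β i • T + γ i • T ^ 2 + s i • Y := by
      apply hext <;> simp [pow_two, hfv, hfT, hfTT, hfw, hYv, hYT, hYTT, hYw, hw, hv3, hds, hes,
        smul_smul]
    have hTm : T ∈ Algebra.adjoin 𝕜 (insert Y (Set.range fun _ : Unit => T)) :=
      Algebra.subset_adjoin (Set.mem_insert_of_mem _ ⟨(), rfl⟩)
    rw [h1]
    exact Subalgebra.add_mem _ (Subalgebra.add_mem _ (Subalgebra.smul_mem _ hTm _)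
      (Subalgebra.smul_mem _ (Subalgebra.pow_mem _ hTm _) _))
      (Subalgebra.smul_mem _ (Algebra.subset_adjoin (Set.mem_insert _ _)) _)

end LocalFamilies
end ConjLimit

namespace ConjLimit
open Module Polynomial

/-! ### Square-zero families and the density result up to dimension four. -/

section SquareZero

variable {𝕜 : Type} [RCLike 𝕜] {V : Type} [AddCommGroup V] [Module 𝕜 V] [FiniteDimensional 𝕜 V]
  {ι : Type}

/-- The relation leaves three generators: the diagonal block `A` and the two off-diagonal units `N`.
The idempotent `E` commutes with both `N j` and satisfies `A E + E A = A`, which gives `(A + tE)² =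
t (A + tE)`; thus `A` can be perturbed to have the eigenvalues `0` and `t`. -/
theorem isDiagLimit_fromBlocks_of_diagonal_relation (hd : ∀ d < 4, DiagLimitDim 𝕜 d)
    (β : ι → Matrix (Fin 2) (Fin 2) 𝕜) (D : Fin 2 → 𝕜) (hD : D ≠ 0)
    (hβ : ∀ i, D 0 * β i 0 0 + D 1 * β i 1 1 = 0) :
    IsDiagLimit fun i => Matrix.toLinAlgEquiv' (R := 𝕜) (Matrix.fromBlocks 0 (β i) 0 0) := by
  have hfin : finrank 𝕜 (Fin 2 ⊕ Fin 2 → 𝕜) = 4 := by simp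
  rw [← hfin] at hd
  let A : Matrix (Fin 2 ⊕ Fin 2) (Fin 2 ⊕ Fin 2) 𝕜 := Matrix.fromBlocks 0 !![D 1, 0; 0, -D 0] 0 0
  let E : Matrix (Fin 2 ⊕ Fin 2) (Fin 2 ⊕ Fin 2) 𝕜 :=
    Matrix.fromBlocks !![0, 0; 0, 1] 0 0 !![1, 0; 0, 0]
  let N : Fin 2 → Matrix (Fin 2 ⊕ Fin 2) (Fin 2 ⊕ Fin 2) 𝕜 := fun j =>
    Matrix.fromBlocks 0 (![!![0, 1; 0, 0], !![0, 0; 1, 0]] j) 0 0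
  have hz : (0 : Fin 2 → 𝕜) = ![0, 0] := by
    ext i
    fin_cases i <;> rfl
  have hAA : A * A = 0 := by simp [A, Matrix.fromBlocks_multiply]
  have hEA : A * E + E * A = A := by
    simp [A, E, Matrix.fromBlocks_multiply, Matrix.fromBlocks_add]
  have hEE : E * E = E := by
    simp [E, Matrix.fromBlocks_multiply, hz]
  have hNN : ∀ i j, N i * N j = 0 := by
    intro i j
    simp [N, Matrix.fromBlocks_multiply]
  have hAN : ∀ j, A * N j = N j * A := by
    intro j
    simp [A, N, Matrix.fromBlocks_multiply]
  have hEN : ∀ j, E * N j = N j * E := by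
    intro j
    fin_cases j <;> simp [E, N, Matrix.fromBlocks_multiply, hz]
  have hsq : ∀ t : 𝕜, (A + t • E) * (A + t • E - algebraMap 𝕜 _ t) = 0 := by
    intro t
    have h1 : (A + t • E) * (A + t • E - algebraMap 𝕜 _ t) =
        A * A + t • (A * E + E * A - A) + (t * t) • (E * E - E) := by
      rw [Algebra.algebraMap_eq_smul_one]
      simp only [mul_sub, add_mul, mul_add, smul_mul_assoc, mul_smul_comm, mul_one]
      module
    rw [h1, hAA, hEA, hEE]
    simp
  let Φ := Matrix.toLinAlgEquiv' (R := 𝕜) (n := Fin 2 ⊕ Fin 2)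
  refine isDiagLimit_of_perturb_one hd (Φ A) (Φ E) (fun j => Φ (N j)) (fun i j => ?_)
    (fun i => ⟨2, ?_⟩) (fun i => ?_) (fun i => ?_) 1 (fun t => ?_) (fun t ht h => ?_)
    (fun t ht h => ?_) (fun i => ?_)
  · rw [commute_iff_eq, ← map_mul, ← map_mul, hNN, hNN]
  · rw [pow_two, ← map_mul, hNN, map_zero]
  · rw [commute_iff_eq, ← map_mul, ← map_mul, hAN]
  · rw [commute_iff_eq, ← map_mul, ← map_mul, hEN]
  · rw [pow_one, ← map_smul, ← map_add, ← AlgEquiv.commutes Φ t, ← map_sub, ← map_mul, hsq, map_zero]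
  · rw [pow_one, ← map_smul, ← map_add, EmbeddingLike.map_eq_zero_iff] at h
    have h1 := congrFun (congrFun h (Sum.inl 1)) (Sum.inl 1)
    simp [A, E, ht] at h1
  · rw [← map_smul, ← map_add, ← AlgEquiv.commutes Φ t] at h
    have h1 := congrFun (congrFun (Φ.injective h) (Sum.inl 0)) (Sum.inl 0)
    simp [A, E, Matrix.algebraMap_matrix_apply] at h1
    exact ht h1.symm
  · obtain ⟨c, hc0, hc1⟩ : ∃ c, β i 0 0 = c * D 1 ∧ β i 1 1 = c * -D 0 := by
      by_cases h1 : D 1 = 0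
      · have h0 : D 0 ≠ 0 := by
          intro h0
          apply hD
          funext j
          fin_cases j <;> assumption
        have h2 := hβ i
        rw [h1, zero_mul, add_zero] at h2
        refine ⟨-(β i 1 1 / D 0), ?_, by field_simp⟩
        rw [h1, mul_zero]
        exact (mul_eq_zero.1 h2).resolve_left h0
      · refine ⟨β i 0 0 / D 1, by field_simp, ?_⟩
        field_simp
        linear_combination hβ i
    have h1 : Matrix.fromBlocks 0 (β i) 0 0 = c • A + β i 0 1 • N 0 + β i 1 0 • N 1 := by
      simp only [A, N, Matrix.fromBlocks_smul, Matrix.fromBlocks_add]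
      congr 1
      · simp
      · ext a b
        fin_cases a <;> fin_cases b <;> simp [hc0, hc1]
      · simp
      · simp
    rw [h1, map_add, map_add, map_smul, map_smul, map_smul]
    have hNm : ∀ j, Φ (N j) ∈ Algebra.adjoin 𝕜 (insert (Φ A) (Set.range fun j => Φ (N j))) :=
      fun j => Algebra.subset_adjoin (Set.mem_insert_of_mem _ ⟨j, rfl⟩)
    exact Subalgebra.add_mem _ (Subalgebra.add_mem _ (Subalgebra.smul_mem _
      (Algebra.subset_adjoin (Set.mem_insert _ _)) _) (Subalgebra.smul_mem _ (hNm 0) _))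
      (Subalgebra.smul_mem _ (hNm 1) _)

/-- At most three blocks lie in the four-dimensional space of `2 × 2` matrices, so a nonzero `M` is
trace-orthogonal to all of them. Row and column operations diagonalize `M`, and the corresponding
block conjugation makes the relation diagonal. The bound is essential: four independent blocks
together with `1` would span five dimensions. -/
theorem fromBlocks_mem_closure_of_card_le (hd : ∀ d < 4, DiagLimitDim 𝕜 d) [Fintype ι]
    (hι : Fintype.card ι ≤ 3) (β : ι → Matrix (Fin 2) (Fin 2) 𝕜) :
    (fun i => Matrix.fromBlocks 0 (β i) 0 0) ∈
      closure (diagonalizableFamilies 𝕜 ι (Fin 2 ⊕ Fin 2)) := by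
  obtain ⟨M, hM, hM0⟩ : ∃ M : Matrix (Fin 2) (Fin 2) 𝕜, (∀ i, (M * β i).trace = 0) ∧ M ≠ 0 := by
    let l : Matrix (Fin 2) (Fin 2) 𝕜 →ₗ[𝕜] (ι → 𝕜) :=
      LinearMap.pi fun i => (Matrix.traceLinearMap (Fin 2) 𝕜 𝕜).comp (LinearMap.mulRight 𝕜 (β i))
    have hl := LinearMap.ker_ne_bot_of_finrank_lt (f := l) (by
      rw [finrank_fintype_fun_eq_card, finrank_matrix]
      simp
      omega)
    obtain ⟨M, hM, hM0⟩ := Submodule.exists_mem_ne_zero_of_ne_bot hl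
    exact ⟨M, fun i => congrFun hM i, hM0⟩
  obtain ⟨L, L', D, hD⟩ := Matrix.Pivot.exists_list_transvec_mul_diagonal_mul_list_transvec M
  set P := (L.map Matrix.TransvectionStruct.toMatrix).prod with hP
  set Q := (L'.map Matrix.TransvectionStruct.toMatrix).prod with hQ
  have hPu : IsUnit P.det := by
    rw [hP, Matrix.TransvectionStruct.det_toMatrix_prod]; exact isUnit_one
  have hQu : IsUnit Q.det := by
    rw [hQ, Matrix.TransvectionStruct.det_toMatrix_prod]; exact isUnit_one
  have hD0 : D ≠ 0 := by
    rintro rfl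
    apply hM0
    rw [hD]
    simp
  have h1 := isDiagLimit_fromBlocks_of_diagonal_relation hd (fun i => Q * β i * P) D hD0 (fun i => by
    have h2 := hM i
    rw [hD, Matrix.mul_assoc, Matrix.mul_assoc, Matrix.trace_mul_comm, Matrix.mul_assoc] at h2
    simpa [Matrix.trace_fin_two, Matrix.diagonal_mul] using h2)
  rw [isDiagLimit_iff (Pi.basisFun 𝕜 (Fin 2 ⊕ Fin 2))] at h1
  have h3 := diagonalizableFamilies_conj (S := Matrix.fromBlocks Q⁻¹ 0 0 P)
    (T := Matrix.fromBlocks Q 0 0 P⁻¹) (by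
      simp [Matrix.fromBlocks_multiply, Matrix.nonsing_inv_mul _ hQu, Matrix.mul_nonsing_inv _ hPu])
    (by simp [Matrix.fromBlocks_multiply, Matrix.nonsing_inv_mul _ hPu,
          Matrix.mul_nonsing_inv _ hQu]) h1
  refine (congrArg (· ∈ closure _) (_root_.funext fun i => ?_)).mp h3
  have h4 : LinearMap.toMatrix (Pi.basisFun 𝕜 (Fin 2 ⊕ Fin 2)) (Pi.basisFun 𝕜 (Fin 2 ⊕ Fin 2))
      (Matrix.toLinAlgEquiv' (R := 𝕜) (Matrix.fromBlocks 0 (Q * β i * P) 0 0)) =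
      Matrix.fromBlocks 0 (Q * β i * P) 0 0 :=
    LinearMap.toMatrix'_toLin' _
  rw [h4, Matrix.fromBlocks_multiply, Matrix.fromBlocks_multiply]
  simp only [Matrix.mul_zero, Matrix.zero_mul, add_zero, zero_add]
  congr 1
  rw [Matrix.mul_assoc Q, ← Matrix.mul_assoc Q⁻¹, Matrix.nonsing_inv_mul _ hQu, Matrix.one_mul,
    Matrix.mul_assoc, Matrix.mul_nonsing_inv _ hPu, Matrix.mul_one]

/-- Let `K` be the common kernel and `I ≤ K` the sum of the ranges. If `K` has codimension at most
one, all members factor through one functional; if `I` has dimension at most one, they share a line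
as range. Otherwise the dimension is four, `K` has dimension two, and the members are upper right `2
× 2` blocks. -/
theorem isDiagLimit_of_square_zero (hd : ∀ d < finrank 𝕜 V, DiagLimitDim 𝕜 d)
    (hfin : finrank 𝕜 V ≤ 4) 
    (hι : finrank 𝕜 V = 4 → ∃ _ : Fintype ι, Fintype.card ι ≤ 3)
    {f : ι → End 𝕜 V} (hf : ∀ i j, f i * f j = 0) : IsDiagLimit f := by
  set K : Submodule 𝕜 V := ⨅ i, LinearMap.ker (f i) with hK
  set I : Submodule 𝕜 V := ⨆ i, LinearMap.range (f i) with hI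
  have hKf : ∀ i, ∀ v ∈ K, f i v = 0 := fun i v hv => (Submodule.mem_iInf _).1 hv i
  have hIf : ∀ i v, f i v ∈ I := fun i v => Submodule.mem_iSup_of_mem i ⟨v, rfl⟩
  have hIK : I ≤ K := iSup_le fun i => le_iInf fun j => by
    rintro _ ⟨v, rfl⟩
    exact LinearMap.congr_fun (hf j i) v
  by_cases hKtop : K = ⊤
  · exact isDiagLimit_of_forall_eq_zero fun i => LinearMap.ext fun v =>
      hKf i v (hKtop ▸ Submodule.mem_top)
  by_cases hK1 : finrank 𝕜 V ≤ finrank 𝕜 K + 1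
  · obtain ⟨φ, hφ, hKφ⟩ := K.exists_le_ker_of_lt_top (lt_top_iff_ne_top.2 hKtop)
    have hker : K = LinearMap.ker φ := by
      refine Submodule.eq_of_le_of_finrank_le hKφ ?_
      have := Submodule.finrank_lt (s := LinearMap.ker φ) (by
        rwa [Ne, LinearMap.ker_eq_top])
      omega
    obtain ⟨e, he⟩ : ∃ e, φ e = 1 := LinearMap.surjective hφ 1
    have h1 := isDiagLimit_of_common_functional hd φ (fun i => f i e) (fun i => by
      have := hIK (hIf i e)
      rwa [hker] at this)
    refine (congrArg IsDiagLimit (_root_.funext fun i => ?_)).mp h1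
    ext v
    have h2 : v - φ v • e ∈ K := by
      rw [hker, LinearMap.mem_ker]
      simp [he]
    have h3 := hKf i _ h2
    rw [map_sub, map_smul, sub_eq_zero] at h3
    simp [h3]
  by_cases hI1 : finrank 𝕜 I ≤ 1
  · obtain ⟨⟨o, hoI⟩, ho⟩ := finrank_le_one_iff.1 hI1
    have ho' : ∀ i v, ∃ c : 𝕜, c • o = f i v := fun i v => by
      obtain ⟨c, hc⟩ := ho ⟨f i v, hIf i v⟩
      exact ⟨c, congrArg Subtype.val hc⟩
    by_cases ho0 : o = 0
    · refine isDiagLimit_of_forall_eq_zero fun i => LinearMap.ext fun v => ?_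
      obtain ⟨c, hc⟩ := ho' i v
      rw [← hc, ho0, smul_zero, LinearMap.zero_apply]
    · obtain ⟨l', hl'⟩ := Module.Projective.exists_dual_ne_zero 𝕜 ho0
      have h1 := isDiagLimit_of_common_range hd o (fun i => ((l' o)⁻¹ • l').comp (f i)) (fun i => by
        simp [hKf i o (hIK hoI)])
      refine (congrArg IsDiagLimit (_root_.funext fun i => ?_)).mp h1
      ext v
      obtain ⟨c, hc⟩ := ho' i v
      simp [← hc, mul_comm c, hl']
  have hle := Submodule.finrank_mono hIK
  have hV4 : finrank 𝕜 V = 4 := by omega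
  have hK2 : finrank 𝕜 K = 2 := by omega
  obtain ⟨W, hW⟩ := K.exists_isCompl
  have hW2 : finrank 𝕜 W = 2 := by
    have := Submodule.finrank_add_eq_of_isCompl hW
    omega
  let b : Basis (Fin 2 ⊕ Fin 2) 𝕜 V :=
    ((finBasisOfFinrankEq 𝕜 K hK2).prod (finBasisOfFinrankEq 𝕜 W hW2)).map
      (Submodule.prodEquivOfIsCompl K W hW)
  rw [isDiagLimit_iff b]
  obtain ⟨_, hcard⟩ := hι hV4
  have h1 := fromBlocks_mem_closure_of_card_le (hV4 ▸ hd) hcard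
    (fun i => (LinearMap.toMatrix b b (f i)).toBlocks₁₂)
  refine (congrArg (· ∈ closure _) (_root_.funext fun i => ?_)).mp h1
  have hbl : ∀ j, b (Sum.inl j) ∈ K := fun j => by simp [b]
  have hrepr : ∀ v ∈ K, ∀ j, b.repr v (Sum.inr j) = 0 := by
    intro v hv j
    have h2 : (Submodule.prodEquivOfIsCompl K W hW).symm v = (⟨v, hv⟩, 0) := by
      rw [LinearEquiv.symm_apply_eq]
      simp
    simp [b, h2]
  conv_rhs => rw [← Matrix.fromBlocks_toBlocks (LinearMap.toMatrix b b (f i))]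
  congr 1
  · ext p q
    simp [Matrix.toBlocks₁₁, LinearMap.toMatrix_apply, hKf i _ (hbl q)]
  · ext p q
    simp [Matrix.toBlocks₂₁, LinearMap.toMatrix_apply, hKf i _ (hbl q)]
  · ext p q
    simp [Matrix.toBlocks₂₂, LinearMap.toMatrix_apply, hrepr _ (hIK (hIf i _))]

/-- Commuting families of nilpotent endomorphisms in dimension at most four. -/
theorem isDiagLimit_of_isNilpotent (hd : ∀ d < finrank 𝕜 V, DiagLimitDim 𝕜 d)
    (hfin : finrank 𝕜 V ≤ 4) 
    (hι : finrank 𝕜 V = 4 → ∃ _ : Fintype ι, Fintype.card ι ≤ 3)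
    {f : ι → End 𝕜 V} (hc : ∀ i j, Commute (f i) (f j)) (hn : ∀ i, IsNilpotent (f i)) :
    IsDiagLimit f := by
  -- `S` ranges over the nilpotent commutant, not only over the family, so that in the negative case
  -- it can be tested on sums: `(f i + f j)² = 0` polarizes to `f i * f j = 0`.
  by_cases hS : ∃ S : End 𝕜 V, IsNilpotent S ∧ (∀ i, Commute S (f i)) ∧ S ^ 2 ≠ 0
  · obtain ⟨S, hSn, hSc, hS2⟩ := hS
    have h0 := pow_finrank_eq_zero_of_isNilpotent hSn
    have h2 : 2 < finrank 𝕜 V := by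
      by_contra! h
      exact hS2 (pow_eq_zero_of_le h h0)
    rcases (show finrank 𝕜 V = 3 ∨ finrank 𝕜 V = 4 by omega) with h | h
    · exact isDiagLimit_of_regular hd two_pos h hS2 (by rwa [h] at h0) hSc
    · by_cases h3 : S ^ 3 = 0
      · exact isDiagLimit_of_index_three hd h hS2 h3 hSc hc hn
      · exact isDiagLimit_of_regular hd three_pos h h3 (by rwa [h] at h0) hSc
  · push Not at hS
    have h1 : ∀ i, f i ^ 2 = 0 := fun i => hS _ (hn i) (hc i)
    refine isDiagLimit_of_square_zero hd hfin hι fun i j => ?_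
    have h2 := hS (f i + f j) ((hc i j).isNilpotent_add (hn i) (hn j))
      fun k => (hc i k).add_left (hc j k)
    rw [(hc i j).add_sq, h1, h1, zero_add, add_zero, mul_assoc] at h2
    have h3 : (2 : 𝕜) • (f i * f j) = 0 := by
      rw [two_smul, ← two_mul]
      exact h2
    exact (smul_eq_zero.1 h3).resolve_left two_ne_zero

variable (𝕜) in
-- Below dimension four there is no restriction on the index type. This matters because passing to
-- an invariant summand lowers the dimension but keeps the number of operators.
theorem diagLimitDim_of_le_three (d : ℕ) (hd : d ≤ 3) : DiagLimitDim 𝕜 d := by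
  induction d using Nat.strong_induction_on with
  | _ d ih =>
    intro V _ _ _ hV ι f hc hs
    have hlt : ∀ k < finrank 𝕜 V, DiagLimitDim 𝕜 k := fun k hk => ih k (by omega) (by omega)
    exact isDiagLimit_of_isNilpotent_case hlt hc hs fun g hg hn =>
      isDiagLimit_of_isNilpotent hlt (by omega) (by omega) hg hn

theorem mem_closure_diagonalizableFamilies {n : ℕ} (hn : n ≤ 4) {f : Fin (n - 1) → Matrix (Fin n) (Fin n) 𝕜}
    (hc : ∀ i j, Commute (f i) (f j))
    (hs : ∀ i, ∃ p : 𝕜[X], p ≠ 0 ∧ p.Splits ∧ aeval (f i) p = 0) :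
    f ∈ closure (diagonalizableFamilies 𝕜 (Fin (n - 1)) (Fin n)) := by
  have hfin : finrank 𝕜 (Fin n → 𝕜) = n := by simp
  let Φ := Matrix.toLinAlgEquiv' (R := 𝕜) (n := Fin n)
  have hlt : ∀ k < finrank 𝕜 (Fin n → 𝕜), DiagLimitDim 𝕜 k := fun k hk =>
    diagLimitDim_of_le_three 𝕜 k (by omega)
  have h1 : IsDiagLimit fun i => Φ (f i) := by
    refine isDiagLimit_of_isNilpotent_case hlt (fun i j => (hc i j).map Φ) (fun i => ?_)
      fun g hg hn => isDiagLimit_of_isNilpotent hlt (by omega)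
        (fun h => ⟨inferInstance, by simp; omega⟩) hg hn
    obtain ⟨p, hp, hps, hfp⟩ := hs i
    exact ⟨p, hp, hps, by
      have := aeval_algHom_apply Φ.toAlgHom (f i) p
      rw [hfp, map_zero] at this
      exact this⟩
  rw [isDiagLimit_iff (Pi.basisFun 𝕜 (Fin n))] at h1
  refine (congrArg (· ∈ closure _) (_root_.funext fun i => ?_)).mp h1
  exact LinearMap.toMatrix'_toLin' _

end SquareZero
end ConjLimit

namespace ConjLimit
open Module NormedSpace

/-! ### Conjugates of the diagonal algebra and their limits. -/

section DiagEmbedding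

variable {n : ℕ}

theorem coe_mul_coe_inv (P : SL(n, ℝ)) :
    (P : Matrix (Fin n) (Fin n) ℝ) * ((P⁻¹ : SL(n, ℝ)) : Matrix (Fin n) (Fin n) ℝ) = 1 := by
  rw [← Matrix.SpecialLinearGroup.coe_mul, mul_inv_cancel, Matrix.SpecialLinearGroup.coe_one]

theorem coe_inv_mul_coe (P : SL(n, ℝ)) :
    ((P⁻¹ : SL(n, ℝ)) : Matrix (Fin n) (Fin n) ℝ) * (P : Matrix (Fin n) (Fin n) ℝ) = 1 := by
  rw [← Matrix.SpecialLinearGroup.coe_mul, inv_mul_cancel, Matrix.SpecialLinearGroup.coe_one]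

/-- The embedding `d ↦ P diag(d) P⁻¹` of the diagonal algebra. -/
noncomputable def diagEmb (P : SL(n, ℝ)) : (Fin n → ℝ) →ₐ[ℝ] Matrix (Fin n) (Fin n) ℝ where
  toFun d := (P : Matrix (Fin n) (Fin n) ℝ) * Matrix.diagonalAlgHom ℝ d *
    ((P⁻¹ : SL(n, ℝ)) : Matrix (Fin n) (Fin n) ℝ)
  map_one' := by simp only [map_one, Matrix.mul_one, coe_mul_coe_inv]
  map_mul' d e := by
    simp only [map_mul, Matrix.mul_assoc]
    rw [← Matrix.mul_assoc _ (P : Matrix (Fin n) (Fin n) ℝ), coe_inv_mul_coe, Matrix.one_mul]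
  map_zero' := by simp only [map_zero, Matrix.mul_zero, Matrix.zero_mul]
  map_add' d e := by simp only [map_add, Matrix.mul_add, Matrix.add_mul]
  commutes' r := by
    simp only [Algebra.algebraMap_eq_smul_one, map_smul, map_one, Matrix.mul_smul, Matrix.smul_mul,
      Matrix.mul_one, coe_mul_coe_inv]

theorem diagEmb_apply (P : SL(n, ℝ)) (d : Fin n → ℝ) :
    diagEmb P d = (P : Matrix (Fin n) (Fin n) ℝ) * Matrix.diagonal d *
      ((P⁻¹ : SL(n, ℝ)) : Matrix (Fin n) (Fin n) ℝ) := rfl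

theorem trace_diagEmb (P : SL(n, ℝ)) (d : Fin n → ℝ) : (diagEmb P d).trace = ∑ i, d i := by
  rw [diagEmb_apply, Matrix.trace_mul_cycle, coe_inv_mul_coe, Matrix.one_mul, Matrix.trace_diagonal]

theorem det_diagEmb (P : SL(n, ℝ)) (d : Fin n → ℝ) : (diagEmb P d).det = ∏ i, d i := by
  rw [diagEmb_apply, Matrix.det_mul, Matrix.det_mul, P.det_coe, (P⁻¹).det_coe, one_mul, mul_one,
    Matrix.det_diagonal]

theorem exp_diagEmb (P : SL(n, ℝ)) (d : Fin n → ℝ) :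
    exp (diagEmb P d) = diagEmb P fun i => Real.exp (d i) := by
  have hP : IsUnit (P : Matrix (Fin n) (Fin n) ℝ) :=
    ⟨⟨_, _, coe_mul_coe_inv P, coe_inv_mul_coe P⟩, rfl⟩
  have hinv : ((P⁻¹ : SL(n, ℝ)) : Matrix (Fin n) (Fin n) ℝ) =
      (P : Matrix (Fin n) (Fin n) ℝ)⁻¹ := (Matrix.inv_eq_right_inv (coe_mul_coe_inv P)).symm
  rw [diagEmb_apply, diagEmb_apply, hinv, Matrix.exp_conj _ _ hP, Matrix.exp_diagonal]
  congr 3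
  funext i
  rw [Pi.coe_exp, Real.exp_eq_exp_ℝ]

theorem mem_conj_cartan {P x : SL(n, ℝ)} : x ∈ (conj P (cartan n) : Set SL(n, ℝ)) ↔
    ∃ d : Fin n → ℝ, (∀ i, 0 < d i) ∧ (x : Matrix (Fin n) (Fin n) ℝ) = diagEmb P d := by
  constructor
  · rintro ⟨g, ⟨d, hd, hg⟩, rfl⟩
    exact ⟨d, hd, by rw [diagEmb_apply, ← hg]; rfl⟩
  · rintro ⟨d, hd, hx⟩
    refine ⟨P⁻¹ * x * P, ⟨d, hd, ?_⟩, ?_⟩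
    · rw [Matrix.SpecialLinearGroup.coe_mul, Matrix.SpecialLinearGroup.coe_mul, hx, diagEmb_apply]
      simp only [Matrix.mul_assoc]
      rw [coe_inv_mul_coe, Matrix.mul_one, ← Matrix.mul_assoc, coe_inv_mul_coe, Matrix.one_mul]
    · change P * (P⁻¹ * x * P) * P⁻¹ = x
      group

/-- More than `n` matrices that are limits of families in subspaces of dimension at most `n` are
linearly dependent. -/
theorem not_linearIndependent_of_tendsto_of_finrank_le {𝕜 : Type*} [RCLike 𝕜] {α κ : Type*}
    [Fintype κ] {m : ℕ} (hκ : m < Fintype.card κ) {l : Filter α} [l.NeBot]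
    {A : α → Submodule 𝕜 (Matrix (Fin n) (Fin n) 𝕜)} (hA : ∀ a, finrank 𝕜 (A a) ≤ m)
    {v : α → κ → Matrix (Fin n) (Fin n) 𝕜} {w : κ → Matrix (Fin n) (Fin n) 𝕜}
    (hv : ∀ a j, v a j ∈ A a) (hw : Tendsto v l (𝓝 w)) : ¬ LinearIndependent 𝕜 w := by
  intro hli
  have hopen : ∀ᶠ u in 𝓝 w, LinearIndependent 𝕜 u := by
    -- Reading a matrix as a function on pairs of indices places it in a normed space, where linear
    -- independence is an open condition.
    let e : Matrix (Fin n) (Fin n) 𝕜 ≃ₗ[𝕜] (Fin n × Fin n → 𝕜) :=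
      (Matrix.ofLinearEquiv 𝕜).symm.trans (LinearEquiv.curry 𝕜 𝕜 (Fin n) (Fin n)).symm
    have he : Continuous fun (u : κ → Matrix (Fin n) (Fin n) 𝕜) j => e (u j) :=
      continuous_pi fun j => (e.toLinearMap.continuous_of_finiteDimensional).comp (continuous_apply j)
    have h1 : LinearIndependent 𝕜 fun j => e (w j) := hli.map' e.toLinearMap e.ker
    filter_upwards [(he.tendsto w).eventually h1.eventually] with u hu
    exact LinearIndependent.of_comp e.toLinearMap hu
  obtain ⟨a, ha⟩ := (hw.eventually hopen).exists
  have h1 : LinearIndependent 𝕜 fun j => (⟨v a j, hv a j⟩ : A a) :=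
    LinearIndependent.of_comp (A a).subtype ha
  have h2 := h1.fintype_card_le_finrank
  have h3 := hA a
  omega

/-- More than `n` matrices that are limits of simultaneously diagonalized ones are linearly
dependent. -/
theorem not_linearIndependent_of_tendsto {α κ : Type*} [Fintype κ] (hκ : n < Fintype.card κ)
    {l : Filter α} [l.NeBot] {P : α → SL(n, ℝ)} {v : α → κ → Matrix (Fin n) (Fin n) ℝ}
    {w : κ → Matrix (Fin n) (Fin n) ℝ} (hv : ∀ a j, v a j ∈ (diagEmb (P a)).range)
    (hw : Tendsto v l (𝓝 w)) : ¬ LinearIndependent ℝ w := by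
  refine not_linearIndependent_of_tendsto_of_finrank_le hκ
    (A := fun a => LinearMap.range (diagEmb (P a)).toLinearMap) (fun a => ?_) hv hw
  have := LinearMap.finrank_range_le (diagEmb (P a)).toLinearMap
  rwa [finrank_fin_fun] at this

end DiagEmbedding

section Frames

variable {n : ℕ}

/-- Linearly independent limits of traceless diagonal frames conjugated by `P k`. -/
def IsLimitFrame (P : ℕ → SL(n, ℝ)) (b : Fin (n - 1) → Matrix (Fin n) (Fin n) ℝ) : Prop :=
  LinearIndependent ℝ b ∧ ∃ d : ℕ → Fin (n - 1) → Fin n → ℝ, (∀ k j, ∑ i, d k j i = 0) ∧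
    Tendsto (fun k j => diagEmb (P k) (d k j)) atTop (𝓝 b)

variable {P : ℕ → SL(n, ℝ)} {b : Fin (n - 1) → Matrix (Fin n) (Fin n) ℝ}

theorem IsLimitFrame.trace_eq_zero (h : IsLimitFrame P b) (j : Fin (n - 1)) : (b j).trace = 0 := by
  obtain ⟨-, d, hd, hlim⟩ := h
  have h1 : Tendsto (fun k => (diagEmb (P k) (d k j)).trace) atTop (𝓝 (b j).trace) :=
    ((continuous_id.matrix_trace).tendsto (b j)).comp (tendsto_pi_nhds.1 hlim j)
  simp only [trace_diagEmb, hd] at h1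
  exact (tendsto_nhds_unique h1 tendsto_const_nhds)

theorem linearIndependent_option_one (hn : 1 ≤ n) (hli : LinearIndependent ℝ b)
    (htr : ∀ j, (b j).trace = 0) :
    LinearIndependent ℝ fun o : Option (Fin (n - 1)) => o.elim 1 b := by
  rw [linearIndependent_option]
  refine ⟨hli, fun h1 => ?_⟩
  have h2 : Submodule.span ℝ (Set.range b) ≤ LinearMap.ker (Matrix.traceLinearMap (Fin n) ℝ ℝ) := by
    rw [Submodule.span_le]
    rintro _ ⟨j, rfl⟩
    exact htr j
  have h3 := h2 h1
  simp at h3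
  omega

/-- The span of the identity and a limit frame. -/
def frameSpan (b : Fin (n - 1) → Matrix (Fin n) (Fin n) ℝ) :
    Submodule ℝ (Matrix (Fin n) (Fin n) ℝ) :=
  Submodule.span ℝ (Set.range fun o : Option (Fin (n - 1)) => o.elim 1 b)

theorem one_mem_frameSpan : (1 : Matrix (Fin n) (Fin n) ℝ) ∈ frameSpan b :=
  Submodule.subset_span ⟨none, rfl⟩

theorem mem_frameSpan (j : Fin (n - 1)) : b j ∈ frameSpan b :=
  Submodule.subset_span ⟨some j, rfl⟩

theorem exists_of_mem_frameSpan {x : Matrix (Fin n) (Fin n) ℝ} (hx : x ∈ frameSpan b) :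
    ∃ (a : ℝ) (c : Fin (n - 1) → ℝ), x = a • (1 : Matrix (Fin n) (Fin n) ℝ) + ∑ j, c j • b j := by
  obtain ⟨c, hc⟩ := (Submodule.mem_span_range_iff_exists_fun ℝ).1 hx
  refine ⟨c none, fun j => c (some j), ?_⟩
  rw [← hc, Fintype.sum_option]
  rfl

/-- If `x` were outside the span, then `x`, `1` and the `b j` would be `n + 1` independent limits of
vectors in `n`-dimensional algebras. -/
theorem IsLimitFrame.mem_frameSpan_of_tendsto (hn : 1 ≤ n) (h : IsLimitFrame P b)
    {α : Type*} {l : Filter α} [l.NeBot] {k : α → ℕ} (hk : Tendsto k l atTop)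
    {v : α → Matrix (Fin n) (Fin n) ℝ} {x : Matrix (Fin n) (Fin n) ℝ}
    (hv : ∀ a, v a ∈ (diagEmb (P (k a))).range) (hx : Tendsto v l (𝓝 x)) : x ∈ frameSpan b := by
  have htr := h.trace_eq_zero
  obtain ⟨hli, d, hd, hlim⟩ := h
  have h1 : ¬ LinearIndependent ℝ fun o : Option (Option (Fin (n - 1))) =>
      o.elim x fun o => o.elim 1 b := by
    refine not_linearIndependent_of_tendsto (l := l) (P := fun a => P (k a))
      (v := fun a o => o.elim (v a) fun o => o.elim 1 fun j => diagEmb (P (k a)) (d (k a) j))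
      (by simp; omega) ?_ ?_
    · rintro a (_ | _ | j)
      exacts [hv a, Subalgebra.one_mem _, ⟨_, rfl⟩]
    · refine tendsto_pi_nhds.2 ?_
      rintro (_ | _ | j)
      exacts [hx, tendsto_const_nhds, (tendsto_pi_nhds.1 hlim j).comp hk]
  rw [linearIndependent_option] at h1
  by_contra h2
  exact h1 ⟨linearIndependent_option_one hn hli htr, h2⟩

/-- Both factors are limits of elements of the commutative algebras `P k D (P k)⁻¹`; their products
stay there, so the limit inherits closure under products and commutativity. -/
theorem IsLimitFrame.mul_mem (hn : 1 ≤ n) (h : IsLimitFrame P b) {x y : Matrix (Fin n) (Fin n) ℝ}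
    (hx : x ∈ frameSpan b) (hy : y ∈ frameSpan b) : x * y ∈ frameSpan b ∧ x * y = y * x := by
  have h' := h
  obtain ⟨hli, d, hd, hlim⟩ := h'
  have key : ∀ z ∈ frameSpan b, ∃ e : ℕ → Fin n → ℝ,
      Tendsto (fun k => diagEmb (P k) (e k)) atTop (𝓝 z) := by
    intro z hz
    obtain ⟨a, c, rfl⟩ := exists_of_mem_frameSpan hz
    refine ⟨fun k => a • 1 + ∑ j, c j • d k j, ?_⟩
    simp only [map_add, map_smul, map_one, map_sum]
    exact tendsto_const_nhds.add
      (tendsto_finsetSum _ fun j _ => (tendsto_pi_nhds.1 hlim j).const_smul _)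
  obtain ⟨e, he⟩ := key x hx
  obtain ⟨e', he'⟩ := key y hy
  refine ⟨h.mem_frameSpan_of_tendsto hn (l := atTop) tendsto_id
    (fun k => Subalgebra.mul_mem _ ⟨e k, rfl⟩ ⟨e' k, rfl⟩) (he.mul he'), ?_⟩
  refine tendsto_nhds_unique (he.mul he') ?_
  have : (fun k => diagEmb (P k) (e k) * diagEmb (P k) (e' k)) =
      fun k => diagEmb (P k) (e' k) * diagEmb (P k) (e k) := by
    funext k
    rw [← map_mul, mul_comm, map_mul]
  rw [this]
  exact he'.mul he

/-- The algebra spanned by the identity and a limit frame. -/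
def IsLimitFrame.subalgebra (hn : 1 ≤ n) (h : IsLimitFrame P b) :
    Subalgebra ℝ (Matrix (Fin n) (Fin n) ℝ) :=
  (frameSpan b).toSubalgebra one_mem_frameSpan fun _ _ hx hy => (h.mul_mem hn hx hy).1

/-- Each eigenvalue along the segment is at least `1 - t`. The bound does not depend on `P` or `d`,
so it survives limits. -/
theorem det_segment_diagEmb {P : SL(n, ℝ)} {d : Fin n → ℝ} (hd : ∀ i, 0 < d i) {t : ℝ}
    (ht : t ∈ Set.Icc (0 : ℝ) 1) : (1 - t) ^ n ≤ ((1 - t) • (1 : Matrix (Fin n) (Fin n) ℝ) +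
      t • diagEmb P d).det := by
  rw [← map_one (diagEmb P), ← map_smul, ← map_smul, ← map_add, det_diagEmb]
  have : (1 - t) ^ n = ∏ _i : Fin n, (1 - t) := by simp
  rw [this]
  refine Finset.prod_le_prod (fun i _ => by linarith [ht.2]) fun i _ => ?_
  simp only [Pi.add_apply, Pi.smul_apply, Pi.one_apply, smul_eq_mul, mul_one]
  nlinarith [hd i, ht.1]

/-- The limit `x` lies in the limit algebra. The uniform bound makes the segment from `1` to `x`
consist of units (at `t = 1`, `det x = 1`), so `x` is the exponential of an element of that algebra;
`det x = 1` removes its component along the identity. -/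
theorem IsLimitFrame.exists_exp_eq (hn : 1 ≤ n) (h : IsLimitFrame P b) {α : Type*} {l : Filter α}
    [l.NeBot] {k : α → ℕ} (hk : Tendsto k l atTop) {v : α → SL(n, ℝ)} {x : SL(n, ℝ)}
    (hv : ∀ a, v a ∈ (conj (P (k a)) (cartan n) : Set SL(n, ℝ))) (hx : Tendsto v l (𝓝 x)) :
    ∃ c : Fin (n - 1) → ℝ, exp (∑ j, c j • b j) = (x : Matrix (Fin n) (Fin n) ℝ) := by
  simp only [mem_conj_cartan] at hv
  choose d hd hvd using hv
  have hval : Continuous fun g : SL(n, ℝ) => (g : Matrix (Fin n) (Fin n) ℝ) :=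
    continuous_subtype_val
  have hx' : Tendsto (fun a => (v a : Matrix (Fin n) (Fin n) ℝ)) l
    (𝓝 (x : Matrix (Fin n) (Fin n) ℝ)) := (hval.tendsto x).comp hx
  have hmem : (x : Matrix (Fin n) (Fin n) ℝ) ∈ frameSpan b :=
    h.mem_frameSpan_of_tendsto hn hk (fun a => ⟨d a, (hvd a).symm⟩) hx'
  obtain ⟨y, hy, hyx⟩ := exists_exp_eq_of_segment_matrix (h.subalgebra hn)
    (fun x hx y hy => (h.mul_mem hn hx hy).2) (x : Matrix (Fin n) (Fin n) ℝ) hmem (fun t ht => by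
      rw [Matrix.isUnit_iff_isUnit_det, isUnit_iff_ne_zero]
      rcases eq_or_lt_of_le ht.2 with rfl | ht1
      · simp
      · refine (lt_of_lt_of_le (pow_pos (sub_pos.2 ht1) n) ?_).ne'
        have hc : Continuous fun M : Matrix (Fin n) (Fin n) ℝ =>
          ((1 - t) • (1 : Matrix (Fin n) (Fin n) ℝ) + t • M).det := by fun_prop
        refine ge_of_tendsto ((hc.tendsto _).comp hx') (Eventually.of_forall fun a => ?_)
        simp only [Function.comp, hvd]
        exact det_segment_diagEmb (hd a) ht)
  obtain ⟨a, c, rfl⟩ := exists_of_mem_frameSpan (b := b) hy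
  refine ⟨c, ?_⟩
  have h1 := congrArg Matrix.det hyx
  rw [det_exp_eq, x.det_coe, Real.exp_eq_one_iff, Matrix.trace_add, Matrix.trace_sum] at h1
  simp only [Matrix.trace_smul, h.trace_eq_zero, smul_eq_mul, mul_zero, Finset.sum_const_zero,
    add_zero, Matrix.trace_one, Fintype.card_fin, mul_eq_zero, Nat.cast_eq_zero] at h1
  have ha : a = 0 := h1.resolve_right (by omega)
  rw [← hyx, ha, zero_smul, zero_add]

theorem IsLimitFrame.exists_tendsto_exp (h : IsLimitFrame P b) (c : Fin (n - 1) → ℝ) :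
    ∃ (x : SL(n, ℝ)) (v : ℕ → SL(n, ℝ)),
      (x : Matrix (Fin n) (Fin n) ℝ) = exp (∑ j, c j • b j) ∧
      (∀ k, v k ∈ (conj (P k) (cartan n) : Set SL(n, ℝ))) ∧ Tendsto v atTop (𝓝 x) := by
  have htr := h.trace_eq_zero
  obtain ⟨-, d, hd, hlim⟩ := h
  have hdet : ∀ k, (exp (∑ j, c j • diagEmb (P k) (d k j))).det = 1 := by
    intro k
    rw [det_exp_eq, Matrix.trace_sum]
    simp [Matrix.trace_smul, trace_diagEmb, hd]
  let v : ℕ → SL(n, ℝ) := fun k => ⟨exp (∑ j, c j • diagEmb (P k) (d k j)), hdet k⟩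
  refine ⟨⟨exp (∑ j, c j • b j), ?_⟩, v, rfl, fun k => ?_, ?_⟩
  · rw [det_exp_eq, Matrix.trace_sum]
    simp [Matrix.trace_smul, htr]
  · rw [mem_conj_cartan]
    refine ⟨fun i => Real.exp ((∑ j, c j • d k j) i), fun i => Real.exp_pos _, ?_⟩
    rw [← exp_diagEmb, map_sum]
    simp only [map_smul]
    rfl
  · refine tendsto_subtype_rng.2 ?_
    exact (continuous_matrix_exp.tendsto _).comp
      (tendsto_finsetSum _ fun j _ => (tendsto_pi_nhds.1 hlim j).const_smul _)

end Frames
end ConjLimit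

namespace ConjLimit
open Module NormedSpace

/-! ### Chabauty convergence through limit points. -/

section Chabauty

variable {G : Type*} [Group G] [TopologicalSpace G] {H : ℕ → ClosedSubgroup G}
  {L : ClosedSubgroup G}

/-- Every neighbourhood of `x` meets `H k` for all large `k`. Recording this as a nontrivial filter
on pairs expresses that `x` is a limit of points of the `H k` without choosing a sequence. -/
theorem neBot_comap_of_tendsto (h : Tendsto H atTop (𝓝 L)) {x : G} (hx : x ∈ (L : Set G)) :
    (comap (Subtype.val : {p : ℕ × G // p.2 ∈ (H p.1 : Set G)} → ℕ × G)
      (atTop ×ˢ 𝓝 x)).NeBot := by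
  rw [comap_neBot_iff]
  intro t ht
  obtain ⟨s, hs, u, hu, hsu⟩ := mem_prod_iff.1 ht
  obtain ⟨U, hUu, hU, hxU⟩ := mem_nhds_iff.1 hu
  have hopen : IsOpen {M : ClosedSubgroup G | ((M : Set G) ∩ U).Nonempty} :=
    TopologicalSpace.isOpen_generateFrom_of_mem (Or.inr ⟨U, hU, rfl⟩)
  obtain ⟨k, ⟨y, hy, hyU⟩, hks⟩ :=
    ((h.eventually (hopen.mem_nhds ⟨x, hx, hxU⟩)).and hs).exists
  exact ⟨⟨(k, y), hy⟩, hsu ⟨hks, hUu hyU⟩⟩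

theorem mem_of_tendsto_of_mem [LocallyCompactSpace G] (h : Tendsto H atTop (𝓝 L)) {α : Type*}
    {l : Filter α} [l.NeBot] {k : α → ℕ} (hk : Tendsto k l atTop) {v : α → G}
    (hv : ∀ a, v a ∈ (H (k a) : Set G)) {x : G} (hx : Tendsto v l (𝓝 x)) : x ∈ (L : Set G) := by
  by_contra hxL
  obtain ⟨K, hK, hxK, hKL⟩ := exists_compact_subset L.isClosed'.isOpen_compl hxL
  have hopen : IsOpen {M : ClosedSubgroup G | (M : Set G) ∩ K = ∅} :=
    TopologicalSpace.isOpen_generateFrom_of_mem (Or.inl ⟨K, hK, rfl⟩)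
  have hLK : (L : Set G) ∩ K = ∅ :=
    Set.disjoint_iff_inter_eq_empty.1 (Set.disjoint_left.2 fun y hy hyK => hKL hyK hy)
  obtain ⟨a, ha, haK⟩ := ((hk.eventually (h.eventually (hopen.mem_nhds hLK))).and
    (hx.eventually (isOpen_interior.mem_nhds hxK))).exists
  exact Set.eq_empty_iff_forall_notMem.1 ha (v a) ⟨hv a, interior_subset haK⟩

/-- The first hypothesis handles the sets meeting an open set. For a compact set missed by `L`, if
infinitely many `H k` met it, a convergent subsequence of points would violate the second
hypothesis. -/
theorem tendsto_of_limits [FirstCountableTopology G]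
    (h1 : ∀ x ∈ (L : Set G), ∃ v : ℕ → G, (∀ k, v k ∈ (H k : Set G)) ∧ Tendsto v atTop (𝓝 x))
    (h2 : ∀ (x : G) (k : ℕ → ℕ) (v : ℕ → G), StrictMono k → (∀ i, v i ∈ (H (k i) : Set G)) →
      Tendsto v atTop (𝓝 x) → x ∈ (L : Set G)) : Tendsto H atTop (𝓝 L) := by
  refine TopologicalSpace.tendsto_nhds_generateFrom_iff.2 ?_
  rintro _ (⟨K, hK, rfl⟩ | ⟨U, hU, rfl⟩) hL
  · by_contra hne
    obtain ⟨φ, hφ, hφK⟩ := extraction_of_frequently_atTop (not_eventually.1 hne)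
    have hex : ∀ i, ((H (φ i) : Set G) ∩ K).Nonempty := fun i =>
      Set.nonempty_iff_ne_empty.2 (hφK i)
    choose v hv hvK using hex
    obtain ⟨x, hxK, ψ, hψ, hx⟩ := hK.tendsto_subseq hvK
    exact Set.eq_empty_iff_forall_notMem.1 hL x
      ⟨h2 x (φ ∘ ψ) (v ∘ ψ) (hφ.comp hψ) (fun i => hv (ψ i)) hx, hxK⟩
  · obtain ⟨x, hxL, hxU⟩ := hL
    obtain ⟨v, hv, hvx⟩ := h1 x hxL
    filter_upwards [hvx.eventually (hU.mem_nhds hxU)] with k hk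
    exact ⟨v k, hv k, hk⟩

end Chabauty

section SpecialLinear

variable {n : ℕ}

instance : LocallyCompactSpace SL(n, ℝ) :=
  haveI : LocallyCompactSpace (Matrix (Fin n) (Fin n) ℝ) :=
    inferInstanceAs (LocallyCompactSpace (Fin n → Fin n → ℝ))
  Matrix.SpecialLinearGroup.isClosedEmbedding_val.locallyCompactSpace

instance : FirstCountableTopology SL(n, ℝ) :=
  haveI : FirstCountableTopology (Matrix (Fin n) (Fin n) ℝ) :=
    inferInstanceAs (FirstCountableTopology (Fin n → Fin n → ℝ))
  Matrix.SpecialLinearGroup.isClosedEmbedding_val.isInducing.firstCountableTopology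

/-- The inverse is continuous by the open mapping theorem for a σ-compact source group and a locally
compact target. -/
theorem mem_AbHat_of_bijective {L : ClosedSubgroup SL(n, ℝ)}
    (ψ : Multiplicative (Fin (n - 1) → ℝ) →* L.toSubgroup) (hc : Continuous ψ)
    (hb : Function.Bijective ψ) : L ∈ AbHat n := by
  have hcl : IsClosed ((L.toSubgroup : Subgroup SL(n, ℝ)) : Set SL(n, ℝ)) := L.isClosed'
  have : LocallyCompactSpace L.toSubgroup := hcl.isClosedEmbedding_subtypeVal.locallyCompactSpace
  have ho := ψ.isOpenMap_of_sigmaCompact hb.2 hc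
  let e : Multiplicative (Fin (n - 1) → ℝ) ≃* L.toSubgroup := MulEquiv.ofBijective ψ hb
  have he : Continuous e.symm :=
    ((Equiv.ofBijective ψ hb).toHomeomorphOfContinuousOpen hc ho).symm.continuous
  exact ⟨ContinuousMulEquiv.symm ⟨e, hc, he⟩⟩

theorem mem_AbHat_of_exp {L : ClosedSubgroup SL(n, ℝ)} {b : Fin (n - 1) → Matrix (Fin n) (Fin n) ℝ}
    (hcomm : ∀ i j, Commute (b i) (b j))
    (hmem : ∀ c : Fin (n - 1) → ℝ, ∃ x ∈ (L : Set SL(n, ℝ)),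
      (x : Matrix (Fin n) (Fin n) ℝ) = exp (∑ j, c j • b j))
    (hsurj : ∀ x ∈ (L : Set SL(n, ℝ)), ∃ c : Fin (n - 1) → ℝ,
      exp (∑ j, c j • b j) = (x : Matrix (Fin n) (Fin n) ℝ))
    (hinj : ∀ c : Fin (n - 1) → ℝ, exp (∑ j, c j • b j) = 1 → c = 0) : L ∈ AbHat n := by
  choose x hxL hx using hmem
  have hadd : ∀ c d, x (c + d) = x c * x d := by
    intro c d
    apply Subtype.ext
    rw [Matrix.SpecialLinearGroup.coe_mul]
    rw [hx, hx, hx, ← Matrix.exp_add_of_commute]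
    · simp only [Pi.add_apply, add_smul, Finset.sum_add_distrib]
    · exact Commute.sum_left _ _ _ fun i _ => Commute.sum_right _ _ _ fun j _ =>
        ((hcomm i j).smul_left _).smul_right _
  have hzero : x 0 = 1 := by
    have := hadd 0 0
    rw [add_zero] at this
    exact (mul_eq_left.1 this.symm)
  let ψ : Multiplicative (Fin (n - 1) → ℝ) →* L.toSubgroup :=
    { toFun := fun c => ⟨x c.toAdd, hxL _⟩
      map_one' := Subtype.ext hzero
      map_mul' := fun c d => Subtype.ext (hadd _ _) }
  refine mem_AbHat_of_bijective ψ ?_ ⟨?_, ?_⟩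
  · refine Continuous.subtype_mk (Continuous.subtype_mk ?_ fun c => (x c.toAdd).2) _
    have : (fun c : Multiplicative (Fin (n - 1) → ℝ) => (x c.toAdd : Matrix (Fin n) (Fin n) ℝ)) =
        fun c => exp (∑ j, c.toAdd j • b j) := by
      funext c
      exact hx _
    change Continuous fun c : Multiplicative (Fin (n - 1) → ℝ) =>
      (x c.toAdd : Matrix (Fin n) (Fin n) ℝ)
    rw [this]
    exact continuous_matrix_exp.comp (continuous_finsetSum _ fun j _ =>
      ((continuous_apply j).comp continuous_toAdd).smul continuous_const)
  · refine (injective_iff_map_eq_one ψ).2 fun c hcx => ?_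
    have h1 : x c.toAdd = 1 := congrArg Subtype.val hcx
    have h2 := hx c.toAdd
    rw [h1, Matrix.SpecialLinearGroup.coe_one] at h2
    exact hinj _ h2.symm
  · rintro ⟨y, hy⟩
    obtain ⟨c, hcy⟩ := hsurj y hy
    refine ⟨Multiplicative.ofAdd c, Subtype.ext (Subtype.ext ?_)⟩
    change (x c : Matrix (Fin n) (Fin n) ℝ) = _
    rw [hx, hcy]

end SpecialLinear

/-! ### Compactness of frames. -/

section Compactness

/-- A sequence of `m`-dimensional subspaces has frames that converge, along a subsequence, to a
linearly independent family. -/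
theorem exists_subseq_tendsto_linearIndependent {E : Type*} [NormedAddCommGroup E]
    [InnerProductSpace ℝ E] [FiniteDimensional ℝ E] {m : ℕ} (W : ℕ → Submodule ℝ E)
    (hW : ∀ k, finrank ℝ (W k) = m) :
    ∃ (u : ℕ → Fin m → E) (φ : ℕ → ℕ) (b : Fin m → E), (∀ k j, u k j ∈ W k) ∧ StrictMono φ ∧
      LinearIndependent ℝ b ∧ Tendsto (u ∘ φ) atTop (𝓝 b) := by
  let B : ∀ k, OrthonormalBasis (Fin m) ℝ (W k) := fun k =>
    (stdOrthonormalBasis ℝ (W k)).reindex (finCongr (hW k))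
  let u : ℕ → Fin m → E := fun k j => B k j
  have hu : ∀ k i j, inner ℝ (u k i) (u k j) = if i = j then (1 : ℝ) else 0 := fun k =>
    orthonormal_iff_ite.1 (B k).orthonormal
  have hK : IsCompact (Set.univ.pi fun _ : Fin m => Metric.closedBall (0 : E) 1) :=
    isCompact_univ_pi fun _ => ProperSpace.isCompact_closedBall _ _
  obtain ⟨b, -, φ, hφ, hb⟩ := hK.tendsto_subseq (x := u) fun k => by
    intro j _
    rw [mem_closedBall_zero_iff]
    exact ((B k).orthonormal.1 j).le
  refine ⟨u, φ, b, fun k j => (B k j).2, hφ, ?_, hb⟩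
  -- Orthonormal frames are used because their Gram matrix is constant and passes to the limit,
  -- which keeps the limit independent.
  have hort : Orthonormal ℝ b := by
    refine orthonormal_iff_ite.2 fun i j => ?_
    have h1 := ((tendsto_pi_nhds.1 hb i).inner (tendsto_pi_nhds.1 hb j) :
      Tendsto _ _ (𝓝 (inner ℝ (b i) (b j))))
    simp only [Function.comp, hu] at h1
    exact tendsto_nhds_unique h1 tendsto_const_nhds
  exact hort.linearIndependent

theorem exists_subseq_isLimitFrame {n : ℕ} (hn : 1 ≤ n) (P : ℕ → SL(n, ℝ)) :
    ∃ (φ : ℕ → ℕ) (b : Fin (n - 1) → Matrix (Fin n) (Fin n) ℝ), StrictMono φ ∧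
      IsLimitFrame (P ∘ φ) b := by
  let s : (Fin n → ℝ) →ₗ[ℝ] ℝ := ∑ i, LinearMap.proj i
  have hs : ∀ d, s d = ∑ i, d i := fun d => by simp [s]
  have hker : finrank ℝ (LinearMap.ker s) = n - 1 := by
    have h1 := LinearMap.finrank_range_add_finrank_ker s
    have h2 : LinearMap.range s = ⊤ := by
      refine LinearMap.range_eq_top.2 fun r => ⟨Pi.single ⟨0, hn⟩ r, ?_⟩
      rw [hs, Finset.sum_pi_single']
      simp
    rw [h2, finrank_top, finrank_self, finrank_fin_fun] at h1
    omega
  let e : Matrix (Fin n) (Fin n) ℝ ≃ₗ[ℝ] EuclideanSpace ℝ (Fin n × Fin n) :=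
    ((Matrix.ofLinearEquiv ℝ).symm.trans (LinearEquiv.curry ℝ ℝ (Fin n) (Fin n)).symm).trans
      (WithLp.linearEquiv 2 ℝ (Fin n × Fin n → ℝ)).symm
  have hinj : ∀ Q : SL(n, ℝ), Function.Injective (diagEmb Q) := by
    intro Q d d' h
    have h1 : ∀ f : Fin n → ℝ, Matrix.diagonal f = ((Q⁻¹ : SL(n, ℝ)) : Matrix (Fin n) (Fin n) ℝ) *
        diagEmb Q f * Q := by
      intro f
      rw [diagEmb_apply]
      simp only [Matrix.mul_assoc]
      rw [coe_inv_mul_coe, Matrix.mul_one, ← Matrix.mul_assoc, coe_inv_mul_coe, Matrix.one_mul]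
    exact Matrix.diagonal_injective (by rw [h1, h1 d', h])
  let g : ℕ → (Fin n → ℝ) →ₗ[ℝ] EuclideanSpace ℝ (Fin n × Fin n) := fun k =>
    e.toLinearMap ∘ₗ (diagEmb (P k)).toLinearMap
  have hg : ∀ k, Function.Injective (g k) := fun k => e.injective.comp (hinj (P k))
  obtain ⟨u, φ, b, hu, hφ, hb, hlim⟩ := exists_subseq_tendsto_linearIndependent (m := n - 1)
    (fun k => (LinearMap.ker s).map (g k)) fun k => by
      rw [← hker]
      exact (Submodule.equivMapOfInjective (g k) (hg k) _).finrank_eq.symm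
  choose d hd hdu using hu
  refine ⟨φ, fun j => e.symm (b j), hφ, hb.map' e.symm.toLinearMap e.symm.ker,
    fun k j => d (φ k) j, fun k j => ?_, ?_⟩
  · rw [← hs]
    exact hd _ _
  · have he : Continuous e.symm := e.symm.toLinearMap.continuous_of_finiteDimensional
    refine tendsto_pi_nhds.2 fun j => ?_
    refine ((he.tendsto _).comp (tendsto_pi_nhds.1 hlim j)).congr fun k => ?_
    simp only [Function.comp, ← hdu]
    exact e.symm_apply_apply _

end Compactness

/-! ### Every conjugacy limit is isomorphic to `ℝⁿ⁻¹`. -/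

section Reducible

variable {n : ℕ}

/-- The midpoint of `1` and an element of a conjugate of `C` has determinant at least `2⁻ⁿ`, so in
the limit the midpoint of `1` and `x` is invertible; but its product with `x - 1` vanishes. -/
theorem eq_one_of_mul_self_eq_one {L : ClosedSubgroup SL(n, ℝ)} {P : ℕ → SL(n, ℝ)}
    (h : Tendsto (fun k => conj (P k) (cartan n)) atTop (𝓝 L)) {x : SL(n, ℝ)}
    (hx : x ∈ (L : Set SL(n, ℝ))) (hxx : x * x = 1) : x = 1 := by
  have hNe := neBot_comap_of_tendsto h hx
  have hlim : Tendsto (fun a : {p : ℕ × SL(n, ℝ) // p.2 ∈ (conj (P p.1) (cartan n) : Set _)} =>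
      (a.1.2 : Matrix (Fin n) (Fin n) ℝ)) (comap Subtype.val (atTop ×ˢ 𝓝 x))
      (𝓝 (x : Matrix (Fin n) (Fin n) ℝ)) :=
    (continuous_subtype_val.tendsto x).comp (tendsto_snd.comp tendsto_comap)
  obtain ⟨M, hM⟩ : ∃ M : Matrix (Fin n) (Fin n) ℝ, (x : Matrix (Fin n) (Fin n) ℝ) = M := ⟨_, rfl⟩
  rw [hM] at hlim
  let f : Matrix (Fin n) (Fin n) ℝ → ℝ := fun N =>
    ((1 - (1 / 2 : ℝ)) • (1 : Matrix (Fin n) (Fin n) ℝ) + (1 / 2 : ℝ) • N).det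
  have hf : Continuous f := by
    change Continuous fun N : Matrix (Fin n) (Fin n) ℝ =>
      ((1 - (1 / 2 : ℝ)) • (1 : Matrix (Fin n) (Fin n) ℝ) + (1 / 2 : ℝ) • N).det
    fun_prop
  have h1 : (1 - (1 / 2 : ℝ)) ^ n ≤ f M := by
    refine ge_of_tendsto ((hf.tendsto M).comp hlim) (Eventually.of_forall fun a => ?_)
    obtain ⟨d, hd, ha⟩ := mem_conj_cartan.1 a.2
    simp only [Function.comp, ha, f]
    exact det_segment_diagEmb hd ⟨by norm_num, by norm_num⟩
  have h2 : IsUnit ((1 - (1 / 2 : ℝ)) • (1 : Matrix (Fin n) (Fin n) ℝ) + (1 / 2 : ℝ) • M) := by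
    rw [Matrix.isUnit_iff_isUnit_det, isUnit_iff_ne_zero]
    exact (lt_of_lt_of_le (by positivity) h1).ne'
  have hMM : M * M = 1 := by
    rw [← hM, ← Matrix.SpecialLinearGroup.coe_mul, hxx, Matrix.SpecialLinearGroup.coe_one]
  have h3 : ((1 - (1 / 2 : ℝ)) • (1 : Matrix (Fin n) (Fin n) ℝ) + (1 / 2 : ℝ) • M) * (M - 1) = 0 := by
    simp only [Matrix.add_mul, Matrix.smul_mul, Matrix.mul_sub, hMM, Matrix.one_mul, Matrix.mul_one]
    module
  have h4 : M - 1 = 0 := (h2.mul_right_eq_zero).1 h3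
  exact Subtype.ext (hM.trans (sub_eq_zero.1 h4))

theorem mem_AbHat_of_isConjLimit (hn : 1 ≤ n) {L : ClosedSubgroup SL(n, ℝ)}
    (h : IsConjLimit n L) : L ∈ AbHat n := by
  obtain ⟨P, hP⟩ := h
  obtain ⟨φ, b, hφ, hb⟩ := exists_subseq_isLimitFrame hn P
  have hP' : Tendsto (fun k => conj ((P ∘ φ) k) (cartan n)) atTop (𝓝 L) :=
    hP.comp hφ.tendsto_atTop
  have hmem : ∀ c : Fin (n - 1) → ℝ, ∃ x ∈ (L : Set SL(n, ℝ)),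
      (x : Matrix (Fin n) (Fin n) ℝ) = exp (∑ j, c j • b j) := by
    intro c
    obtain ⟨x, v, hx, hv, hlim⟩ := hb.exists_tendsto_exp c
    exact ⟨x, mem_of_tendsto_of_mem hP' tendsto_id hv hlim, hx⟩
  refine mem_AbHat_of_exp (fun i j => (hb.mul_mem hn (mem_frameSpan i) (mem_frameSpan j)).2) hmem
    (fun x hx => ?_) fun c hc => ?_
  · have hNe := neBot_comap_of_tendsto hP' hx
    exact hb.exists_exp_eq hn (l := comap Subtype.val (atTop ×ˢ 𝓝 x)) (k := fun a :
      {p : ℕ × SL(n, ℝ) // p.2 ∈ (conj ((P ∘ φ) p.1) (cartan n) : Set _)} => a.1.1)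
      (tendsto_fst.comp tendsto_comap) (v := fun a => a.1.2) (fun a => a.2)
      (tendsto_snd.comp tendsto_comap)
  -- If `exp` of a vector is `1`, then `exp` of its half is an involution in `L`, hence `1`.
  -- Repeated halving reaches the neighbourhood of `0` on which `exp` takes the value `1` only at
  -- `0`.
  · have half : ∀ c : Fin (n - 1) → ℝ, exp (∑ j, c j • b j) = 1 →
        exp (∑ j, ((1 / 2 : ℝ) • c) j • b j) = 1 := by
      intro c hc
      obtain ⟨x, hxL, hx⟩ := hmem ((1 / 2 : ℝ) • c)
      have hxx : x * x = 1 := by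
        apply Subtype.ext
        rw [Matrix.SpecialLinearGroup.coe_mul, Matrix.SpecialLinearGroup.coe_one]
        rw [hx, ← Matrix.exp_add_of_commute _ _ (Commute.refl _), ← hc, ← Finset.sum_add_distrib]
        congr 1
        refine Finset.sum_congr rfl fun j _ => ?_
        rw [← add_smul, Pi.smul_apply, smul_eq_mul]
        congr 1
        ring
      rw [← hx, eq_one_of_mul_self_eq_one hP' hxL hxx, Matrix.SpecialLinearGroup.coe_one]
    have hiter : ∀ k : ℕ, exp (∑ j, ((1 / 2 : ℝ) ^ k • c) j • b j) = 1 := by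
      intro k
      induction k with
      | zero => simpa using hc
      | succ k ih => rw [pow_succ', mul_smul]; exact half _ ih
    have hsum : ∀ k : ℕ, ∑ j, ((1 / 2 : ℝ) ^ k • c) j • b j =
        (1 / 2 : ℝ) ^ k • ∑ j, c j • b j := by
      intro k
      rw [Finset.smul_sum]
      exact Finset.sum_congr rfl fun j _ => by rw [Pi.smul_apply, smul_eq_mul, mul_smul]
    have hlim : Tendsto (fun k : ℕ => (1 / 2 : ℝ) ^ k • ∑ j, c j • b j) atTop (𝓝 0) := by
      have := (tendsto_pow_atTop_nhds_zero_of_lt_one (r := (1 / 2 : ℝ)) (by norm_num)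
        (by norm_num)).smul_const (∑ j, c j • b j)
      rwa [zero_smul] at this
    obtain ⟨k, hk⟩ := (hlim.eventually eventually_eq_zero_of_exp_eq_one).exists
    have h0 : ∑ j, c j • b j = 0 :=
      (smul_eq_zero.1 (hk (by rw [← hsum]; exact hiter k))).resolve_left (by positivity)
    exact _root_.funext (Fintype.linearIndependent_iff.1 hb.1 c h0)

end Reducible
end ConjLimit

namespace ConjLimit
open Module NormedSpace

/-! ### Closed subgroups isomorphic to `ℝⁿ⁻¹` as exponentials of commuting frames. -/

section Parametrization

variable {n : ℕ}

/-- A closed subgroup isomorphic to `ℝⁿ⁻¹` is the image of a commuting frame under `exp`. -/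
theorem exists_exp_frame_of_mem_AbHat {G : ClosedSubgroup SL(n, ℝ)} (hG : G ∈ AbHat n) :
    ∃ a : Fin (n - 1) → Matrix (Fin n) (Fin n) ℝ, (∀ i j, Commute (a i) (a j)) ∧
      (∀ c : Fin (n - 1) → ℝ, ∃ x ∈ (G : Set SL(n, ℝ)),
        (x : Matrix (Fin n) (Fin n) ℝ) = exp (∑ j, c j • a j)) ∧
      (∀ x ∈ (G : Set SL(n, ℝ)), ∃ c : Fin (n - 1) → ℝ,
        exp (∑ j, c j • a j) = (x : Matrix (Fin n) (Fin n) ℝ)) ∧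
      ∀ c : Fin (n - 1) → ℝ, exp (∑ j, c j • a j) = 1 → c = 0 := by
  obtain ⟨e⟩ := hG
  let φ : (Fin (n - 1) → ℝ) → SL(n, ℝ) := fun c => (e.symm (Multiplicative.ofAdd c) : G.toSubgroup)
  have hφc : Continuous fun c => (φ c : Matrix (Fin n) (Fin n) ℝ) :=
    (e.symm.continuous.comp continuous_ofAdd).subtype_val.subtype_val
  have hφadd : ∀ c d, (φ (c + d) : Matrix (Fin n) (Fin n) ℝ) = φ c * φ d := by
    intro c d
    rw [← Matrix.SpecialLinearGroup.coe_mul]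
    congr 1
    change ((e.symm (Multiplicative.ofAdd c * Multiplicative.ofAdd d) : G.toSubgroup) :
      SL(n, ℝ)) = _
    rw [map_mul]
    rfl
  have hφ0 : (φ 0 : Matrix (Fin n) (Fin n) ℝ) = 1 := by
    change ((e.symm 1 : G.toSubgroup) : Matrix (Fin n) (Fin n) ℝ) = 1
    rw [map_one]
    rfl
  have hone : ∀ c : Fin (n - 1) → ℝ, ∃ A : Matrix (Fin n) (Fin n) ℝ, ∀ t : ℝ,
      (φ (t • c) : Matrix (Fin n) (Fin n) ℝ) = exp (t • A) := fun c =>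
    exists_eq_exp_smul_matrix (fun t => (φ (t • c) : Matrix (Fin n) (Fin n) ℝ))
      (hφc.comp (continuous_id.smul continuous_const)) (by simp only [zero_smul, hφ0])
      fun s t => by rw [add_smul, hφadd]
  choose A hA using hone
  let a : Fin (n - 1) → Matrix (Fin n) (Fin n) ℝ := fun i => A (Pi.single i 1)
  have hcomm : ∀ i j, Commute (a i) (a j) := fun i j => by
    refine commute_of_commute_exp_matrix fun s t => ?_
    rw [← hA, ← hA, commute_iff_eq, ← hφadd, add_comm, hφadd]
  have hsum : ∀ (c : Fin (n - 1) → ℝ) (s : Finset (Fin (n - 1))),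
      (φ (∑ i ∈ s, c i • Pi.single i 1) : Matrix (Fin n) (Fin n) ℝ) =
        exp (∑ i ∈ s, c i • a i) := by
    intro c s
    induction s using Finset.induction_on with
    | empty => rw [Finset.sum_empty, Finset.sum_empty, hφ0, exp_zero]
    | insert i s his ih =>
      rw [Finset.sum_insert his, Finset.sum_insert his, hφadd, ih, hA,
        ← Matrix.exp_add_of_commute]
      exact Commute.sum_right _ _ _ fun j _ => ((hcomm i j).smul_left _).smul_right _
  have hφ : ∀ c, (φ c : Matrix (Fin n) (Fin n) ℝ) = exp (∑ i, c i • a i) := by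
    intro c
    rw [← hsum c Finset.univ]
    congr 2
    exact pi_eq_sum_univ' c
  refine ⟨a, hcomm, fun c => ⟨φ c, (e.symm (Multiplicative.ofAdd c)).2, hφ c⟩, fun x hx => ?_,
    fun c hc => ?_⟩
  · refine ⟨(e ⟨x, hx⟩).toAdd, ?_⟩
    rw [← hφ]
    change ((e.symm (e ⟨x, hx⟩) : G.toSubgroup) : Matrix (Fin n) (Fin n) ℝ) = _
    rw [ContinuousMulEquiv.symm_apply_apply]
  · have h1 : e.symm (Multiplicative.ofAdd c) = 1 := Subtype.ext (Subtype.ext ((hφ c).trans hc))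
    have h2 := (map_eq_one_iff e.symm e.symm.injective).1 h1
    exact ofAdd_eq_one.1 h2

variable {a : Fin (n - 1) → Matrix (Fin n) (Fin n) ℝ}

theorem linearIndependent_of_exp_injective
    (hinj : ∀ c : Fin (n - 1) → ℝ, exp (∑ j, c j • a j) = 1 → c = 0) : LinearIndependent ℝ a :=
  Fintype.linearIndependent_iff.2 fun c hc => congrFun (hinj c (by rw [hc, exp_zero]))

end Parametrization

/-! ### Passing to `ℂ`, and splitting of characteristic polynomials. -/

section Complexification

variable {n : ℕ}

theorem linearIndependent_map_ofReal {κ : Type*} [Fintype κ]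
    {w : κ → Matrix (Fin n) (Fin n) ℝ} (hw : LinearIndependent ℝ w) :
    LinearIndependent ℂ fun j => (w j).map Complex.ofReal := by
  rw [Fintype.linearIndependent_iff] at hw ⊢
  intro g hg
  have hre := hw (fun j => (g j).re) (by
    ext p q
    have := congrArg Complex.re (congrFun (congrFun hg p) q)
    simpa [Matrix.sum_apply] using this)
  have him := hw (fun j => (g j).im) (by
    ext p q
    have := congrArg Complex.im (congrFun (congrFun hg p) q)
    simpa [Matrix.sum_apply] using this)
  exact fun j => Complex.ext (hre j) (him j)

/-- For a family `g` diagonal in a common basis, all the values `T j g` lie in an algebra of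
dimension at most `n`. Dependence of more than `n` such values persists in the limit. -/
theorem not_linearIndependent_of_mem_closure {𝕜 κ ι : Type*} [RCLike 𝕜] [Fintype κ]
    (hκ : n < Fintype.card κ) {f : ι → Matrix (Fin n) (Fin n) 𝕜}
    (hf : f ∈ closure (diagonalizableFamilies 𝕜 ι (Fin n)))
    (T : κ → (ι → Matrix (Fin n) (Fin n) 𝕜) → Matrix (Fin n) (Fin n) 𝕜)
    (hTc : ∀ j, Continuous (T j)) (hT : ∀ j g, T j g ∈ Algebra.adjoin 𝕜 (Set.range g)) :
    ¬ LinearIndependent 𝕜 fun j => T j f := by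
  have hNe' : (comap (Subtype.val : diagonalizableFamilies 𝕜 ι (Fin n) → _) (𝓝 f)).NeBot :=
    mem_closure_iff_comap_neBot.1 hf
  refine not_linearIndependent_of_tendsto_of_finrank_le hκ
    (l := comap (Subtype.val : diagonalizableFamilies 𝕜 ι (Fin n) → _) (𝓝 f))
    (A := fun g => Subalgebra.toSubmodule (Algebra.adjoin 𝕜 (Set.range g.1))) ?_
    (v := fun g j => T j g.1) (fun g j => hT j g.1)
    (tendsto_pi_nhds.2 fun j => ((hTc j).tendsto f).comp tendsto_comap)
  rintro ⟨g, k, P, Q, hPQ, hQP, d, hd⟩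
  have hk : n = k := by simpa using Matrix.square_of_invertible P Q hPQ hQP
  subst hk
  let D : (Fin n → 𝕜) →ₗ[𝕜] Matrix (Fin n) (Fin n) 𝕜 :=
    (LinearMap.mulRight 𝕜 Q) ∘ₗ (LinearMap.mulLeft 𝕜 P) ∘ₗ
      (Matrix.diagonalAlgHom 𝕜).toLinearMap
  have hD : ∀ e, D e = P * Matrix.diagonal e * Q := fun e => rfl
  have hle : Algebra.adjoin 𝕜 (Set.range g) ≤ (LinearMap.range D).toSubalgebra
      ⟨1, by rw [hD]; simp [hPQ]⟩ (by
        rintro _ _ ⟨x, rfl⟩ ⟨y, rfl⟩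
        refine ⟨x * y, ?_⟩
        have hxy : Matrix.diagonal (x * y) = Matrix.diagonal x * Matrix.diagonal y :=
          map_mul (Matrix.diagonalAlgHom 𝕜) x y
        rw [hD, hD, hD, hxy]
        simp only [Matrix.mul_assoc]
        rw [← Matrix.mul_assoc Q P, hQP, Matrix.one_mul]) :=
    Algebra.adjoin_le (by rintro _ ⟨i, rfl⟩; exact ⟨d i, (hd i).symm⟩)
  refine (Submodule.finrank_mono (t := LinearMap.range D) hle).trans ?_
  have := LinearMap.finrank_range_le D
  rwa [finrank_fin_fun] at this

theorem map_mul_ofReal (x y : Matrix (Fin n) (Fin n) ℝ) : (x * y).map Complex.ofReal =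
    x.map Complex.ofReal * y.map Complex.ofReal :=
  Matrix.map_mul (f := Complex.ofRealHom)

theorem map_one_ofReal : (1 : Matrix (Fin n) (Fin n) ℝ).map Complex.ofReal = 1 :=
  Matrix.map_one Complex.ofRealHom (map_zero _) (map_one _)

variable {a : Fin (n - 1) → Matrix (Fin n) (Fin n) ℝ}

/-- A product `a i * a j` outside the span would give `n + 1` independent matrices over `ℝ`, hence
over `ℂ`, inside a limit of algebras of dimension at most `n`. -/
theorem mul_mem_frameSpan_of_mem_closure (hn : 1 ≤ n)
    (hli : LinearIndependent ℝ fun o : Option (Fin (n - 1)) => o.elim 1 a)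
    (hcl : (fun j => (a j).map Complex.ofReal) ∈
      closure (diagonalizableFamilies ℂ (Fin (n - 1)) (Fin n)))
    {x y : Matrix (Fin n) (Fin n) ℝ} (hx : x ∈ frameSpan a) (hy : y ∈ frameSpan a) :
    x * y ∈ frameSpan a := by
  have key : ∀ i j, a i * a j ∈ frameSpan a := by
    intro i j
    by_contra hij
    have h1 : LinearIndependent ℝ fun o : Option (Option (Fin (n - 1))) =>
        o.elim (a i * a j) fun o => o.elim 1 a := by
      rw [linearIndependent_option]
      exact ⟨hli, hij⟩
    refine not_linearIndependent_of_mem_closure (κ := Option (Option (Fin (n - 1))))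
      (by simp; omega) hcl (fun o g => o.elim (g i * g j) fun o => o.elim 1 g) ?_ ?_ ?_
    · rintro (_ | _ | k)
      exacts [(continuous_apply i).mul (continuous_apply j), continuous_const, continuous_apply k]
    · rintro (_ | _ | k) g
      exacts [Subalgebra.mul_mem _ (Algebra.subset_adjoin ⟨i, rfl⟩)
        (Algebra.subset_adjoin ⟨j, rfl⟩), Subalgebra.one_mem _, Algebra.subset_adjoin ⟨k, rfl⟩]
    · have h2 : (fun o : Option (Option (Fin (n - 1))) =>
          (o.elim (a i * a j) fun o => o.elim 1 a).map Complex.ofReal) =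
          fun o => o.elim ((a i).map Complex.ofReal * (a j).map Complex.ofReal)
            fun o => o.elim 1 fun j => (a j).map Complex.ofReal := by
        funext o
        rcases o with _ | _ | k
        exacts [map_mul_ofReal _ _, map_one_ofReal, rfl]
      have h3 := linearIndependent_map_ofReal h1
      rw [h2] at h3
      exact h3
  refine Submodule.span_induction₂ (p := fun x y _ _ => x * y ∈ frameSpan a) ?_ ?_ ?_ ?_ ?_ ?_ ?_
    hx hy
  · rintro _ _ ⟨_ | i, rfl⟩ ⟨_ | j, rfl⟩
    · change 1 * (1 : Matrix (Fin n) (Fin n) ℝ) ∈ _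
      rw [one_mul]
      exact one_mem_frameSpan
    · change 1 * a j ∈ _
      rw [one_mul]
      exact mem_frameSpan j
    · change a i * 1 ∈ _
      rw [mul_one]
      exact mem_frameSpan i
    · exact key i j
  · intro y _
    rw [zero_mul]
    exact Submodule.zero_mem _
  · intro x _
    rw [mul_zero]
    exact Submodule.zero_mem _
  · intro x y z _ _ _ h1 h2
    rw [add_mul]
    exact Submodule.add_mem _ h1 h2
  · intro x y z _ _ _ h1 h2
    rw [mul_add]
    exact Submodule.add_mem _ h1 h2
  · intro r x y _ _ h1
    rw [smul_mul_assoc]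
    exact Submodule.smul_mem _ _ h1
  · intro r x y _ _ h1
    rw [mul_smul_comm]
    exact Submodule.smul_mem _ _ h1

theorem mul_comm_of_mem_frameSpan (hc : ∀ i j, Commute (a i) (a j))
    {x y : Matrix (Fin n) (Fin n) ℝ} (hx : x ∈ frameSpan a) (hy : y ∈ frameSpan a) :
    x * y = y * x := by
  obtain ⟨r, c, rfl⟩ := exists_of_mem_frameSpan hx
  obtain ⟨s, d, rfl⟩ := exists_of_mem_frameSpan hy
  refine Commute.eq ?_
  have h1 : Commute (∑ j, c j • a j) (∑ j, d j • a j) :=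
    Commute.sum_left _ _ _ fun i _ => Commute.sum_right _ _ _ fun j _ =>
      ((hc i j).smul_left _).smul_right _
  exact (((Commute.one_left _).smul_left r).add_left
    (((Commute.one_right _).smul_right s).add_right h1))

/-- If `x ^ 2 + 1` is invertible for all `x` in a real algebra of matrices, then the
characteristic polynomials of its elements split. -/
theorem splits_charpoly_of_isUnit_sq_add_one (B : Subalgebra ℝ (Matrix (Fin n) (Fin n) ℝ))
    (hB : ∀ x ∈ B, IsUnit (x ^ 2 + 1)) {x : Matrix (Fin n) (Fin n) ℝ} (hx : x ∈ B) :
    x.charpoly.Splits := by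
  refine Polynomial.Splits.of_splits_map_of_injective (i := Complex.ofRealHom)
    Complex.ofRealHom.injective (IsAlgClosed.splits _) fun z hz => ?_
  by_cases him : z.im = 0
  · exact ⟨z.re, Complex.ext rfl him.symm⟩
  exfalso
  have h1 : (Matrix.scalar (Fin n) z - x.map Complex.ofRealHom).det = 0 := by
    rw [← Matrix.eval_charpoly, Matrix.charpoly_map]
    exact (Polynomial.mem_roots'.1 hz).2
  -- Normalized so that `z - x = z.im (y + i)`. A nonreal root `z` makes `y + i` singular, hence
  -- also `y ^ 2 + 1 = (y + i)(y - i)`.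
  let y : Matrix (Fin n) (Fin n) ℝ := z.im⁻¹ • (z.re • 1 - x)
  have hy : y ∈ B := B.smul_mem (B.sub_mem (B.smul_mem B.one_mem _) hx) _
  have h2 : (Matrix.scalar (Fin n) z - x.map Complex.ofRealHom) =
      (z.im : ℂ) • (Complex.ofRealHom.mapMatrix y + Complex.I • 1) := by
    have him' : (z.im : ℂ) ≠ 0 := by exact_mod_cast him
    ext p q
    rcases eq_or_ne p q with rfl | hpq
    · simp [y, Matrix.smul_apply]
      field_simp
      linear_combination -(Complex.re_add_im z)
    · simp [y, Matrix.smul_apply, hpq, Matrix.one_apply_ne hpq]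
      field_simp
  have h3 : Complex.ofRealHom.mapMatrix (y ^ 2 + 1) =
      (Complex.ofRealHom.mapMatrix y + Complex.I • 1) *
        (Complex.ofRealHom.mapMatrix y - Complex.I • 1) := by
    rw [map_add, map_pow, map_one]
    simp only [Matrix.add_mul, Matrix.mul_sub, Matrix.smul_mul, Matrix.mul_smul, Matrix.mul_one,
      Matrix.one_mul, smul_add, smul_smul, Complex.I_mul_I, pow_two]
    module
  have h4 : IsUnit (Complex.ofRealHom.mapMatrix (y ^ 2 + 1)) := (hB y hy).map _
  rw [Matrix.isUnit_iff_isUnit_det, h3, Matrix.det_mul, isUnit_iff_ne_zero] at h4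
  rw [h2, Matrix.det_smul] at h1
  rcases mul_eq_zero.1 h1 with h5 | h5
  · exact pow_ne_zero _ (Complex.ofReal_ne_zero.2 him) h5
  · exact h4 (by rw [h5, zero_mul])

end Complexification
end ConjLimit

namespace ConjLimit
open Module NormedSpace

/-! ### In dimension at most four every member of `AbHat` is a conjugacy limit. -/

section Diagonalization

variable {n : ℕ}

theorem exists_diagEmb_of_mem_diagonalizableFamilies {ι : Type*} (hn : 1 ≤ n)
    {f : ι → Matrix (Fin n) (Fin n) ℝ} (hf : f ∈ diagonalizableFamilies ℝ ι (Fin n)) :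
    ∃ (R : SL(n, ℝ)) (d : ι → Fin n → ℝ), ∀ i, f i = diagEmb R (d i) := by
  obtain ⟨k, P, Q, hPQ, hQP, d, hd⟩ := hf
  have hk : n = k := by simpa using Matrix.square_of_invertible P Q hPQ hQP
  subst hk
  have hdet : P.det ≠ 0 := by
    have h1 := congrArg Matrix.det hPQ
    rw [Matrix.det_mul, Matrix.det_one] at h1
    exact left_ne_zero_of_mul_eq_one h1
  -- Rescaling one eigenvector brings the change of basis into `SL(n, ℝ)` without altering the
  -- diagonalized matrices.
  let δ : Fin n → ℝ := Function.update 1 ⟨0, hn⟩ P.det⁻¹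
  have hδ : (P * Matrix.diagonal δ).det = 1 := by
    rw [Matrix.det_mul, Matrix.det_diagonal, Finset.prod_update_of_mem (Finset.mem_univ _)]
    simp [hdet]
  let R : SL(n, ℝ) := ⟨P * Matrix.diagonal δ, hδ⟩
  refine ⟨R, d, fun i => ?_⟩
  have h1 : f i * R = R * Matrix.diagonal (d i) := by
    change f i * (P * Matrix.diagonal δ) = P * Matrix.diagonal δ * Matrix.diagonal (d i)
    rw [hd]
    simp only [Matrix.mul_assoc]
    rw [← Matrix.mul_assoc Q P, hQP, Matrix.one_mul, Matrix.diagonal_mul_diagonal,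
      Matrix.diagonal_mul_diagonal]
    simp only [mul_comm]
  rw [diagEmb_apply, ← h1, Matrix.mul_assoc, coe_mul_coe_inv, Matrix.mul_one]

theorem exists_isLimitFrame_of_mem_closure (hn : 1 ≤ n)
    {a : Fin (n - 1) → Matrix (Fin n) (Fin n) ℝ} (hli : LinearIndependent ℝ a)
    (htr : ∀ j, (a j).trace = 0)
    (hcl : a ∈ closure (diagonalizableFamilies ℝ (Fin (n - 1)) (Fin n))) :
    ∃ P : ℕ → SL(n, ℝ), IsLimitFrame P a := by
  have : FirstCountableTopology (Matrix (Fin n) (Fin n) ℝ) :=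
    inferInstanceAs (FirstCountableTopology (Fin n → Fin n → ℝ))
  obtain ⟨f, hf, hlim⟩ := mem_closure_iff_seq_limit.1 hcl
  choose R d hd using fun k => exists_diagEmb_of_mem_diagonalizableFamilies hn (hf k)
  have hn' : (n : ℝ) ≠ 0 := by positivity
  -- Removing the scalar part makes the approximants traceless; the correction tends to `0` because
  -- the limits are traceless.
  refine ⟨R, hli, fun k j => d k j - ((∑ i, d k j i) / n) • 1, fun k j => ?_, ?_⟩
  · simp [Finset.sum_sub_distrib]
    field_simp
    ring
  · refine tendsto_pi_nhds.2 fun j => ?_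
    have hlim' := tendsto_pi_nhds.1 hlim j
    have h1 : Tendsto (fun k => (f k j).trace / n) atTop (𝓝 0) := by
      have h2 := ((continuous_id.matrix_trace.tendsto (a j)).comp hlim').div_const (n : ℝ)
      simpa only [Function.comp, id, htr, zero_div] using h2
    have h3 := hlim'.sub (h1.smul_const (1 : Matrix (Fin n) (Fin n) ℝ))
    rw [zero_smul, sub_zero] at h3
    refine h3.congr fun k => ?_
    rw [map_sub, map_smul, map_one, ← hd, hd k j, trace_diagEmb]

theorem mem_RedHat_of_mem_AbHat (hn : 1 ≤ n) (hn4 : n ≤ 4) {G : ClosedSubgroup SL(n, ℝ)}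
    (hG : G ∈ AbHat n) : G ∈ RedHat n := by
  obtain ⟨a, hc, hmem, hsurj, hinj⟩ := exists_exp_frame_of_mem_AbHat hG
  have hli := linearIndependent_of_exp_injective hinj
  have htr : ∀ j, (a j).trace = 0 := by
    intro j
    obtain ⟨x, -, hx⟩ := hmem (Pi.single j 1)
    have h1 := congrArg Matrix.det hx
    rw [x.det_coe, det_exp_eq, eq_comm, Real.exp_eq_one_iff] at h1
    simpa [Pi.single_apply, ite_smul] using h1
  have hli1 := linearIndependent_option_one hn hli htr
  -- Over `ℂ` the eigenvalue condition is automatic. This limit is used only to show that `1` and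
  -- the `a j` span an algebra, on which the injectivity of `exp` then forces real eigenvalues.
  have hclC : (fun j => (a j).map Complex.ofReal) ∈
      closure (diagonalizableFamilies ℂ (Fin (n - 1)) (Fin n)) := by
    refine mem_closure_diagonalizableFamilies hn4 (fun i j => ?_) fun i =>
      ⟨_, (Matrix.charpoly_monic _).ne_zero, IsAlgClosed.splits _, Matrix.aeval_self_charpoly _⟩
    rw [commute_iff_eq, ← map_mul_ofReal, (hc i j).eq, map_mul_ofReal]
  let B : Subalgebra ℝ (Matrix (Fin n) (Fin n) ℝ) :=
    (frameSpan a).toSubalgebra one_mem_frameSpan fun _ _ hx hy =>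
      mul_mem_frameSpan_of_mem_closure hn hli1 hclC hx hy
  have hB : ∀ x ∈ B, IsUnit (x ^ 2 + 1) := fun x hx => by
    refine isUnit_sq_add_one_matrix B (fun x hx y hy => mul_comm_of_mem_frameSpan hc hx hy)
      (fun y hy hexp => ?_) x hx
    obtain ⟨r, c, rfl⟩ := exists_of_mem_frameSpan (b := a) hy
    have h1 := congrArg Matrix.det hexp
    rw [det_exp_eq, Matrix.det_one, Real.exp_eq_one_iff, Matrix.trace_add, Matrix.trace_sum] at h1
    simp only [Matrix.trace_smul, htr, smul_eq_mul, mul_zero, Finset.sum_const_zero,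
      add_zero, Matrix.trace_one, Fintype.card_fin, mul_eq_zero, Nat.cast_eq_zero] at h1
    have hr : r = 0 := h1.resolve_right (by omega)
    rw [hr, zero_smul, zero_add] at hexp ⊢
    simp [hinj c hexp]
  have hcl := mem_closure_diagonalizableFamilies hn4 hc fun i =>
    ⟨_, (Matrix.charpoly_monic _).ne_zero,
      splits_charpoly_of_isUnit_sq_add_one B hB (mem_frameSpan (b := a) i),
      Matrix.aeval_self_charpoly _⟩
  obtain ⟨P, hP⟩ := exists_isLimitFrame_of_mem_closure hn hli htr hcl
  refine ⟨P, tendsto_of_limits (fun x hx => ?_) fun x k v hk hv hx => ?_⟩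
  · obtain ⟨c, hcx⟩ := hsurj x hx
    obtain ⟨y, v, hy, hv, hlim⟩ := hP.exists_tendsto_exp c
    have hxy : y = x := Subtype.ext (hy.trans hcx)
    exact ⟨v, hv, hxy ▸ hlim⟩
  · obtain ⟨c, hcx⟩ := hP.exists_exp_eq hn hk.tendsto_atTop hv hx
    obtain ⟨y, hy, hyx⟩ := hmem c
    have hxy : y = x := Subtype.ext (hyx.trans hcx)
    exact hxy ▸ hy

theorem Ab_eq_Red (hn : 1 ≤ n) (hn4 : n ≤ 4) : Ab n = Red n :=
  congrArg _ (Set.Subset.antisymm (fun _ hG => mem_RedHat_of_mem_AbHat hn hn4 hG)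
    fun _ hL => mem_AbHat_of_isConjLimit hn hL)

end Diagonalization
end ConjLimit

namespace ConjLimit
open Module NormedSpace

/-! ### The dimension obstruction and quadratic unipotent groups. -/

section Obstruction

variable {n : ℕ}

/-- A conjugacy limit of the diagonal group spans at most `n` dimensions. -/
theorem exists_submodule_of_mem_RedHat (hn : 1 ≤ n) {L : ClosedSubgroup SL(n, ℝ)}
    (hL : L ∈ RedHat n) : ∃ W : Submodule ℝ (Matrix (Fin n) (Fin n) ℝ), finrank ℝ W ≤ n ∧
      ∀ x ∈ (L : Set SL(n, ℝ)), (x : Matrix (Fin n) (Fin n) ℝ) ∈ W := by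
  obtain ⟨P, hP⟩ := hL
  obtain ⟨φ, b, hφ, hb⟩ := exists_subseq_isLimitFrame hn P
  have hP' : Tendsto (fun k => conj ((P ∘ φ) k) (cartan n)) atTop (𝓝 L) :=
    hP.comp hφ.tendsto_atTop
  refine ⟨frameSpan b, ?_, fun x hx => ?_⟩
  · refine (finrank_range_le_card (R := ℝ)
      fun o : Option (Fin (n - 1)) => o.elim 1 b).trans ?_
    simp
    omega
  · have hNe := neBot_comap_of_tendsto hP' hx
    refine hb.mem_frameSpan_of_tendsto hn (l := comap Subtype.val (atTop ×ˢ 𝓝 x)) (k := fun a :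
      {p : ℕ × SL(n, ℝ) // p.2 ∈ (conj ((P ∘ φ) p.1) (cartan n) : Set _)} => a.1.1)
      (tendsto_fst.comp tendsto_comap)
      (v := fun a => (a.1.2 : Matrix (Fin n) (Fin n) ℝ)) (fun a => ?_)
      ((continuous_subtype_val.tendsto x).comp (tendsto_snd.comp tendsto_comap))
    obtain ⟨d, -, hd⟩ := mem_conj_cartan.1 a.2
    exact ⟨d, hd.symm⟩

theorem exists_submodule_of_conj {L : ClosedSubgroup SL(n, ℝ)} (g : SL(n, ℝ))
    {W : Submodule ℝ (Matrix (Fin n) (Fin n) ℝ)} (hW : finrank ℝ W ≤ n)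
    (hL : ∀ x ∈ (L : Set SL(n, ℝ)), (x : Matrix (Fin n) (Fin n) ℝ) ∈ W) :
    ∃ W' : Submodule ℝ (Matrix (Fin n) (Fin n) ℝ), finrank ℝ W' ≤ n ∧
      ∀ x ∈ (conj g L : Set SL(n, ℝ)), (x : Matrix (Fin n) (Fin n) ℝ) ∈ W' := by
  refine ⟨W.map (LinearMap.mulLeftRight ℝ ((g : Matrix (Fin n) (Fin n) ℝ),
    ((g⁻¹ : SL(n, ℝ)) : Matrix (Fin n) (Fin n) ℝ))), (Submodule.finrank_map_le _ _).trans hW, ?_⟩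
  rintro _ ⟨x, hx, rfl⟩
  exact ⟨x, hL x hx, rfl⟩

/-- The characteristic polynomial of the nilpotent `-N` is `X ^ n`; its value at `1` is `det (1 +
N)`. -/
theorem det_one_add_of_isNilpotent {N : Matrix (Fin n) (Fin n) ℝ} (hN : IsNilpotent N) :
    (1 + N).det = 1 := by
  have h1 := (Matrix.isNilpotent_charpoly_sub_pow_of_isNilpotent hN.neg).eq_zero
  have h2 := Matrix.eval_charpoly (-N) 1
  rw [sub_eq_zero.1 h1] at h2
  simpa using h2.symm

variable {E : Fin (n - 1) → Matrix (Fin n) (Fin n) ℝ} {z : Fin (n - 1)}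
  {S : Matrix (Fin n) (Fin n) ℝ}

/-- The exponential of `∑ v k • E k` when the only nonzero product of the `E k` is
`E z * E z = S`. -/
noncomputable def quadraticExp (E : Fin (n - 1) → Matrix (Fin n) (Fin n) ℝ) (z : Fin (n - 1))
    (S : Matrix (Fin n) (Fin n) ℝ) (v : Fin (n - 1) → ℝ) : Matrix (Fin n) (Fin n) ℝ :=
  1 + (∑ k, v k • E k + (v z ^ 2 / 2) • S)

theorem quadraticExp_zero : quadraticExp E z S 0 = 1 := by
  simp [quadraticExp]

theorem continuous_quadraticExp : Continuous (quadraticExp E z S) := by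
  unfold quadraticExp
  fun_prop

theorem sum_smul_mul_sum_smul
    (hEE : ∀ k l, E k * E l = if k = z ∧ l = z then S else 0) (v w : Fin (n - 1) → ℝ) :
    (∑ k, v k • E k) * ∑ l, w l • E l = (v z * w z) • S := by
  simp only [Finset.sum_mul, Finset.mul_sum, smul_mul_assoc, mul_smul_comm, hEE, ite_and, smul_ite,
    smul_zero]
  simp [smul_smul, mul_comm]

theorem quadraticExp_add (hEE : ∀ k l, E k * E l = if k = z ∧ l = z then S else 0)
    (hES : ∀ k, E k * S = 0) (hSE : ∀ k, S * E k = 0) (v w : Fin (n - 1) → ℝ) :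
    quadraticExp E z S (v + w) = quadraticExp E z S v * quadraticExp E z S w := by
  have hSS : S * S = 0 := by
    have h1 := hEE z z
    rw [if_pos ⟨rfl, rfl⟩] at h1
    nth_rw 1 [← h1]
    rw [mul_assoc, hES, mul_zero]
  have h1 : (∑ k, v k • E k) * S = 0 := by simp [Finset.sum_mul, hES]
  have h2 : S * ∑ k, w k • E k = 0 := by simp [Finset.mul_sum, hSE]
  have h3 : ∑ k, (v + w) k • E k = ∑ k, v k • E k + ∑ k, w k • E k := by
    simp [add_smul, Finset.sum_add_distrib]
  unfold quadraticExp
  rw [h3]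
  simp only [mul_add, add_mul, one_mul, mul_one, sum_smul_mul_sum_smul hEE, mul_smul_comm,
    smul_mul_assoc, h1, h2, hSS, smul_zero, Pi.add_apply]
  module

theorem det_quadraticExp (hEE : ∀ k l, E k * E l = if k = z ∧ l = z then S else 0)
    (hES : ∀ k, E k * S = 0) (hSE : ∀ k, S * E k = 0) (v : Fin (n - 1) → ℝ) :
    (quadraticExp E z S v).det = 1 := by
  refine det_one_add_of_isNilpotent ⟨3, ?_⟩
  have hSS : S * S = 0 := by
    have h1 := hEE z z
    rw [if_pos ⟨rfl, rfl⟩] at h1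
    nth_rw 1 [← h1]
    rw [mul_assoc, hES, mul_zero]
  have h1 : (∑ k, v k • E k) * S = 0 := by simp [Finset.sum_mul, hES]
  have h2 : S * ∑ k, v k • E k = 0 := by simp [Finset.mul_sum, hSE]
  simp only [pow_succ, pow_zero, one_mul, mul_add, add_mul, sum_smul_mul_sum_smul hEE,
    mul_smul_comm, smul_mul_assoc, h1, h2, hSS, smul_zero, add_zero]

/-- Independence of `S`, `1` and the `E k` lets a linear map read off the parameter `v`. This gives
both the closedness of the group and the injectivity of its parametrization. -/
theorem exists_linearMap_quadraticExp
    (hli : LinearIndependent ℝ fun o : Option (Option (Fin (n - 1))) =>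
      o.elim S fun o => o.elim 1 E) :
    ∃ ρ : Matrix (Fin n) (Fin n) ℝ →ₗ[ℝ] (Fin (n - 1) → ℝ),
      ∀ v, ρ (quadraticExp E z S v) = v := by
  obtain ⟨g, hg⟩ := LinearMap.exists_leftInverse_of_injective _
    (LinearMap.ker_eq_bot.2 hli.fintypeLinearCombination_injective)
  refine ⟨LinearMap.funLeft ℝ ℝ (fun k => some (some k)) ∘ₗ g, fun v => ?_⟩
  let u : Option (Option (Fin (n - 1))) → ℝ := fun o => o.elim (v z ^ 2 / 2) fun o => o.elim 1 v
  have hu : quadraticExp E z S v = Fintype.linearCombination ℝ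
      (fun o : Option (Option (Fin (n - 1))) => o.elim S fun o => o.elim 1 E) u := by
    rw [Fintype.linearCombination_apply, Fintype.sum_option, Fintype.sum_option]
    simp only [Option.elim, u, quadraticExp]
    module
  have h1 := LinearMap.congr_fun hg u
  rw [LinearMap.comp_apply, ← hu, LinearMap.id_apply] at h1
  rw [LinearMap.comp_apply, h1]
  rfl

/-- The closed subgroup of all `quadraticExp E z S v`. -/
def quadraticSubgroup (hEE : ∀ k l, E k * E l = if k = z ∧ l = z then S else 0)
    (hES : ∀ k, E k * S = 0) (hSE : ∀ k, S * E k = 0)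
    (hli : LinearIndependent ℝ fun o : Option (Option (Fin (n - 1))) =>
      o.elim S fun o => o.elim 1 E) : ClosedSubgroup SL(n, ℝ) where
  carrier := {x | ∃ v, (x : Matrix (Fin n) (Fin n) ℝ) = quadraticExp E z S v}
  one_mem' := ⟨0, by rw [quadraticExp_zero, Matrix.SpecialLinearGroup.coe_one]⟩
  mul_mem' := by
    rintro x y ⟨v, hv⟩ ⟨w, hw⟩
    exact ⟨v + w, by rw [Matrix.SpecialLinearGroup.coe_mul, quadraticExp_add hEE hES hSE, hv, hw]⟩
  inv_mem' := by
    rintro x ⟨v, hv⟩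
    refine ⟨-v, left_inv_eq_right_inv (coe_inv_mul_coe x) ?_⟩
    rw [hv, ← quadraticExp_add hEE hES hSE, add_neg_cancel, quadraticExp_zero]
  isClosed' := by
    obtain ⟨ρ, hρ⟩ := exists_linearMap_quadraticExp (z := z) hli
    have hset : {x : SL(n, ℝ) | ∃ v, (x : Matrix (Fin n) (Fin n) ℝ) = quadraticExp E z S v} =
        {x : SL(n, ℝ) | (x : Matrix (Fin n) (Fin n) ℝ) =
          quadraticExp E z S (ρ (x : Matrix (Fin n) (Fin n) ℝ))} := by
      ext x
      constructor
      · rintro ⟨v, hv⟩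
        change (x : Matrix (Fin n) (Fin n) ℝ) = _
        rw [hv, hρ]
      · exact fun hx => ⟨_, hx⟩
    change IsClosed {x : SL(n, ℝ) | ∃ v, (x : Matrix (Fin n) (Fin n) ℝ) = quadraticExp E z S v}
    rw [hset]
    have hval : Continuous fun x : SL(n, ℝ) => (x : Matrix (Fin n) (Fin n) ℝ) :=
      continuous_subtype_val
    exact isClosed_eq hval
      (continuous_quadraticExp.comp (ρ.continuous_of_finiteDimensional.comp hval))

theorem quadraticSubgroup_mem_AbHat (hEE : ∀ k l, E k * E l = if k = z ∧ l = z then S else 0)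
    (hES : ∀ k, E k * S = 0) (hSE : ∀ k, S * E k = 0)
    (hli : LinearIndependent ℝ fun o : Option (Option (Fin (n - 1))) =>
      o.elim S fun o => o.elim 1 E) : quadraticSubgroup hEE hES hSE hli ∈ AbHat n := by
  obtain ⟨ρ, hρ⟩ := exists_linearMap_quadraticExp (z := z) hli
  let x : (Fin (n - 1) → ℝ) → SL(n, ℝ) := fun v =>
    ⟨quadraticExp E z S v, det_quadraticExp hEE hES hSE v⟩
  let ψ : Multiplicative (Fin (n - 1) → ℝ) →* (quadraticSubgroup hEE hES hSE hli).toSubgroup :=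
    { toFun := fun v => ⟨x v.toAdd, v.toAdd, rfl⟩
      map_one' := Subtype.ext (Subtype.ext (quadraticExp_zero (E := E) (z := z) (S := S)))
      map_mul' := fun v w => Subtype.ext (Subtype.ext (quadraticExp_add hEE hES hSE _ _)) }
  refine mem_AbHat_of_bijective ψ ?_ ⟨fun v w h => ?_, ?_⟩
  · exact Continuous.subtype_mk (Continuous.subtype_mk
      (continuous_quadraticExp.comp continuous_toAdd) _) _
  · have h1 : quadraticExp E z S v.toAdd = quadraticExp E z S w.toAdd :=
      congrArg (fun y : (quadraticSubgroup hEE hES hSE hli).toSubgroup =>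
        ((y : SL(n, ℝ)) : Matrix (Fin n) (Fin n) ℝ)) h
    have h2 := congrArg ρ h1
    rw [hρ, hρ] at h2
    exact h2
  · rintro ⟨y, v, hv⟩
    exact ⟨Multiplicative.ofAdd v, Subtype.ext (Subtype.ext hv.symm)⟩

theorem not_forall_quadraticSubgroup_mem
    (hEE : ∀ k l, E k * E l = if k = z ∧ l = z then S else 0)
    (hES : ∀ k, E k * S = 0) (hSE : ∀ k, S * E k = 0)
    (hli : LinearIndependent ℝ fun o : Option (Option (Fin (n - 1))) =>
      o.elim S fun o => o.elim 1 E) {W : Submodule ℝ (Matrix (Fin n) (Fin n) ℝ)}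
    (hW : finrank ℝ W ≤ n) : ¬ ∀ x ∈ (quadraticSubgroup hEE hES hSE hli : Set SL(n, ℝ)),
      (x : Matrix (Fin n) (Fin n) ℝ) ∈ W := by
  intro h
  have hmem : ∀ v, quadraticExp E z S v ∈ W := fun v =>
    h ⟨_, det_quadraticExp hEE hES hSE v⟩ ⟨v, rfl⟩
  have h1 : (1 : Matrix (Fin n) (Fin n) ℝ) ∈ W := quadraticExp_zero (E := E) (z := z) ▸ hmem 0
  have hsingle : ∀ k (r : ℝ), quadraticExp E z S (Pi.single k r) =
      1 + (r • E k + ((Pi.single k r : Fin (n - 1) → ℝ) z ^ 2 / 2) • S) := by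
    intro k r
    simp [quadraticExp, Pi.single_apply, ite_smul]
  have hS : S ∈ W := by
    -- A second difference in the direction `z` cancels the linear term and isolates `S`.
    have h2 := W.sub_mem (W.add_mem (hmem (Pi.single z 1)) (hmem (Pi.single z (-1))))
      (W.smul_mem (2 : ℝ) h1)
    rw [hsingle, hsingle, Pi.single_eq_same, Pi.single_eq_same] at h2
    convert h2 using 1
    module
  have hE : ∀ k, E k ∈ W := by
    intro k
    have h2 := W.sub_mem (W.sub_mem (hmem (Pi.single k 1)) h1)
      (W.smul_mem ((Pi.single k 1 : Fin (n - 1) → ℝ) z ^ 2 / 2) hS)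
    rw [hsingle] at h2
    convert h2 using 1
    module
  have hall : ∀ o : Option (Option (Fin (n - 1))), (o.elim S fun o => o.elim 1 E) ∈ W := by
    rintro (_ | _ | k)
    exacts [hS, h1, hE k]
  have h2 : LinearIndependent ℝ fun o : Option (Option (Fin (n - 1))) =>
      (⟨o.elim S fun o => o.elim 1 E, hall o⟩ : W) := LinearIndependent.of_comp W.subtype hli
  have h3 := h2.fintype_card_le_finrank
  simp at h3
  omega

end Obstruction

/-! ### The explicit group for dimension at least five. -/

section Example

variable {n : ℕ} {s t : Fin (n - 1) → Fin n} {z : Fin (n - 1)} {p r : Fin n}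

/-- Elementary matrices at the positions `(s k, t k)`, with an additional entry at `(p, r)` for
`k = z`. -/
def elementaryFrame (s t : Fin (n - 1) → Fin n) (z : Fin (n - 1)) (p r : Fin n)
    (k : Fin (n - 1)) : Matrix (Fin n) (Fin n) ℝ :=
  Matrix.single (s k) (t k) 1 + if k = z then Matrix.single p r 1 else 0

/-- No column `t k` is a row `s l`, so two main entries never compose. The extra entry at `(p, r)`
can only follow a main entry in column `p`, which occurs for `k = z` alone. -/
theorem elementaryFrame_mul (hst : ∀ k l, t k ≠ s l) (hr : ∀ k, s k ≠ r)
    (hpr : p ≠ r) (htp : ∀ k, t k = p ↔ k = z) (k l : Fin (n - 1)) :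
    elementaryFrame s t z p r k * elementaryFrame s t z p r l =
      if k = z ∧ l = z then Matrix.single (s z) r 1 else 0 := by
  have h1 : (if k = z then Matrix.single p r (1 : ℝ) else 0) * Matrix.single (s l) (t l) 1 = 0 := by
    split_ifs
    · exact Matrix.single_mul_single_of_ne _ _ _ _ (hr l).symm _
    · exact zero_mul _
  have h2 : (if k = z then Matrix.single p r (1 : ℝ) else 0) *
      (if l = z then Matrix.single p r (1 : ℝ) else 0) = 0 := by
    split_ifs
    · exact Matrix.single_mul_single_of_ne _ _ _ _ hpr.symm _
    all_goals simp
  unfold elementaryFrame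
  rw [add_mul, mul_add, mul_add, Matrix.single_mul_single_of_ne _ _ _ _ (hst k l), h1, h2]
  by_cases hl : l = z
  · by_cases hk : k = z
    · rw [if_pos hl, if_pos ⟨hk, hl⟩, (htp k).2 hk, Matrix.single_mul_single_same, hk]
      simp
    · rw [if_pos hl, if_neg (fun h => hk h.1),
        Matrix.single_mul_single_of_ne _ _ _ _ (fun h => hk ((htp k).1 h))]
      simp
  · rw [if_neg hl, if_neg (fun h => hl h.2)]
    simp

theorem elementaryFrame_mul_single (hst : ∀ k l, t k ≠ s l) (hr : ∀ k, s k ≠ r)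
    (k : Fin (n - 1)) : elementaryFrame s t z p r k * Matrix.single (s z) r 1 = 0 := by
  unfold elementaryFrame
  rw [add_mul, Matrix.single_mul_single_of_ne _ _ _ _ (hst k z), zero_add]
  split_ifs
  · exact Matrix.single_mul_single_of_ne _ _ _ _ (hr z).symm _
  · exact zero_mul _

theorem single_mul_elementaryFrame (hr : ∀ k, s k ≠ r) (hpr : p ≠ r)
    (k : Fin (n - 1)) : Matrix.single (s z) r 1 * elementaryFrame s t z p r k = 0 := by
  unfold elementaryFrame
  rw [mul_add, Matrix.single_mul_single_of_ne _ _ _ _ (hr k).symm, zero_add]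
  split_ifs
  · exact Matrix.single_mul_single_of_ne _ _ _ _ hpr.symm _
  · exact mul_zero _

/-- Each coefficient is isolated by one matrix entry: `(r, r)` sees only the identity, then `(s z,
r)` only the square, then `(s k, t k)` only the `k`-th generator. -/
theorem linearIndependent_elementaryFrame (hp : ∀ k, s k ≠ p)
    (hr : ∀ k, s k ≠ r) (hpr : p ≠ r) (hzr : ∀ k, ¬ (s k = s z ∧ t k = r))
    (hinj : ∀ k l, s k = s l → t k = t l → k = l) :
    LinearIndependent ℝ fun o : Option (Option (Fin (n - 1))) =>
      o.elim (Matrix.single (s z) r 1) fun o => o.elim 1 (elementaryFrame s t z p r) := by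
  rw [Fintype.linearIndependent_iff]
  intro g hg
  rw [Fintype.sum_option, Fintype.sum_option] at hg
  simp only [Option.elim] at hg
  have hentry : ∀ i j, g none * Matrix.single (s z) r (1 : ℝ) i j +
      (g (some none) * (1 : Matrix (Fin n) (Fin n) ℝ) i j +
        ∑ k, g (some (some k)) * elementaryFrame s t z p r k i j) = 0 := by
    intro i j
    have := congrFun (congrFun hg i) j
    simpa only [Matrix.add_apply, Matrix.sum_apply, Matrix.smul_apply, smul_eq_mul,
      Matrix.zero_apply] using this
  have hE : ∀ k i j, elementaryFrame s t z p r k i j =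
      (if s k = i ∧ t k = j then 1 else 0) + if k = z ∧ p = i ∧ r = j then 1 else 0 := by
    intro k i j
    unfold elementaryFrame
    by_cases hk : k = z <;> simp [hk, Matrix.single_apply]
  have hone : g (some none) = 0 := by
    have h1 := hentry r r
    rw [Finset.sum_eq_zero fun k _ => by
      rw [hE, if_neg (fun h => hr k h.1), if_neg (fun h => hpr h.2.1)]; simp] at h1
    simpa [Matrix.single_apply, hr z] using h1
  have hnone : g none = 0 := by
    have h1 := hentry (s z) r
    rw [Finset.sum_eq_zero fun k _ => by
      rw [hE, if_neg (hzr k), if_neg (fun h => hp z h.2.1.symm)]; simp, hone] at h1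
    simpa [Matrix.single_apply] using h1
  rintro (_ | _ | k)
  · exact hnone
  · exact hone
  · have h1 := hentry (s k) (t k)
    rw [hnone, hone, zero_mul, zero_mul, zero_add, zero_add, Finset.sum_eq_single k] at h1
    · rw [hE, if_pos ⟨rfl, rfl⟩, if_neg (fun h => hp k h.2.1.symm)] at h1
      simpa using h1
    · intro l _ hl
      rw [hE, if_neg (fun h => hl (hinj l k h.1 h.2)), if_neg (fun h => hp k h.2.1.symm)]
      simp
    · simp

theorem exists_mem_AbHat_not_forall_mem (hn : 5 ≤ n) : ∃ G ∈ AbHat n,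
    ∀ W : Submodule ℝ (Matrix (Fin n) (Fin n) ℝ), finrank ℝ W ≤ n →
      ¬ ∀ x ∈ (G : Set SL(n, ℝ)), (x : Matrix (Fin n) (Fin n) ℝ) ∈ W := by
  -- With zero-based indices, the generators are `e(0, n-3) + e(n-3, n-1)`, then `e(k, n-1)` for `1
  -- ≤ k ≤ n-4`, then `e(0, n-2)` and `e(1, n-2)`; the square of the first is `e(0, n-1)`. The
  -- condition `n ≥ 5` keeps row `1` different from the intermediate index `n-3`.
  let s : Fin (n - 1) → Fin n := fun k =>
    if h : (k : ℕ) < n - 3 then ⟨k, by omega⟩ else ⟨k - (n - 3), by omega⟩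
  let t : Fin (n - 1) → Fin n := fun k =>
    if (k : ℕ) = 0 then ⟨n - 3, by omega⟩ else
      if (k : ℕ) < n - 3 then ⟨n - 1, by omega⟩ else ⟨n - 2, by omega⟩
  let z : Fin (n - 1) := ⟨0, by omega⟩
  let p : Fin n := ⟨n - 3, by omega⟩
  let r : Fin n := ⟨n - 1, by omega⟩
  have hs : ∀ k, (s k : ℕ) = if (k : ℕ) < n - 3 then (k : ℕ) else k - (n - 3) := by
    intro k
    simp only [s]
    split_ifs <;> rfl
  have ht : ∀ k, (t k : ℕ) = if (k : ℕ) = 0 then n - 3 else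
      if (k : ℕ) < n - 3 then n - 1 else n - 2 := by
    intro k
    simp only [t]
    split_ifs <;> rfl
  have hst : ∀ k l, t k ≠ s l := by
    intro k l h
    have := congrArg Fin.val h
    have := l.2
    rw [hs, ht] at *
    split_ifs at * <;> omega
  have hp : ∀ k, s k ≠ p := by
    intro k h
    have h1 : (s k : ℕ) = n - 3 := congrArg Fin.val h
    have := k.2
    rw [hs] at h1
    split_ifs at h1 <;> omega
  have hr : ∀ k, s k ≠ r := by
    intro k h
    have h1 : (s k : ℕ) = n - 1 := congrArg Fin.val h
    have := k.2
    rw [hs] at h1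
    split_ifs at h1 <;> omega
  have hpr : p ≠ r := by
    intro h
    have h1 : n - 3 = n - 1 := congrArg Fin.val h
    omega
  have htp : ∀ k, t k = p ↔ k = z := by
    intro k
    rw [Fin.ext_iff, Fin.ext_iff, ht]
    change _ = n - 3 ↔ (k : ℕ) = 0
    split_ifs <;> omega
  have hzr : ∀ k, ¬ (s k = s z ∧ t k = r) := by
    rintro k ⟨h1, h2⟩
    have h3 : (s k : ℕ) = 0 := by rw [h1, hs]; simp [z]
    have h4 : (t k : ℕ) = n - 1 := congrArg Fin.val h2
    rw [hs] at h3
    rw [ht] at h4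
    split_ifs at * <;> omega
  have hinj : ∀ k l, s k = s l → t k = t l → k = l := by
    intro k l h1 h2
    have h3 := congrArg Fin.val h1
    have h4 := congrArg Fin.val h2
    rw [hs, hs] at h3
    rw [ht, ht] at h4
    apply Fin.ext
    split_ifs at * <;> omega
  have hli := linearIndependent_elementaryFrame hp hr hpr hzr hinj
  have hEE := elementaryFrame_mul hst hr hpr htp
  have hES := elementaryFrame_mul_single (z := z) (p := p) hst hr
  have hSE := single_mul_elementaryFrame (t := t) (z := z) hr hpr
  exact ⟨quadraticSubgroup hEE hES hSE hli, quadraticSubgroup_mem_AbHat hEE hES hSE hli,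
    fun W hW => not_forall_quadraticSubgroup_mem hEE hES hSE hli hW⟩

theorem Red_ssubset_Ab (hn : 5 ≤ n) : Red n ⊂ Ab n := by
  have hn1 : 1 ≤ n := by omega
  refine ⟨Set.image_mono fun L hL => mem_AbHat_of_isConjLimit hn1 hL, fun hsub => ?_⟩
  obtain ⟨G, hG, hGW⟩ := exists_mem_AbHat_not_forall_mem hn
  obtain ⟨L, hL, hLG⟩ := hsub ⟨G, hG, rfl⟩
  obtain ⟨g, hg⟩ : ∃ g, conj g L = G := Quotient.exact hLG
  obtain ⟨W, hW, hLW⟩ := exists_submodule_of_mem_RedHat hn1 hL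
  obtain ⟨W', hW', hGW'⟩ := exists_submodule_of_conj g hW hLW
  exact hGW W' hW' (hg ▸ hGW')

end Example
end ConjLimit

theorem theorem2 (n : ℕ) (hn : 1 ≤ n) :
    (n ≤ 4 → ConjLimit.Ab n = ConjLimit.Red n) ∧
      (5 ≤ n → ConjLimit.Red n ⊂ ConjLimit.Ab n) :=
  ⟨ConjLimit.Ab_eq_Red hn, ConjLimit.Red_ssubset_Ab⟩
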